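/- Let $L$ be a $\mathbb{Z}$-Lie algebra of rank $3$, that is, a Lie ring whose additive group is free abelian of rank $d=3$. For a prime $p$ let $L(\mathbb{Z}_p)=L\otimes_{\mathbb{Z}}\mathbb{Z}_p$. For a $\mathbb{Z}_p$-Lie subalgebra $\Lambda\le L(\mathbb{Z}_p)$ of finite index, let $\alpha_i(\Lambda)=|\mathbb{Z}_p/I_i|$ $(1\le i\le d)$, where $0\neq I_1\subseteq I_2\subseteq\cdots\subseteq I_d$ are the unique ideals of $\mathbb{Z}_p$ with $L(\mathbb{Z}_p)/\Lambda\cong\bigoplus_{i=1}^{d}\mathbb{Z}_p/I_i$. Put $$\zeta_{L(\mathbb{Z}_p)}(s)=\sum_{\Lambda}|L(\mathbb{Z}_p):\Lambda|^{-s},\qquad \zeta^{\mathrm{co}}_{L(\mathbb{Z}_p)}(s_1,\ldots,s_d)=\sum_{\Lambda}\alpha_1(\Lambda)^{-s_1}\cdots\alpha_d(\Lambda)^{-s_d},$$ both sums running over all $\mathbb{Z}_p$-Lie subalgebras $\Lambda$ of finite index in $L(\mathbb{Z}_p)$, where $s,s_1,\ldots,s_d$ are complex variables with sufficiently large real parts.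 These are the local (Euler) factors of the subalgebra zeta function $\zeta_L(s)$ and of the subalgebra cotype zeta function $\zeta_L^{\mathrm{co}}(\boldsymbol{s})$ of $L$. Call $\zeta_L(s)$ *finitely uniform* if there are finitely many rational functions $W_1,\ldots,W_k\in\mathbb{Q}(X,Y)$ such that for every prime $p$ there is an $i$ with $\zeta_{L(\mathbb{Z}_p)}(s)=W_i(p,p^{-s})$, and *uniform* if there is a single $W\in\mathbb{Q}(X,Y)$ such that $\zeta_{L(\mathbb{Z}_p)}(s)=W(p,p^{-s})$ for all but finitely many primes $p$. Define finite uniformity and uniformity of $\zeta_L^{\mathrm{co}}(\boldsymbol{s})$ in the same way, with rational functions in $\mathbb{Q}(X,Y_1,\ldots,Y_d)$ and the identities $\zeta^{\mathrm{co}}_{L(\mathbb{Z}_p)}(\boldsymbol{s})=W(p,p^{-s_1},\ldots,p^{-s_d})$. (The identities are between meromorphic functions on a domain where all real parts are sufficiently large, and they include that the series converges absolutely there and that $W$ can be specialized at $X=p$, i.e. that $W$ can be written as $P/Q$ with polynomials $P,Q$ such that $Q$ does not vanish identically at $X=p$.) Then: 1. $\zeta_L(s)$ is finitely uniform; 2.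 $\zeta_L(s)$ is uniform if and only if $\zeta_L^{\mathrm{co}}(\boldsymbol{s})$ is uniform; 3. $\zeta_L(s)$ is finitely uniform if and only if $\zeta_L^{\mathrm{co}}(\boldsymbol{s})$ is finitely uniform. -/

import Mathlib

open scoped TensorProduct

section RationalFunctions

variable {ι : Type}

/-- The field `ℚ(X, (Y_i)_{i ∈ ι})` of rational functions in one variable `X` (the variable `none`)
and variables `Y_i` (the variables `some i`). -/
abbrev RatXY (ι : Type) : Type := FractionRing (MvPolynomial (Option ι) ℚ)

/-- The partial specialization `P(q, Y) ∈ ℚ[Y_i : i ∈ ι]` of a polynomial `P(X, Y)`. -/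
noncomputable def specializeX (q : ℕ) (P : MvPolynomial (Option ι) ℚ) : MvPolynomial ι ℚ :=
  MvPolynomial.aeval
    (fun o : Option ι => o.elim (MvPolynomial.C (q : ℚ)) (fun i => MvPolynomial.X i)) P

/-- The complex number `P(q, (q^{-s_i})_i)`. -/
noncomputable def evalAt (q : ℕ) (s : ι → ℂ) (P : MvPolynomial (Option ι) ℚ) : ℂ :=
  MvPolynomial.aeval (fun o : Option ι => o.elim (q : ℂ) (fun i => (q : ℂ) ^ (-s i))) P

/-- The identity `∑_a term a s = W(q, (q^{-s_i})_i)` between a Dirichlet series in the complex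
variables `s = (s_i)_i` and a rational function: the series converges absolutely as soon as
all the real parts `Re s_i` are large, and it agrees there with the right-hand side.
That the specialization `W(q, Y)` makes sense as a rational function means that `W = P / Q` for some
polynomials with `Q(q, Y) ≠ 0` in `ℚ[Y]`. Since the nonzero function `Q(q, q^{-s})` may still have
zeros, the equality of meromorphic functions is written with the denominator cleared. -/
def SeriesEqRat {α : Type*} (q : ℕ) (term : α → (ι → ℂ) → ℂ) (W : RatXY ι) : Prop :=
  ∃ P Q : MvPolynomial (Option ι) ℚ,
    W = algebraMap (MvPolynomial (Option ι) ℚ) (RatXY ι) P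
      / algebraMap (MvPolynomial (Option ι) ℚ) (RatXY ι) Q ∧
    specializeX q Q ≠ 0 ∧
    ∃ σ : ℝ, ∀ s : ι → ℂ, (∀ i, σ < (s i).re) →
      Summable (fun a => term a s) ∧
      evalAt q s Q * ∑' a, term a s = evalAt q s P

/-- A family, indexed by the primes `p`, of Dirichlet series `∑_a term p a s` is finitely uniform:
finitely many rational functions `W_1, …, W_k` over `ℚ` suffice to describe all of them. -/
def FinitelyUniform {α : (p : ℕ) → [Fact p.Prime] → Type*}
    (term : (p : ℕ) → [Fact p.Prime] → α p → (ι → ℂ) → ℂ) : Prop :=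
  ∃ (k : ℕ) (W : Fin k → RatXY ι),
    ∀ (p : ℕ) [Fact p.Prime], ∃ i : Fin k, SeriesEqRat p (term p) (W i)

/-- The family is uniform: one rational function describes the series at all but finitely
many primes. -/
def Uniform {α : (p : ℕ) → [Fact p.Prime] → Type*}
    (term : (p : ℕ) → [Fact p.Prime] → α p → (ι → ℂ) → ℂ) : Prop :=
  ∃ (W : RatXY ι) (S : Finset ℕ),
    ∀ (p : ℕ) [Fact p.Prime], p ∉ S → SeriesEqRat p (term p) W

end RationalFunctions

section Cotype

variable {R M : Type*} [CommRing R] [AddCommGroup M] [Module R M]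

/-- `I_1 ⊆ I_2 ⊆ ⋯ ⊆ I_d` are nonzero ideals of `R` with `M / N ≅ R/I_1 ⊕ ⋯ ⊕ R/I_d`. -/
def IsCotypeChain {d : ℕ} (N : Submodule R M) (I : Fin d → Ideal R) : Prop :=
  Monotone I ∧ (∀ i, I i ≠ ⊥) ∧ Nonempty ((M ⧸ N) ≃ₗ[R] ((i : Fin d) → R ⧸ I i))

open Classical in
/-- The cotype `(α_1(N), …, α_d(N))` of a submodule `N` of finite index in a module `M` of rank `d`:
`α_i(N) = |R / I_i|`, where `I_1 ⊆ ⋯ ⊆ I_d` are the nonzero ideals with `M / N ≅ ⨁ R / I_i`.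
(These ideals are uniquely determined; for `R = ℤ_p` they exist by `exists_isCotypeChain`.) -/
noncomputable def cotype (d : ℕ) (N : Submodule R M) (i : Fin d) : ℕ :=
  if h : ∃ I : Fin d → Ideal R, IsCotypeChain N I then Nat.card (R ⧸ h.choose i) else 0

end Cotype

/-- Every `ℤ_p`-submodule of finite index in a free `ℤ_p`-module of rank `d` has a cotype. -/
theorem exists_isCotypeChain (p : ℕ) [Fact p.Prime] {M : Type*} [AddCommGroup M] [Module ℤ_[p] M]
    [Module.Free ℤ_[p] M] [Module.Finite ℤ_[p] M] (d : ℕ) (hd : Module.finrank ℤ_[p] M = d)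
    (N : Submodule ℤ_[p] M) (hN : Finite (M ⧸ N)) :
    ∃ I : Fin d → Ideal ℤ_[p], IsCotypeChain N I := by
  have htors : Module.IsTorsion ℤ_[p] (M ⧸ N) := by
    intro x
    have hinj : ¬ Function.Injective (fun r : ℤ_[p] => r • x) := not_injective_infinite_finite _
    simp only [Function.Injective, not_forall] at hinj
    obtain ⟨a, b, hab, hne⟩ := hinj
    exact ⟨⟨a - b, mem_nonZeroDivisors_of_ne_zero (sub_ne_zero.mpr hne)⟩, by
      simpa [Submonoid.smul_def, sub_smul, sub_eq_zero] using hab⟩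
  have hfin : Module.finrank ℤ_[p] N = Module.finrank ℤ_[p] M := by
    have h1 := Submodule.finrank_quotient_add_finrank N
    have h2 : Module.finrank ℤ_[p] (M ⧸ N) = 0 := Module.finrank_eq_zero_iff_isTorsion.mpr htors
    omega
  let b : Module.Basis (Fin d) ℤ_[p] M := Module.finBasisOfFinrankEq ℤ_[p] M hd
  let J : Fin d → Ideal ℤ_[p] := fun i => Ideal.span {Submodule.smithNormalFormCoeffs b hfin i}
  have hsort : ∃ e : Equiv.Perm (Fin d), Monotone (J ∘ e) := by
    classical
    let _ : LinearOrder (Ideal ℤ_[p]) :=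
      { (inferInstance : PartialOrder (Ideal ℤ_[p])) with
        le_total := fun I J => Std.Total.total I J
        toDecidableLE := Classical.decRel _
        min := fun a b => if a ≤ b then a else b
        max := fun a b => if a ≤ b then b else a
        min_def := fun a b => by congr
        max_def := fun a b => by congr }
    exact ⟨Tuple.sort J, Tuple.monotone_sort J⟩
  obtain ⟨e, he⟩ := hsort
  refine ⟨J ∘ e, he, fun i => ?_, ⟨?_⟩⟩
  · simp [J, Submodule.smithNormalFormCoeffs_ne_zero]
  · exact (N.quotientEquivPiSpan b hfin).trans
      (LinearEquiv.piCongrLeft ℤ_[p] (fun i => ℤ_[p] ⧸ J i) e).symm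

section SubalgebraZeta

variable (L : Type*) [LieRing L]

/-- The finite-index `ℤ_p`-subalgebras of `L(ℤ_p) = L ⊗ ℤ_p`. -/
abbrev LocalSubalgebra (p : ℕ) [Fact p.Prime] : Type _ :=
  {Λ : LieSubalgebra ℤ_[p] (ℤ_[p] ⊗[ℤ] L) // Finite ((ℤ_[p] ⊗[ℤ] L) ⧸ Λ.toSubmodule)}

/-- The term `|L(ℤ_p) : Λ|^{-s}` of the local subalgebra zeta function
`ζ_{L(ℤ_p)}(s) = ∑_Λ |L(ℤ_p) : Λ|^{-s}` (one complex variable `s = s ()`). -/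
noncomputable def zetaTerm (p : ℕ) [Fact p.Prime] (Λ : LocalSubalgebra L p) (s : Unit → ℂ) : ℂ :=
  (Nat.card ((ℤ_[p] ⊗[ℤ] L) ⧸ Λ.1.toSubmodule) : ℂ) ^ (-s ())

/-- The term `α_1(Λ)^{-s_1} ⋯ α_d(Λ)^{-s_d}` of the local subalgebra cotype zeta function
`ζ^{co}_{L(ℤ_p)}(s_1, …, s_d)`, where `d` is the rank of `L`. -/
noncomputable def cotypeZetaTerm (d : ℕ) (p : ℕ) [Fact p.Prime] (Λ : LocalSubalgebra L p)
    (s : Fin d → ℂ) : ℂ :=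
  ∏ i, (cotype d Λ.1.toSubmodule i : ℂ) ^ (-s i)

/-- The subalgebra zeta function `ζ_L(s)` is finitely uniform. -/
def ZetaFinitelyUniform : Prop := FinitelyUniform (fun p [Fact p.Prime] => zetaTerm L p)

/-- The subalgebra zeta function `ζ_L(s)` is uniform. -/
def ZetaUniform : Prop := Uniform (fun p [Fact p.Prime] => zetaTerm L p)

/-- The subalgebra cotype zeta function `ζ^{co}_L(s_1, …, s_d)` is finitely uniform. -/
def CotypeZetaFinitelyUniform (d : ℕ) : Prop :=
  FinitelyUniform (fun p [Fact p.Prime] => cotypeZetaTerm L d p)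

/-- The subalgebra cotype zeta function `ζ^{co}_L(s_1, …, s_d)` is uniform. -/
def CotypeZetaUniform (d : ℕ) : Prop := Uniform (fun p [Fact p.Prime] => cotypeZetaTerm L d p)

end SubalgebraZeta

/-!
Over `ℤ_p` a product on a lattice of rank three is a linear map from `⋀² L ≅ L^*` to `L`, hence the
same thing as a bilinear form on the dual lattice; the quadratic form of this bilinear form, `qf`
of the matrix of structure constants, governs all the subalgebras. A sublattice of finite index is
`p^c N`, where `N` has elementary divisors `p^(l+k)`, `p^l`, `1`, and `N` is the common kernel of
two functionals with values in `ℤ/p^(l+k)` and `ℤ/p^l`. The sublattice `p^c N` is a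
subalgebra if and only if the quadratic form is divisible by `p^(k-c)` at the first of these
functionals (`closed_iff`); neither the second functional nor the Jacobi identity plays a role.
Counting surjections and dividing by the order of the automorphism group of the quotient, one finds
that the number of subalgebras of type `(c, l, k)` is an explicit polynomial in `p` times the
probability that the form is divisible by `p^(k-c)` at a primitive vector
(`card_closedLattice_eq`).

The triple sum over the types is therefore a rational expression in the generating function of these
probabilities (`tsum_types`). To evaluate the latter, the form is written over `ℤ` as a nondegenerate
form in `r` essential variables (`exists_isReduced`). Hensel's lemma (`hensel`) shows
that the densities of the zeros which are primitive in the essential variables form a geometric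
progression from some index on, so the generating function is rational at each prime
(`tsum_primitiveDensity`). At the primes not dividing a certain integer `D ≠ 0` the progression
starts at once, and its first term is the number of points of a form over `𝔽_p`
(`card_zeros_mod_p`): it is `0` for `r ≤ 1`, `p^2 - 1` for `r = 3`, and for `r = 2` either `0` or
`2 (p^2 - p)`, depending on whether the form splits modulo `p`. So two rational functions
suffice for almost all primes, and each of the remaining primes can be given a function of its own:
both zeta functions are finitely uniform (`finitelyUniform_mergedTerm`).

The subalgebra zeta function is obtained from the cotype zeta function by giving all the variables
`s_i` the same value. All of the above is done for an arbitrary identification `j` of the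
variables (`mergedTerm`), and the two rational functions of the case `r = 2` differ under every
identification (`zetaNum_split_ne`). As a rational function is determined by its specializations at
infinitely many primes, either zeta function is uniform if and only if `r ≠ 2`, or almost all primes
split, or almost all primes do not, and this condition is the same for both (`exists_uniform_iff`).
-/

open scoped TensorProduct

namespace CotypeZeta

/-! ### The rings `ℤ_p / p^m` -/

/-- Fibres of a surjective homomorphism of groups all have the size of the kernel. -/
theorem card_subtype_comp {G H : Type*} [AddCommGroup G] [AddCommGroup H] (f : G →+ H)
    (hf : Function.Surjective f) (P : H → Prop) :
    Nat.card {g // P (f g)} = Nat.card f.ker * Nat.card {h // P h} := by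
  have hs := Function.surjInv_eq hf
  rw [← Nat.card_prod]
  refine Nat.card_congr
    { toFun := fun g => (⟨g.1 - Function.surjInv hf (f g.1), ?_⟩, ⟨f g.1, g.2⟩)
      invFun := fun x => ⟨x.1.1 + Function.surjInv hf x.2.1, ?_⟩
      left_inv := fun g => ?_
      right_inv := fun x => ?_ }
  · simp [AddMonoidHom.mem_ker, hs]
  · have := x.1.2
    rw [AddMonoidHom.mem_ker] at this
    rw [map_add, this, hs, zero_add]
    exact x.2.2
  · simp
  · have := x.1.2
    rw [AddMonoidHom.mem_ker] at this
    ext <;> simp [this, hs]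

theorem card_ker_mul_card {G H : Type*} [AddCommGroup G] [AddCommGroup H] (f : G →+ H)
    (hf : Function.Surjective f) : Nat.card f.ker * Nat.card H = Nat.card G := by
  have := card_subtype_comp f hf (fun _ => True)
  rw [Nat.card_congr (Equiv.subtypeUnivEquiv (fun _ => trivial)),
    Nat.card_congr (Equiv.subtypeUnivEquiv (fun _ => trivial))] at this
  exact this.symm

section

variable (p : ℕ) [Fact p.Prime]

/-- The quotient ring `ℤ_p / p^m`. -/
abbrev S (m : ℕ) : Type := ℤ_[p] ⧸ Ideal.span {(p : ℤ_[p]) ^ m}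

/-- The ring isomorphism `ℤ_p / p^m ≃ ℤ / p^m`. -/
noncomputable def equivZMod (m : ℕ) : S p m ≃+* ZMod (p ^ m) :=
  (Ideal.quotEquivOfEq (PadicInt.ker_toZModPow m).symm).trans
    (RingHom.quotientKerEquivOfSurjective (ZMod.ringHom_surjective (PadicInt.toZModPow m)))

theorem card_S (m : ℕ) : Nat.card (S p m) = p ^ m := by
  rw [Nat.card_congr (equivZMod p m).toEquiv, Nat.card_zmod]

instance (m : ℕ) : Finite (S p m) := by
  have : NeZero (p ^ m) := ⟨pow_ne_zero _ (Fact.out : p.Prime).ne_zero⟩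
  exact Finite.of_equiv _ (equivZMod p m).symm.toEquiv

instance subsingleton_S_zero : Subsingleton (S p 0) := by
  rw [Ideal.Quotient.subsingleton_iff]
  simp

variable {p}

theorem p_ne_zero : (p : ℤ_[p]) ≠ 0 := by
  exact_mod_cast (Fact.out : p.Prime).ne_zero

theorem mk_eq_zero_iff {m : ℕ} {x : ℤ_[p]} :
    (Ideal.Quotient.mk _ x : S p m) = 0 ↔ (p : ℤ_[p]) ^ m ∣ x := by
  rw [Ideal.Quotient.eq_zero_iff_mem, Ideal.mem_span_singleton]

theorem mk_eq_mk_iff {m : ℕ} {x y : ℤ_[p]} :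
    (Ideal.Quotient.mk _ x : S p m) = Ideal.Quotient.mk _ y ↔ (p : ℤ_[p]) ^ m ∣ x - y := by
  rw [← sub_eq_zero, ← map_sub, mk_eq_zero_iff]

theorem pow_dvd_mk_iff {m n : ℕ} (h : n ≤ m) {x : ℤ_[p]} :
    (p : S p m) ^ n ∣ Ideal.Quotient.mk _ x ↔ (p : ℤ_[p]) ^ n ∣ x := by
  constructor
  · rintro ⟨c, hc⟩
    obtain ⟨c, rfl⟩ := Ideal.Quotient.mk_surjective c
    have : (Ideal.Quotient.mk _ x : S p m) = Ideal.Quotient.mk _ ((p : ℤ_[p]) ^ n * c) := by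
      rw [hc]; simp
    rw [mk_eq_mk_iff] at this
    have h2 := (pow_dvd_pow (p : ℤ_[p]) h).trans this
    exact (dvd_sub_left (Dvd.intro _ rfl)).mp h2
  · rintro ⟨c, rfl⟩
    exact ⟨Ideal.Quotient.mk _ c, by simp⟩

theorem isUnit_iff_not_dvd (x : ℤ_[p]) : IsUnit x ↔ ¬ (p : ℤ_[p]) ∣ x := by
  rw [← not_iff_not, not_not, ← mem_nonunits_iff, PadicInt.mem_nonunits,
    PadicInt.norm_lt_one_iff_dvd]

theorem isUnit_mk_iff {m : ℕ} (hm : m ≠ 0) {x : ℤ_[p]} :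
    IsUnit (Ideal.Quotient.mk _ x : S p m) ↔ IsUnit x := by
  refine ⟨fun h => ?_, fun h => h.map _⟩
  obtain ⟨c, hc⟩ := h.exists_right_inv
  obtain ⟨c, rfl⟩ := Ideal.Quotient.mk_surjective c
  rw [← map_mul, ← map_one (Ideal.Quotient.mk _), mk_eq_mk_iff] at hc
  by_contra hx
  rw [isUnit_iff_not_dvd, not_not] at hx
  have h1 : (p : ℤ_[p]) ∣ 1 := by
    have h2 := (dvd_pow_self (p : ℤ_[p]) hm).trans hc
    exact (dvd_sub_right (hx.mul_right c)).mp h2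
  exact PadicInt.prime_p.not_isUnit (isUnit_of_dvd_one h1)

theorem not_isUnit_iff {m : ℕ} (hm : m ≠ 0) {x : S p m} :
    ¬ IsUnit x ↔ (p : S p m) ∣ x := by
  obtain ⟨x, rfl⟩ := Ideal.Quotient.mk_surjective x
  rw [isUnit_mk_iff hm, isUnit_iff_not_dvd, not_not]
  have := pow_dvd_mk_iff (p := p) (n := 1) (Nat.one_le_iff_ne_zero.mpr hm) (x := x)
  simpa using this.symm

theorem card_nonunits (m : ℕ) : Nat.card {x : S p (m + 1) // ¬ IsUnit x} = p ^ m := by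
  have hle : Ideal.span {(p : ℤ_[p]) ^ (m + 1)} ≤ Ideal.span {(p : ℤ_[p]) ^ 1} := by
    rw [Ideal.span_singleton_le_span_singleton]
    exact pow_dvd_pow _ (by omega)
  let f : S p (m + 1) →+* S p 1 := Ideal.Quotient.factor hle
  have hf : Function.Surjective f := Ideal.Quotient.factor_surjective hle
  have h1 := card_ker_mul_card f.toAddMonoidHom hf
  have h2 : Nat.card {x : S p (m + 1) // ¬ IsUnit x} = Nat.card f.toAddMonoidHom.ker := by
    refine Nat.card_congr (Equiv.subtypeEquivRight fun x => ?_)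
    rw [not_isUnit_iff (by omega), AddMonoidHom.mem_ker]
    obtain ⟨x, rfl⟩ := Ideal.Quotient.mk_surjective x
    have h3 := pow_dvd_mk_iff (p := p) (m := m + 1) (n := 1) (by omega) (x := x)
    rw [pow_one, pow_one] at h3
    rw [h3]
    change _ ↔ f (Ideal.Quotient.mk _ x) = 0
    rw [Ideal.Quotient.factor_mk, mk_eq_zero_iff, pow_one]
  rw [h2]
  rw [card_S, card_S] at h1
  exact Nat.eq_of_mul_eq_mul_right (pow_pos (Fact.out : p.Prime).pos 1) (h1.trans (pow_add p m 1))

/-- The number of primitive vectors. -/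
theorem card_primitive (ι : Type) [Fintype ι] (m : ℕ) :
    Nat.card {w : ι → S p (m + 1) // ∃ i, IsUnit (w i)} + p ^ (m * Fintype.card ι)
      = p ^ ((m + 1) * Fintype.card ι) := by
  classical
  have h1 : Nat.card {w : ι → S p (m + 1) // ¬ ∃ i, IsUnit (w i)} = p ^ (m * Fintype.card ι) := by
    have e : {w : ι → S p (m + 1) // ¬ ∃ i, IsUnit (w i)} ≃
        (ι → {x : S p (m + 1) // ¬ IsUnit x}) :=
      (Equiv.subtypeEquivRight (by simp)).trans
        (Equiv.subtypePiEquivPi (p := fun (_ : ι) (x : S p (m + 1)) => ¬ IsUnit x))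
    rw [Nat.card_congr e, Nat.card_pi]
    simp [card_nonunits, pow_mul]
  have h2 := Nat.card_congr (Equiv.sumCompl (fun w : ι → S p (m + 1) => ∃ i, IsUnit (w i)))
  rw [Nat.card_sum, h1, Nat.card_pi] at h2
  simpa [card_S, pow_mul] using h2

end

/-! ### Elementary divisor types of lattices -/

section

variable {p : ℕ} [Fact p.Prime]

/-- The sublattice `N` of `ℤ_p^n` has elementary divisors `p^{a_i}` with respect to some basis. -/
def HasType {n : ℕ} (a : Fin n → ℕ) (N : Submodule ℤ_[p] (Fin n → ℤ_[p])) : Prop :=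
  ∃ b : Module.Basis (Fin n) ℤ_[p] (Fin n → ℤ_[p]),
    ∀ x, x ∈ N ↔ ∀ i, (p : ℤ_[p]) ^ a i ∣ b.repr x i

theorem exists_hasType {n : ℕ} (N : Submodule ℤ_[p] (Fin n → ℤ_[p]))
    (hN : Finite ((Fin n → ℤ_[p]) ⧸ N)) : ∃ a : Fin n → ℕ, Antitone a ∧ HasType a N := by
  have htors : Module.IsTorsion ℤ_[p] ((Fin n → ℤ_[p]) ⧸ N) := by
    intro x
    have hinj : ¬ Function.Injective (fun r : ℤ_[p] => r • x) := not_injective_infinite_finite _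
    simp only [Function.Injective, not_forall] at hinj
    obtain ⟨a, b, hab, hne⟩ := hinj
    exact ⟨⟨a - b, mem_nonZeroDivisors_of_ne_zero (sub_ne_zero.mpr hne)⟩, by
      simpa [Submonoid.smul_def, sub_smul, sub_eq_zero] using hab⟩
  have hfin : Module.finrank ℤ_[p] N = Module.finrank ℤ_[p] (Fin n → ℤ_[p]) := by
    have h1 := Submodule.finrank_quotient_add_finrank N
    have h2 : Module.finrank ℤ_[p] ((Fin n → ℤ_[p]) ⧸ N) = 0 :=
      Module.finrank_eq_zero_iff_isTorsion.mpr htors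
    omega
  obtain ⟨b, a, ab, hab⟩ :=
    Submodule.exists_smith_normal_form_of_rank_eq (Pi.basisFun ℤ_[p] (Fin n)) hfin
  have ha : ∀ i, a i ≠ 0 := fun i h => ab.ne_zero i (by ext1; simp [hab, h])
  have hmem : ∀ x, x ∈ N ↔ ∀ i, (p : ℤ_[p]) ^ (a i).valuation ∣ b.repr x i := by
    intro x
    have hd : ∀ (i) (y : ℤ_[p]), (p : ℤ_[p]) ^ (a i).valuation ∣ y ↔ a i ∣ y := by
      intro i y
      conv_rhs => rw [PadicInt.unitCoeff_spec (ha i)]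
      rw [Units.mul_left_dvd]
    simp_rw [hd, ab.mem_submodule_iff', hab]
    have : ∀ (c : Fin n → ℤ_[p]) (i), b.repr (∑ j, c j • a j • b j) i = a i * c i := by
      intro c i
      simp only [← mul_smul, b.repr_sum_self, mul_comm]
    constructor
    · rintro ⟨c, rfl⟩ i
      exact ⟨c i, this c i⟩
    · intro h
      choose c hc using h
      exact ⟨c, b.ext_elem fun i => (hc i).trans (this c i).symm⟩
  let e := Tuple.sort (fun i => OrderDual.toDual (a i).valuation)
  refine ⟨fun i => (a (e i)).valuation, ?_, b.reindex e.symm, fun x => ?_⟩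
  · exact fun i j h => Tuple.monotone_sort (fun i => OrderDual.toDual (a i).valuation) h
  · rw [hmem]
    simp only [Module.Basis.repr_reindex_apply, Equiv.symm_symm]
    exact (Equiv.forall_congr_right (q := fun i => (p : ℤ_[p]) ^ (a i).valuation ∣ b.repr x i)
      e).symm

theorem HasType.quotientEquiv {n : ℕ} {a : Fin n → ℕ} {N : Submodule ℤ_[p] (Fin n → ℤ_[p])}
    (h : HasType a N) : Nonempty (((Fin n → ℤ_[p]) ⧸ N) ≃ₗ[ℤ_[p]] ((i : Fin n) → S p (a i))) := by
  obtain ⟨b, hb⟩ := h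
  let f : (Fin n → ℤ_[p]) →ₗ[ℤ_[p]] ((i : Fin n) → S p (a i)) :=
    LinearMap.pi fun i => (Submodule.mkQ _).comp (b.coord i)
  have hf : Function.Surjective f := by
    intro y
    choose z hz using fun i => Ideal.Quotient.mk_surjective (y i)
    refine ⟨b.equivFun.symm z, funext fun i => ?_⟩
    rw [← hz]
    exact congrArg (Ideal.Quotient.mk _) (congrFun (b.equivFun.apply_symm_apply z) i)
  have hN : N = LinearMap.ker f := by
    ext x
    rw [hb, LinearMap.mem_ker, funext_iff]
    refine forall_congr' fun i => ?_
    change _ ↔ Ideal.Quotient.mk _ (b.repr x i) = 0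
    rw [mk_eq_zero_iff]
  exact ⟨(Submodule.quotEquivOfEq _ _ hN).trans (f.quotKerEquivOfSurjective hf)⟩

theorem HasType.finite {n : ℕ} {a : Fin n → ℕ} {N : Submodule ℤ_[p] (Fin n → ℤ_[p])}
    (h : HasType a N) : Finite ((Fin n → ℤ_[p]) ⧸ N) := by
  obtain ⟨e⟩ := h.quotientEquiv
  exact Finite.of_equiv _ e.symm.toEquiv

/-- The lattice `⨁ p^{a_i} ℤ_p`. -/
theorem exists_of_type {n : ℕ} (a : Fin n → ℕ) :
    ∃ N : Submodule ℤ_[p] (Fin n → ℤ_[p]), HasType a N := by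
  refine ⟨Submodule.pi Set.univ fun i => Ideal.span {(p : ℤ_[p]) ^ a i},
    Pi.basisFun ℤ_[p] (Fin n), fun x => ?_⟩
  simp [Submodule.mem_pi, Ideal.mem_span_singleton]

theorem card_torsion_S (m j : ℕ) :
    Nat.card {x : S p m // (p : ℤ_[p]) ^ j • x = 0} = p ^ min m j := by
  rcases le_total m j with h | h
  · rw [min_eq_left h, ← card_S p m]
    refine Nat.card_congr (Equiv.subtypeUnivEquiv fun x => ?_)
    obtain ⟨x, rfl⟩ := Ideal.Quotient.mk_surjective x
    change (Ideal.Quotient.mk _ ((p : ℤ_[p]) ^ j * x) : S p m) = 0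
    rw [mk_eq_zero_iff]
    exact (pow_dvd_pow _ h).mul_right x
  · obtain ⟨k, rfl⟩ := Nat.exists_eq_add_of_le h
    rw [min_eq_right h]
    have hle : Ideal.span {(p : ℤ_[p]) ^ (j + k)} ≤ Ideal.span {(p : ℤ_[p]) ^ k} := by
      rw [Ideal.span_singleton_le_span_singleton]
      exact pow_dvd_pow _ (by omega)
    let f : S p (j + k) →+* S p k := Ideal.Quotient.factor hle
    have hf : Function.Surjective f := Ideal.Quotient.factor_surjective hle
    have h1 := card_ker_mul_card f.toAddMonoidHom hf
    have h2 : Nat.card {x : S p (j + k) // (p : ℤ_[p]) ^ j • x = 0}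
        = Nat.card f.toAddMonoidHom.ker := by
      refine Nat.card_congr (Equiv.subtypeEquivRight fun x => ?_)
      obtain ⟨x, rfl⟩ := Ideal.Quotient.mk_surjective x
      change (Ideal.Quotient.mk _ ((p : ℤ_[p]) ^ j * x) : S p (j + k)) = 0
        ↔ f (Ideal.Quotient.mk _ x) = 0
      rw [Ideal.Quotient.factor_mk, mk_eq_zero_iff, mk_eq_zero_iff, pow_add,
        mul_dvd_mul_iff_left (pow_ne_zero _ p_ne_zero)]
    rw [h2]
    rw [card_S, card_S] at h1
    exact Nat.eq_of_mul_eq_mul_right (pow_pos (Fact.out : p.Prime).pos k) (h1.trans (pow_add p j k))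

theorem antitone_eq_of_card {n : ℕ} {a b : Fin n → ℕ} (ha : Antitone a) (hb : Antitone b)
    (h : ∀ j, ∑ i, min (a i) j = ∑ i, min (b i) j) : a = b := by
  have key : ∀ {a b : Fin n → ℕ}, Antitone a → Antitone b →
      (∀ j, ∑ i, min (a i) j = ∑ i, min (b i) j) → ∀ i, b i ≤ a i := by
    intro a b ha hb h i
    by_contra! hlt
    have hcount : ∀ (c : Fin n → ℕ) (j : ℕ), ∑ i, min (c i) (j + 1)
        = ∑ i, min (c i) j + (Finset.univ.filter fun i => j < c i).card := by
      intro c j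
      rw [Finset.card_filter, ← Finset.sum_add_distrib]
      refine Finset.sum_congr rfl fun i _ => ?_
      split_ifs <;> omega
    have h1 : (Finset.univ.filter fun k => a i < a k).card
        = (Finset.univ.filter fun k => a i < b k).card := by
      have := h (a i + 1)
      rw [hcount, hcount, h (a i)] at this
      omega
    have h2 : (Finset.univ.filter fun k => a i < a k) ⊂ Finset.univ.filter fun k => a i < b k := by
      refine (Finset.ssubset_iff_of_subset fun k hk => ?_).mpr ⟨i, by simpa using hlt, by simp⟩
      simp only [Finset.mem_filter, Finset.mem_univ, true_and] at hk ⊢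
      have hki : k ≤ i := by
        by_contra! hki
        exact absurd (ha hki.le) (by omega)
      exact hlt.trans_le (hb hki)
    exact absurd h1 (Finset.card_lt_card h2).ne
  funext i
  exact le_antisymm (key hb ha (fun j => (h j).symm) i) (key ha hb h i)

theorem type_unique {n : ℕ} {a b : Fin n → ℕ} (ha : Antitone a) (hb : Antitone b)
    (e : ((i : Fin n) → S p (a i)) ≃ₗ[ℤ_[p]] ((i : Fin n) → S p (b i))) : a = b := by
  refine antitone_eq_of_card ha hb fun j => ?_
  have hcard : ∀ c : Fin n → ℕ, Nat.card {x : (i : Fin n) → S p (c i) //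
      (p : ℤ_[p]) ^ j • x = 0} = p ^ ∑ i, min (c i) j := by
    intro c
    have e : {x : (i : Fin n) → S p (c i) // (p : ℤ_[p]) ^ j • x = 0} ≃
        ((i : Fin n) → {x : S p (c i) // (p : ℤ_[p]) ^ j • x = 0}) :=
      (Equiv.subtypeEquivRight (by simp [funext_iff])).trans
        (Equiv.subtypePiEquivPi (p := fun i (x : S p (c i)) => (p : ℤ_[p]) ^ j • x = 0))
    rw [Nat.card_congr e, Nat.card_pi, ← Finset.prod_pow_eq_pow_sum]
    exact Finset.prod_congr rfl fun i _ => card_torsion_S _ _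
  have h : Nat.card {x : (i : Fin n) → S p (a i) // (p : ℤ_[p]) ^ j • x = 0}
      = Nat.card {x : (i : Fin n) → S p (b i) // (p : ℤ_[p]) ^ j • x = 0} := by
    refine Nat.card_congr (e.toEquiv.subtypeEquiv fun x => ?_)
    change _ ↔ (p : ℤ_[p]) ^ j • e x = 0
    rw [← map_smul, map_eq_zero_iff _ e.injective]
  rw [hcard, hcard] at h
  exact Nat.pow_right_injective (Fact.out : p.Prime).two_le h

theorem HasType.of_quotientEquiv {n : ℕ} {a : Fin n → ℕ} (ha : Antitone a)
    {N N' : Submodule ℤ_[p] (Fin n → ℤ_[p])} (h : HasType a N)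
    (e : ((Fin n → ℤ_[p]) ⧸ N) ≃ₗ[ℤ_[p]] ((Fin n → ℤ_[p]) ⧸ N')) : HasType a N' := by
  have := h.finite
  obtain ⟨b, hb, hN'⟩ := exists_hasType N' (Finite.of_equiv _ e.toEquiv)
  obtain ⟨e1⟩ := h.quotientEquiv
  obtain ⟨e2⟩ := hN'.quotientEquiv
  rwa [type_unique ha hb ((e1.symm.trans e).trans e2)]

theorem HasType.unique {n : ℕ} {a b : Fin n → ℕ} (ha : Antitone a) (hb : Antitone b)
    {N : Submodule ℤ_[p] (Fin n → ℤ_[p])} (h : HasType a N) (h' : HasType b N) : a = b := by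
  obtain ⟨e1⟩ := h.quotientEquiv
  obtain ⟨e2⟩ := h'.quotientEquiv
  exact type_unique ha hb (e1.symm.trans e2)

/-- The cotype only depends on the quotient. -/
theorem cotype_eq {n : ℕ} {a : Fin n → ℕ} (ha : Antitone a) {M : Type*} [AddCommGroup M]
    [Module ℤ_[p] M] {N : Submodule ℤ_[p] M}
    (e : (M ⧸ N) ≃ₗ[ℤ_[p]] ((i : Fin n) → S p (a i))) (i : Fin n) :
    cotype n N i = p ^ a i := by
  have hex : ∃ I : Fin n → Ideal ℤ_[p], IsCotypeChain N I := by
    refine ⟨fun i => Ideal.span {(p : ℤ_[p]) ^ a i}, fun i j h => ?_, fun i => ?_, ⟨e⟩⟩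
    · rw [Ideal.span_singleton_le_span_singleton]
      exact pow_dvd_pow _ (ha h)
    · rw [Ne, Ideal.span_singleton_eq_bot]
      exact pow_ne_zero _ p_ne_zero
  rw [cotype, dif_pos hex]
  obtain ⟨hmono, hne, ⟨e'⟩⟩ := hex.choose_spec
  generalize hex.choose = I at *
  have hI : ∀ i, ∃ m : ℕ, I i = Ideal.span {(p : ℤ_[p]) ^ m} := fun i =>
    PadicInt.ideal_eq_span_pow_p (hne i)
  choose b hb using hI
  obtain rfl : I = fun i => Ideal.span {(p : ℤ_[p]) ^ b i} := funext hb
  have hanti : Antitone b := by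
    intro i j h
    have := hmono h
    rw [Ideal.span_singleton_le_span_singleton] at this
    exact (pow_dvd_pow_iff p_ne_zero PadicInt.prime_p.not_isUnit).mp this
  obtain rfl := type_unique ha hanti (e.symm.trans e')
  exact card_S p (a i)

/-- The lattice `p^c N`. -/
noncomputable def scale {n : ℕ} (c : ℕ) (N : Submodule ℤ_[p] (Fin n → ℤ_[p])) :
    Submodule ℤ_[p] (Fin n → ℤ_[p]) :=
  N.map (LinearMap.lsmul ℤ_[p] (Fin n → ℤ_[p]) ((p : ℤ_[p]) ^ c))

theorem smul_mem_scale {n : ℕ} (c : ℕ) {N : Submodule ℤ_[p] (Fin n → ℤ_[p])}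
    {x : Fin n → ℤ_[p]} : (p : ℤ_[p]) ^ c • x ∈ scale c N ↔ x ∈ N := by
  constructor
  · rintro ⟨y, hy, h⟩
    rw [LinearMap.lsmul_apply] at h
    exact (smul_right_injective _ (pow_ne_zero c (p_ne_zero (p := p))) h) ▸ hy
  · exact fun h => ⟨x, h, rfl⟩

theorem mem_scale {n : ℕ} (c : ℕ) {N : Submodule ℤ_[p] (Fin n → ℤ_[p])}
    {x : Fin n → ℤ_[p]} : x ∈ scale c N ↔ ∃ y ∈ N, (p : ℤ_[p]) ^ c • y = x := Iff.rfl

theorem scale_injective {n : ℕ} (c : ℕ) : Function.Injective (scale (p := p) (n := n) c) := by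
  intro N N' h
  ext x
  rw [← smul_mem_scale c, h, smul_mem_scale]

theorem HasType.scale {n : ℕ} {a : Fin n → ℕ} {N : Submodule ℤ_[p] (Fin n → ℤ_[p])}
    (h : HasType a N) (c : ℕ) : HasType (fun i => a i + c) (scale c N) := by
  obtain ⟨b, hb⟩ := h
  refine ⟨b, fun x => ⟨?_, fun h => ?_⟩⟩
  · rintro ⟨y, hy, rfl⟩ i
    obtain ⟨z, hz⟩ := (hb y).mp hy i
    exact ⟨z, by simp [hz]; ring⟩
  · choose z hz using h
    refine ⟨b.equivFun.symm (fun i => (p : ℤ_[p]) ^ a i * z i), (hb _).mpr fun i => ?_, ?_⟩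
    · rw [← b.equivFun_apply, LinearEquiv.apply_symm_apply]
      exact Dvd.intro _ rfl
    · refine b.ext_elem fun i => ?_
      rw [hz, LinearMap.lsmul_apply, map_smul, Finsupp.smul_apply, ← b.equivFun_apply,
        LinearEquiv.apply_symm_apply, smul_eq_mul]
      ring

theorem HasType.exists_scale {n : ℕ} {a : Fin n → ℕ} {c : ℕ}
    {N : Submodule ℤ_[p] (Fin n → ℤ_[p])} (h : HasType (fun i => a i + c) N) :
    ∃ N', HasType a N' ∧ CotypeZeta.scale c N' = N := by
  obtain ⟨b, hb⟩ := h
  have hN' : HasType a ((Submodule.pi Set.univ fun i => Ideal.span {(p : ℤ_[p]) ^ a i}).comap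
      b.equivFun.toLinearMap) := by
    refine ⟨b, fun x => ?_⟩
    simp [Submodule.mem_pi, Ideal.mem_span_singleton]
  refine ⟨_, hN', ?_⟩
  ext x
  rw [hb, mem_scale]
  constructor
  · rintro ⟨y, hy, rfl⟩ i
    simp only [Submodule.mem_comap, Submodule.mem_pi, Ideal.mem_span_singleton] at hy
    obtain ⟨z, hz⟩ := hy i trivial
    refine ⟨z, ?_⟩
    have hz : b.repr y i = (p : ℤ_[p]) ^ a i * z := hz
    simp [hz]; ring
  · intro h
    choose z hz using h
    refine ⟨b.equivFun.symm (fun i => (p : ℤ_[p]) ^ a i * z i), ?_, ?_⟩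
    · simp only [Submodule.mem_comap, Submodule.mem_pi, Ideal.mem_span_singleton]
      intro i _
      rw [LinearEquiv.coe_coe, LinearEquiv.apply_symm_apply]
      exact Dvd.intro _ rfl
    · refine b.ext_elem fun i => ?_
      rw [hz, map_smul, Finsupp.smul_apply, ← b.equivFun_apply,
        LinearEquiv.apply_symm_apply, smul_eq_mul]
      ring

/-- In rank `n`, quotients isomorphic to a product of two cyclic modules are those with at most
two nontrivial elementary divisors. -/
theorem hasType_iff_quotient {n : ℕ} {m l : ℕ} {a : Fin (n + 2) → ℕ} (ha : Antitone a)
    (h0 : a 0 = m) (h1 : a 1 = l) (h2 : ∀ i : Fin n, a i.succ.succ = 0)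
    (N : Submodule ℤ_[p] (Fin (n + 2) → ℤ_[p])) :
    HasType a N ↔ Nonempty (((Fin (n + 2) → ℤ_[p]) ⧸ N) ≃ₗ[ℤ_[p]] (S p m × S p l)) := by
  have key : ∀ {N : Submodule ℤ_[p] (Fin (n + 2) → ℤ_[p])}, HasType a N →
      Nonempty (((Fin (n + 2) → ℤ_[p]) ⧸ N) ≃ₗ[ℤ_[p]] (S p m × S p l)) := by
    rintro N ⟨b, hb⟩
    let f : (Fin (n + 2) → ℤ_[p]) →ₗ[ℤ_[p]] (S p m × S p l) :=
      ((Submodule.mkQ _).comp (b.coord 0)).prod ((Submodule.mkQ _).comp (b.coord 1))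
    have hf : Function.Surjective f := by
      rintro ⟨y1, y2⟩
      obtain ⟨z1, rfl⟩ := Ideal.Quotient.mk_surjective y1
      obtain ⟨z2, rfl⟩ := Ideal.Quotient.mk_surjective y2
      refine ⟨z1 • b 0 + z2 • b 1, ?_⟩
      have e1 : b.repr (z1 • b 0 + z2 • b 1) 0 = z1 := by simp
      have e2 : b.repr (z1 • b 0 + z2 • b 1) 1 = z2 := by simp
      exact Prod.ext (congrArg (Ideal.Quotient.mk _) e1) (congrArg (Ideal.Quotient.mk _) e2)
    have hN : N = LinearMap.ker f := by
      ext x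
      have e : x ∈ LinearMap.ker f ↔ (Ideal.Quotient.mk _ (b.repr x 0) : S p m) = 0 ∧
          (Ideal.Quotient.mk _ (b.repr x 1) : S p l) = 0 := by
        rw [LinearMap.mem_ker]
        exact Prod.ext_iff
      rw [hb, e, mk_eq_zero_iff, mk_eq_zero_iff, Fin.forall_fin_succ, Fin.forall_fin_succ]
      simp [h0, h1, h2]
    exact ⟨(Submodule.quotEquivOfEq _ _ hN).trans (f.quotKerEquivOfSurjective hf)⟩
  refine ⟨key, fun ⟨e⟩ => ?_⟩
  obtain ⟨N₀, hN₀⟩ := exists_of_type (p := p) a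
  obtain ⟨e₀⟩ := key hN₀
  exact hN₀.of_quotientEquiv ha (e₀.trans e.symm)

end

/-! ### Counting kernels of surjections -/

/-- Surjections `V → A` up to automorphisms of `A` correspond to submodules with quotient `A`. -/
theorem card_surjective {R V A : Type*} [CommRing R] [AddCommGroup V] [Module R V]
    [AddCommGroup A] [Module R A] (P : Submodule R V → Prop) :
    Nat.card {φ : V →ₗ[R] A // Function.Surjective φ ∧ P (LinearMap.ker φ)}
      = Nat.card {N : Submodule R V // Nonempty ((V ⧸ N) ≃ₗ[R] A) ∧ P N} * Nat.card (A ≃ₗ[R] A) := by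
  rw [← Nat.card_prod]
  let F : {N : Submodule R V // Nonempty ((V ⧸ N) ≃ₗ[R] A) ∧ P N} × (A ≃ₗ[R] A) → (V →ₗ[R] A) :=
    fun x => (x.1.2.1.some.trans x.2).toLinearMap.comp (Submodule.mkQ x.1.1)
  have hker : ∀ x, LinearMap.ker (F x) = x.1.1 := fun x => by
    simp only [F]
    rw [LinearEquiv.ker_comp, Submodule.ker_mkQ]
  have hsurj : ∀ x, Function.Surjective (F x) := fun x =>
    (x.1.2.1.some.trans x.2).surjective.comp (Submodule.mkQ_surjective x.1.1)
  refine (Nat.card_congr (Equiv.ofBijective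
    (fun x => ⟨F x, hsurj x, (hker x).symm ▸ x.1.2.2⟩) ⟨?_, ?_⟩)).symm
  · intro x y hxy
    have hxy : F x = F y := congrArg Subtype.val hxy
    have h1 : x.1 = y.1 := Subtype.ext (by rw [← hker x, hxy, hker y])
    obtain ⟨x1, x2⟩ := x
    obtain ⟨y1, y2⟩ := y
    obtain rfl : x1 = y1 := h1
    refine Prod.ext rfl (LinearEquiv.ext fun a => ?_)
    obtain ⟨v, hv⟩ := Submodule.mkQ_surjective _ (x1.2.1.some.symm a)
    have := LinearMap.congr_fun hxy v
    simpa [F, ← Submodule.mkQ_apply, hv] using this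
  · rintro ⟨φ, hφ, hP⟩
    have hne : Nonempty ((V ⧸ LinearMap.ker φ) ≃ₗ[R] A) := ⟨φ.quotKerEquivOfSurjective hφ⟩
    refine ⟨(⟨LinearMap.ker φ, hne, hP⟩, hne.some.symm.trans (φ.quotKerEquivOfSurjective hφ)), ?_⟩
    refine Subtype.ext (LinearMap.ext fun v => ?_)
    simp [F]

section

variable {p : ℕ} [Fact p.Prime]

/-- The linear map `ℤ_p^n → A` with prescribed values on the standard basis. -/
noncomputable abbrev hom (p : ℕ) [Fact p.Prime] {n : ℕ} {A : Type*} [AddCommGroup A]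
    [Module ℤ_[p] A] (w : Fin n → A) : (Fin n → ℤ_[p]) →ₗ[ℤ_[p]] A :=
  (Pi.basisFun ℤ_[p] (Fin n)).constr ℤ_[p] w

theorem hom_apply {n : ℕ} {A : Type*} [AddCommGroup A] [Module ℤ_[p] A] (w : Fin n → A)
    (x : Fin n → ℤ_[p]) : hom p w x = ∑ i, x i • w i := by
  rw [Module.Basis.constr_apply_fintype]
  simp

theorem hom_mk_fst {n m l : ℕ} (u v x : Fin n → ℤ_[p]) :
    (hom p (fun j => ((Ideal.Quotient.mk _ (u j), Ideal.Quotient.mk _ (v j)) : S p m × S p l)) x).1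
      = Ideal.Quotient.mk _ (∑ j, x j * u j) := by
  rw [hom_apply, Prod.fst_sum, map_sum]
  rfl

theorem hom_mk_snd {n m l : ℕ} (u v x : Fin n → ℤ_[p]) :
    (hom p (fun j => ((Ideal.Quotient.mk _ (u j), Ideal.Quotient.mk _ (v j)) : S p m × S p l)) x).2
      = Ideal.Quotient.mk _ (∑ j, x j * v j) := by
  rw [hom_apply, Prod.snd_sum, map_sum]
  rfl

theorem exists_lift {n m l : ℕ} (w : Fin n → S p m × S p l) : ∃ u v : Fin n → ℤ_[p],
    w = fun j => (Ideal.Quotient.mk _ (u j), Ideal.Quotient.mk _ (v j)) := by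
  choose u hu using fun j => Ideal.Quotient.mk_surjective (w j).1
  choose v hv using fun j => Ideal.Quotient.mk_surjective (w j).2
  exact ⟨u, v, funext fun j => Prod.ext (hu j).symm (hv j).symm⟩

theorem exists_isUnit_of_surjective {n m l : ℕ} (hm : m ≠ 0) {w : Fin n → S p m × S p l}
    (h : Function.Surjective (hom p w)) : ∃ i, IsUnit (w i).1 := by
  obtain ⟨u, v, rfl⟩ := exists_lift w
  simp only [isUnit_mk_iff hm]
  by_contra! hu
  obtain ⟨x, hx⟩ := h (1, 0)
  have hx := congrArg Prod.fst hx
  rw [hom_mk_fst, ← map_one (Ideal.Quotient.mk _), mk_eq_mk_iff] at hx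
  have h1 : (p : ℤ_[p]) ∣ ∑ j, x j * u j := Finset.dvd_sum fun j _ =>
    ((not_not.mp ((isUnit_iff_not_dvd _).not.mp (hu j))).mul_left _)
  exact PadicInt.prime_p.not_isUnit (isUnit_of_dvd_one
    ((dvd_sub_right h1).mp ((dvd_pow_self (p : ℤ_[p]) hm).trans hx)))

/-- A pair `(u, v)` with `u_i` a unit gives a surjection if and only if a minor is invertible. -/
theorem surjective_iff {n m l : ℕ} (hm : m ≠ 0) (hl : l ≠ 0) (u v : Fin n → ℤ_[p]) (i : Fin n)
    (hi : IsUnit (u i)) :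
    Function.Surjective (hom p (fun j =>
      ((Ideal.Quotient.mk _ (u j), Ideal.Quotient.mk _ (v j)) : S p m × S p l)))
      ↔ ∃ j, IsUnit (v j * u i - v i * u j) := by
  constructor
  · intro h
    by_contra! hd
    obtain ⟨x, hx⟩ := h (0, 1)
    have hx1 := congrArg Prod.fst hx
    have hx2 := congrArg Prod.snd hx
    rw [hom_mk_fst, mk_eq_zero_iff] at hx1
    rw [hom_mk_snd, ← map_one (Ideal.Quotient.mk _), mk_eq_mk_iff] at hx2
    replace hx1 := (dvd_pow_self (p : ℤ_[p]) hm).trans hx1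
    replace hx2 := (dvd_pow_self (p : ℤ_[p]) hl).trans hx2
    have h3 : (p : ℤ_[p]) ∣ ∑ j, x j * (v j * u i - v i * u j) := Finset.dvd_sum fun j _ =>
      ((not_not.mp ((isUnit_iff_not_dvd _).not.mp (hd j))).mul_left _)
    have h4 : ∑ j, x j * (v j * u i - v i * u j)
        = u i * ((∑ j, x j * v j) - 1) + u i - v i * ∑ j, x j * u j := by
      have : ∑ j, x j * (v j * u i - v i * u j)
          = u i * (∑ j, x j * v j) - v i * ∑ j, x j * u j := by
        rw [Finset.mul_sum, Finset.mul_sum, ← Finset.sum_sub_distrib]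
        exact Finset.sum_congr rfl fun j _ => by ring
      rw [this]; ring
    rw [h4, dvd_sub_left (hx1.mul_left _), dvd_add_right (hx2.mul_left _)] at h3
    exact (isUnit_iff_not_dvd _).mp hi h3
  · rintro ⟨j, hj⟩ ⟨y1, y2⟩
    obtain ⟨z1, rfl⟩ := Ideal.Quotient.mk_surjective y1
    obtain ⟨z2, rfl⟩ := Ideal.Quotient.mk_surjective y2
    obtain ⟨d, hd⟩ := hj.exists_right_inv
    let x : Fin n → ℤ_[p] := Pi.single i (d * (z1 * v j - z2 * u j))
      + Pi.single j (d * (z2 * u i - z1 * v i))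
    have hsum : ∀ f : Fin n → ℤ_[p], ∑ k, x k * f k
        = d * (z1 * v j - z2 * u j) * f i + d * (z2 * u i - z1 * v i) * f j := by
      intro f
      simp [x, add_mul, Finset.sum_add_distrib, Pi.single_apply]
    refine ⟨x, Prod.ext ?_ ?_⟩
    · rw [hom_mk_fst, hsum]
      congr 1
      linear_combination z1 * hd
    · rw [hom_mk_snd, hsum]
      congr 1
      linear_combination z2 * hd

theorem surjective_iff_zero {n m : ℕ} (hm : m ≠ 0) (w : Fin n → S p m × S p 0) :
    Function.Surjective (hom p w) ↔ ∃ i, IsUnit (w i).1 := by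
  refine ⟨exists_isUnit_of_surjective hm, fun ⟨i, hi⟩ => ?_⟩
  obtain ⟨u, v, rfl⟩ := exists_lift w
  rw [isUnit_mk_iff hm] at hi
  obtain ⟨d, hd⟩ := hi.exists_right_inv
  rintro ⟨y1, y2⟩
  obtain ⟨z1, rfl⟩ := Ideal.Quotient.mk_surjective y1
  refine ⟨Pi.single i (d * z1), Prod.ext ?_ (Subsingleton.elim _ _)⟩
  rw [hom_mk_fst]
  congr 1
  simp [Pi.single_apply]
  linear_combination z1 * hd

variable (p) in
/-- The number of ways to complete a primitive vector `w₁` of `(ℤ/p^m)^n` to a surjection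
`(w₁, w₂) : ℤ_p^n → ℤ/p^m × ℤ/p^l`. -/
def completions (n : ℕ) : ℕ → ℕ
  | 0 => 1
  | l + 1 => p ^ (l + 1) * (p ^ ((l + 1) * (n - 1)) - p ^ (l * (n - 1)))

theorem card_completions {n m l : ℕ} (hm : m ≠ 0) (w : Fin n → S p m)
    (hw : ∃ i, IsUnit (w i)) :
    Nat.card {v : Fin n → S p l // Function.Surjective (hom p (fun j => (w j, v j)))}
      = completions p n l := by
  cases l with
  | zero =>
    have : ∀ v : Fin n → S p 0, Function.Surjective (hom p (fun j => (w j, v j))) := fun v =>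
      (surjective_iff_zero hm _).mpr hw
    rw [Nat.card_congr (Equiv.subtypeUnivEquiv this), Nat.card_pi]
    simp [completions]
  | succ l =>
    obtain ⟨i, hi⟩ := hw
    choose u hu using fun j => Ideal.Quotient.mk_surjective (w j)
    obtain rfl : (fun j => Ideal.Quotient.mk _ (u j)) = w := funext hu
    rw [isUnit_mk_iff hm] at hi
    obtain ⟨c, hc⟩ := (hi.map (Ideal.Quotient.mk (Ideal.span {(p : ℤ_[p]) ^ (l + 1)})))
    let e : (Fin n → S p (l + 1)) ≃ S p (l + 1) × ({j // j ≠ i} → S p (l + 1)) :=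
      (Equiv.funSplitAt i _).trans (Equiv.prodShear (Equiv.refl _) fun s =>
        Equiv.piCongrRight fun j => (Units.mulRight c).trans
          (Equiv.subRight (s * Ideal.Quotient.mk _ (u j))))
    have he : ∀ v : Fin n → S p (l + 1),
        Function.Surjective (hom p (fun j => ((Ideal.Quotient.mk _ (u j) : S p m), v j)))
          ↔ (∃ j, IsUnit ((e v).2 j)) := by
      intro v
      choose z hz using fun j => Ideal.Quotient.mk_surjective (v j)
      obtain rfl : (fun j => Ideal.Quotient.mk _ (z j)) = v := funext hz
      rw [surjective_iff hm (by omega) u z i hi]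
      have h1 : ∀ j, (e fun j => Ideal.Quotient.mk _ (z j)).2 j
          = Ideal.Quotient.mk _ (z j * u i - z i * u j) := by
        intro j
        simp only [map_sub, map_mul, ← hc]
        rfl
      simp only [h1, isUnit_mk_iff (Nat.succ_ne_zero l)]
      constructor
      · rintro ⟨j, hj⟩
        refine ⟨⟨j, ?_⟩, hj⟩
        rintro rfl
        simp at hj
      · rintro ⟨j, hj⟩
        exact ⟨j, hj⟩
    have e2 : {v : Fin n → S p (l + 1) //
        Function.Surjective (hom p (fun j => ((Ideal.Quotient.mk _ (u j) : S p m), v j)))} ≃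
        S p (l + 1) × {t : {j // j ≠ i} → S p (l + 1) // ∃ j, IsUnit (t j)} :=
      (e.subtypeEquiv (q := fun x => ∃ j, IsUnit (x.2 j)) he).trans
        { toFun := fun x => (x.1.1, ⟨x.1.2, x.2⟩)
          invFun := fun x => ⟨(x.1, x.2.1), x.2.2⟩
          left_inv := fun _ => rfl
          right_inv := fun _ => rfl }
    rw [Nat.card_congr e2, Nat.card_prod, card_S, completions]
    have h3 := card_primitive (p := p) {j // j ≠ i} l
    have h4 : Fintype.card {j : Fin n // j ≠ i} = n - 1 := by
      rw [Fintype.card_subtype_compl]; simp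
    rw [h4] at h3
    rw [← h3, Nat.add_sub_cancel]

/-- Counting surjections onto `ℤ/p^m × ℤ/p^l` with a condition on the first component. -/
theorem card_surjective_pairs {n m l : ℕ} (hm : m ≠ 0) (Q : (Fin n → S p m) → Prop) :
    Nat.card {w : Fin n → S p m × S p l // Function.Surjective (hom p w) ∧ Q (fun j => (w j).1)}
      = Nat.card {w : Fin n → S p m // (∃ i, IsUnit (w i)) ∧ Q w} * completions p n l := by
  have e : {w : Fin n → S p m × S p l // Function.Surjective (hom p w) ∧ Q (fun j => (w j).1)} ≃
      (Σ w : {w : Fin n → S p m // (∃ i, IsUnit (w i)) ∧ Q w},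
        {v : Fin n → S p l // Function.Surjective (hom p (fun j => (w.1 j, v j)))}) :=
    { toFun := fun w => ⟨⟨fun j => (w.1 j).1, exists_isUnit_of_surjective hm w.2.1, w.2.2⟩,
        ⟨fun j => (w.1 j).2, w.2.1⟩⟩
      invFun := fun x => ⟨fun j => (x.1.1 j, x.2.1 j), x.2.2, x.1.2.2⟩
      left_inv := fun _ => rfl
      right_inv := fun _ => rfl }
  have : Fintype {w : Fin n → S p m // (∃ i, IsUnit (w i)) ∧ Q w} := Fintype.ofFinite _
  rw [Nat.card_congr e, Nat.card_sigma]
  simp only [fun w : {w : Fin n → S p m // (∃ i, IsUnit (w i)) ∧ Q w} =>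
    card_completions (l := l) hm w.1 w.2.1]
  rw [Finset.sum_const, smul_eq_mul, Finset.card_univ, Nat.card_eq_fintype_card]

theorem card_kernels {n m l : ℕ} (hm : m ≠ 0)
    (P : Submodule ℤ_[p] (Fin n → ℤ_[p]) → Prop) (Q : (Fin n → S p m) → Prop)
    (hPQ : ∀ w : Fin n → S p m × S p l, Function.Surjective (hom p w) →
      (P (LinearMap.ker (hom p w)) ↔ Q (fun j => (w j).1))) :
    Nat.card {N : Submodule ℤ_[p] (Fin n → ℤ_[p]) //
        Nonempty (((Fin n → ℤ_[p]) ⧸ N) ≃ₗ[ℤ_[p]] (S p m × S p l)) ∧ P N}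
      * Nat.card ((S p m × S p l) ≃ₗ[ℤ_[p]] (S p m × S p l))
      = Nat.card {w : Fin n → S p m // (∃ i, IsUnit (w i)) ∧ Q w} * completions p n l := by
  rw [← card_surjective, ← card_surjective_pairs hm]
  refine (Nat.card_congr (((Pi.basisFun ℤ_[p] (Fin n)).constr ℤ_[p]).toEquiv.subtypeEquiv
    fun w => ?_)).symm
  exact and_congr_right fun h => (hPQ w h).symm

theorem card_kernels_all {n m l : ℕ} (hm : m ≠ 0) :
    Nat.card {N : Submodule ℤ_[p] (Fin n → ℤ_[p]) //
        Nonempty (((Fin n → ℤ_[p]) ⧸ N) ≃ₗ[ℤ_[p]] (S p m × S p l))}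
      * Nat.card ((S p m × S p l) ≃ₗ[ℤ_[p]] (S p m × S p l))
      = Nat.card {w : Fin n → S p m // ∃ i, IsUnit (w i)} * completions p n l := by
  have := card_kernels (l := l) hm (fun _ : Submodule ℤ_[p] (Fin n → ℤ_[p]) => True)
    (fun _ => True) (fun _ _ => Iff.rfl)
  simpa only [and_true] using this

/-- The order of the automorphism group of `ℤ/p^k`. -/
theorem card_aut_cyclic (k : ℕ) :
    Nat.card ((S p (k + 1) × S p 0) ≃ₗ[ℤ_[p]] (S p (k + 1) × S p 0)) + p ^ k = p ^ (k + 1) := by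
  have h1 := card_kernels_all (p := p) (n := 1) (m := k + 1) (l := 0) (by omega)
  have h2 := card_primitive (p := p) (Fin 1) k
  have hN : ∀ N : Submodule ℤ_[p] (Fin 1 → ℤ_[p]),
      Nonempty (((Fin 1 → ℤ_[p]) ⧸ N) ≃ₗ[ℤ_[p]] (S p (k + 1) × S p 0)) →
      ∀ x, x ∈ N ↔ (p : ℤ_[p]) ^ (k + 1) ∣ x 0 := by
    rintro N ⟨e⟩ x
    have hN : x ∈ N ↔ ∀ y : S p (k + 1) × S p 0, x 0 • y = 0 := by
      constructor
      · intro hx y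
        obtain ⟨v, hv⟩ := Submodule.mkQ_surjective N (e.symm y)
        have : x 0 • Submodule.mkQ N v = 0 := by
          rw [← map_smul, Submodule.mkQ_apply, Submodule.Quotient.mk_eq_zero]
          have h : x 0 • v = v 0 • x := by
            ext i
            simp [Subsingleton.elim i 0, mul_comm]
          rw [h]
          exact N.smul_mem _ hx
        rw [hv, ← map_smul, map_eq_zero_iff _ e.symm.injective] at this
        exact this
      · intro h
        have := h (e (Submodule.mkQ N (Pi.single 0 1)))
        rw [← map_smul, map_eq_zero_iff _ e.injective, ← map_smul, Submodule.mkQ_apply,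
          Submodule.Quotient.mk_eq_zero] at this
        convert this using 1
        ext i
        simp [Subsingleton.elim i 0]
    rw [hN, ← mk_eq_zero_iff]
    constructor
    · intro h
      have := congrArg Prod.fst (h (1, 0))
      have h' : x 0 • (1 : S p (k + 1)) = 0 := this
      rwa [Algebra.smul_def, mul_one] at h'
    · intro h y
      refine Prod.ext ?_ (Subsingleton.elim _ _)
      change x 0 • y.1 = 0
      rw [Algebra.smul_def]
      change Ideal.Quotient.mk _ (x 0) * y.1 = 0
      rw [h, zero_mul]
  have h3 : Nat.card {N : Submodule ℤ_[p] (Fin 1 → ℤ_[p]) //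
        Nonempty (((Fin 1 → ℤ_[p]) ⧸ N) ≃ₗ[ℤ_[p]] (S p (k + 1) × S p 0))} = 1 := by
    have hs : Subsingleton {N : Submodule ℤ_[p] (Fin 1 → ℤ_[p]) //
        Nonempty (((Fin 1 → ℤ_[p]) ⧸ N) ≃ₗ[ℤ_[p]] (S p (k + 1) × S p 0))} :=
      ⟨fun N N' => Subtype.ext (Submodule.ext fun x => by rw [hN _ N.2, hN _ N'.2])⟩
    have hne : Nonempty {N : Submodule ℤ_[p] (Fin 1 → ℤ_[p]) //
        Nonempty (((Fin 1 → ℤ_[p]) ⧸ N) ≃ₗ[ℤ_[p]] (S p (k + 1) × S p 0))} := by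
      have hw := (surjective_iff_zero (p := p) (n := 1) (m := k + 1) (by omega)
        (fun _ => (1, 0))).mpr ⟨0, isUnit_one⟩
      exact ⟨⟨_, ⟨LinearMap.quotKerEquivOfSurjective _ hw⟩⟩⟩
    rw [Nat.card_eq_one_iff_unique]
    exact ⟨hs, hne⟩
  rw [h3, one_mul, completions, mul_one] at h1
  rw [h1]
  simpa using h2

/-- Sublattices of `ℤ_p^2` of type `(l + k, l)` are the multiples `p^l N` with `N` of type
`(k, 0)`. -/
theorem card_rank_two (l k : ℕ) :
    Nat.card {N : Submodule ℤ_[p] (Fin 2 → ℤ_[p]) //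
        Nonempty (((Fin 2 → ℤ_[p]) ⧸ N) ≃ₗ[ℤ_[p]] (S p (l + k) × S p l))}
      = Nat.card {N : Submodule ℤ_[p] (Fin 2 → ℤ_[p]) //
        Nonempty (((Fin 2 → ℤ_[p]) ⧸ N) ≃ₗ[ℤ_[p]] (S p k × S p 0))} := by
  have ha : ∀ m l : ℕ, l ≤ m → Antitone ![m, l] := by
    intro m l h i j hij
    fin_cases i <;> fin_cases j <;> simp_all
  have h1 : ∀ m l : ℕ, l ≤ m → ∀ N : Submodule ℤ_[p] (Fin 2 → ℤ_[p]),
      Nonempty (((Fin 2 → ℤ_[p]) ⧸ N) ≃ₗ[ℤ_[p]] (S p m × S p l)) ↔ HasType ![m, l] N :=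
    fun m l h N => (hasType_iff_quotient (ha m l h) rfl rfl (fun i => i.elim0) N).symm
  have hadd : ![l + k, l] = fun i => ![k, 0] i + l := by
    ext i; fin_cases i <;> simp [add_comm]
  have hs : ∀ N : {N : Submodule ℤ_[p] (Fin 2 → ℤ_[p]) //
      Nonempty (((Fin 2 → ℤ_[p]) ⧸ N) ≃ₗ[ℤ_[p]] (S p k × S p 0))},
      Nonempty (((Fin 2 → ℤ_[p]) ⧸ scale l N.1) ≃ₗ[ℤ_[p]] (S p (l + k) × S p l)) := by
    intro N
    rw [h1 _ _ (by omega), hadd]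
    exact ((h1 _ _ (by omega) _).mp N.2).scale l
  refine (Nat.card_congr (Equiv.ofBijective (fun N => ⟨scale l N.1, hs N⟩) ⟨?_, ?_⟩)).symm
  · intro N N' h
    exact Subtype.ext (scale_injective l (congrArg Subtype.val h))
  · rintro ⟨N, hN⟩
    rw [h1 _ _ (by omega), hadd] at hN
    obtain ⟨N', hN', rfl⟩ := hN.exists_scale
    exact ⟨⟨N', (h1 _ _ (by omega) _).mpr hN'⟩, rfl⟩

variable (p) in
/-- The number of sublattices of `ℤ_p^3` with elementary divisors `p^{l+k}`, `p^l`, `1`. -/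
def latticeCount : ℕ → ℕ → ℚ
  | 0, 0 => 1
  | 0, l + 1 => (p ^ 2 + p + 1) * p ^ (2 * l)
  | k + 1, 0 => (p ^ 2 + p + 1) * p ^ (2 * k)
  | k + 1, l + 1 => (p ^ 2 + p + 1) * (p + 1) * p ^ (2 * k + 2 * l + 1)

theorem card_primitive_rat (n m : ℕ) :
    (Nat.card {w : Fin n → S p (m + 1) // ∃ i, IsUnit (w i)} : ℚ)
      = p ^ (m * n) * (p ^ n - 1) := by
  have := card_primitive (p := p) (Fin n) m
  rw [Fintype.card_fin] at this
  have h2 : (Nat.card {w : Fin n → S p (m + 1) // ∃ i, IsUnit (w i)} : ℚ) + p ^ (m * n)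
      = p ^ ((m + 1) * n) := by exact_mod_cast this
  rw [add_mul, one_mul, pow_add (p : ℚ) (m * n) n] at h2
  linear_combination h2

theorem completions_rat (n l : ℕ) :
    (completions p (n + 1) (l + 1) : ℚ) = p ^ (l + 1) * p ^ (l * n) * (p ^ n - 1) := by
  have hp := (Fact.out : p.Prime).one_lt.le
  rw [completions, Nat.cast_mul, Nat.add_sub_cancel, Nat.cast_sub (by gcongr; omega)]
  push_cast
  ring

/-- The order of the automorphism group of `ℤ/p^{l+k} × ℤ/p^l`, in terms of sublattices of
`ℤ_p^2`. -/
theorem latticeCount_mul_card_aut (k l : ℕ) (h : l + k ≠ 0) :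
    latticeCount p k l
        * Nat.card ((S p (l + k) × S p l) ≃ₗ[ℤ_[p]] (S p (l + k) × S p l))
      = Nat.card {w : Fin 3 → S p (l + k) // ∃ i, IsUnit (w i)} * completions p 3 l := by
  have hp : (1 : ℚ) < p := by exact_mod_cast (Fact.out : p.Prime).one_lt
  have hp1 : (p : ℚ) - 1 ≠ 0 := by linarith
  have hp0 : (p : ℚ) ≠ 0 := by linarith
  have hp2 : (p : ℚ) + 1 ≠ 0 := by linarith
  have hcyc : ∀ k : ℕ, (Nat.card ((S p (k + 1) × S p 0) ≃ₗ[ℤ_[p]] (S p (k + 1) × S p 0)) : ℚ)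
      = p ^ k * (p - 1) := by
    intro k
    have h1 : (Nat.card ((S p (k + 1) × S p 0) ≃ₗ[ℤ_[p]] (S p (k + 1) × S p 0)) : ℚ)
      + p ^ k = p ^ (k + 1) := by exact_mod_cast card_aut_cyclic (p := p) k
    linear_combination h1
  -- the number of sublattices of `ℤ_p^2` with cyclic quotient of order `p^{k+1}`
  have h2 : ∀ k : ℕ, (Nat.card {N : Submodule ℤ_[p] (Fin 2 → ℤ_[p]) //
      Nonempty (((Fin 2 → ℤ_[p]) ⧸ N) ≃ₗ[ℤ_[p]] (S p (k + 1) × S p 0))} : ℚ)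
      = p ^ k * (p + 1) := by
    intro k
    have h1 := congrArg (Nat.cast : ℕ → ℚ)
      (card_kernels_all (p := p) (n := 2) (m := k + 1) (l := 0) (by omega))
    rw [Nat.cast_mul, Nat.cast_mul, hcyc, card_primitive_rat] at h1
    have : (p : ℚ) ^ k * (p - 1) ≠ 0 := mul_ne_zero (pow_ne_zero _ hp0) hp1
    refine mul_right_cancel₀ this (h1.trans ?_)
    simp only [completions, Nat.cast_one]
    ring
  have h20 : Nat.card {N : Submodule ℤ_[p] (Fin 2 → ℤ_[p]) //
      Nonempty (((Fin 2 → ℤ_[p]) ⧸ N) ≃ₗ[ℤ_[p]] (S p 0 × S p 0))} = 1 := by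
    rw [Nat.card_eq_one_iff_unique]
    have hN : ∀ N : Submodule ℤ_[p] (Fin 2 → ℤ_[p]),
        Nonempty (((Fin 2 → ℤ_[p]) ⧸ N) ≃ₗ[ℤ_[p]] (S p 0 × S p 0)) → N = ⊤ := by
      rintro N ⟨e⟩
      have := e.toEquiv.subsingleton
      exact Submodule.Quotient.subsingleton_iff.mp this
    refine ⟨⟨fun N N' => Subtype.ext ((hN _ N.2).trans (hN _ N'.2).symm)⟩, ⟨⟨⊤, ?_⟩⟩⟩
    have : Subsingleton ((Fin 2 → ℤ_[p]) ⧸ (⊤ : Submodule ℤ_[p] (Fin 2 → ℤ_[p]))) :=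
      Submodule.Quotient.subsingleton_iff.mpr rfl
    exact ⟨LinearEquiv.ofSubsingleton _ _⟩
  match k, l with
  | 0, 0 => omega
  | 0, l + 1 =>
    have h3 := congrArg (Nat.cast : ℕ → ℚ)
      (card_kernels_all (p := p) (n := 2) (m := l + 1 + 0) (l := l + 1) (by omega))
    rw [card_rank_two, h20, one_mul] at h3
    rw [h3]
    push_cast
    rw [card_primitive_rat, card_primitive_rat, completions_rat, completions_rat, latticeCount]
    ring
  | k + 1, 0 =>
    have e : 0 + (k + 1) = k + 1 := by omega
    rw [e, hcyc, card_primitive_rat, latticeCount, completions]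
    push_cast
    ring
  | k + 1, l + 1 =>
    have h3 := congrArg (Nat.cast : ℕ → ℚ)
      (card_kernels_all (p := p) (n := 2) (m := l + 1 + (k + 1)) (l := l + 1) (by omega))
    rw [card_rank_two] at h3
    push_cast at h3
    have e : l + 1 + (k + 1) = (l + k + 1) + 1 := by omega
    rw [e] at h3 ⊢
    rw [h2, card_primitive_rat, completions_rat] at h3
    rw [card_primitive_rat, completions_rat, latticeCount]
    have hne : (p : ℚ) ^ k * (p + 1) ≠ 0 := mul_ne_zero (pow_ne_zero _ hp0) hp2
    refine mul_left_cancel₀ hne ?_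
    rw [mul_left_comm, h3]
    ring

end

/-! ### Subalgebras of three-dimensional algebras and a ternary quadratic form -/

/-- The ternary quadratic form `∑ A_{ij} x_i x_j` over an arbitrary commutative ring. -/
def qf (A : Matrix (Fin 3) (Fin 3) ℤ) {T : Type*} [CommRing T] (x : Fin 3 → T) : T :=
  ∑ i, ∑ j, (A i j : T) * x i * x j

/-- The alternating product on `T^3` with `e_1 × e_2 ↦ A_0`, `e_2 × e_0 ↦ A_1`,
`e_0 × e_1 ↦ A_2`, the rows of `A`. Every alternating product arises in this way. -/
def br (A : Matrix (Fin 3) (Fin 3) ℤ) {T : Type*} [CommRing T] (x y : Fin 3 → T) : Fin 3 → T :=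
  fun j => ∑ i, crossProduct x y i * (A i j : T)

theorem map_qf (A : Matrix (Fin 3) (Fin 3) ℤ) {T T' : Type*} [CommRing T] [CommRing T']
    (f : T →+* T') (x : Fin 3 → T) : f (qf A x) = qf A (fun i => f (x i)) := by
  simp [qf]

theorem br_smul (A : Matrix (Fin 3) (Fin 3) ℤ) {T : Type*} [CommRing T] (r s : T)
    (x y : Fin 3 → T) : br A (r • x) (s • y) = (r * s) • br A x y := by
  ext j
  simp only [br, map_smul, LinearMap.smul_apply, Pi.smul_apply, smul_eq_mul, Finset.mul_sum]
  exact Finset.sum_congr rfl fun i _ => by ring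

section

variable {p : ℕ} [Fact p.Prime]

/-- Expansion of `x × y` in a basis `u, v, z` of determinant one. -/
theorem cross_expansion {T : Type*} [CommRing T] (u v z x y a : Fin 3 → T)
    (h : ∑ i, z i * crossProduct u v i = 1) :
    ∑ i, crossProduct x y i * a i
      = ((∑ j, x j * v j) * (∑ j, y j * z j) - (∑ j, x j * z j) * (∑ j, y j * v j))
          * (∑ j, u j * a j)
        + ((∑ j, x j * z j) * (∑ j, y j * u j) - (∑ j, x j * u j) * (∑ j, y j * z j))
          * (∑ j, v j * a j)
        + ((∑ j, x j * u j) * (∑ j, y j * v j) - (∑ j, x j * v j) * (∑ j, y j * u j))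
          * (∑ j, z j * a j) := by
  rw [← one_mul (∑ i, crossProduct x y i * a i), ← h]
  simp only [cross_apply, Fin.sum_univ_three, Matrix.cons_val]
  ring

/-- The key step: if `u, v` are part of a basis of the dual lattice, then the lattice of all `x` with
`p^{l+k} ∣ u(x)` and `p^l ∣ v(x)` is closed under `p^c` times the product if and only if
`p^{k-c}` divides the value of the quadratic form at `u`. -/
theorem closed_iff (A : Matrix (Fin 3) (Fin 3) ℤ) (c l k : ℕ) (u v z : Fin 3 → ℤ_[p])
    (h : ∑ i, z i * crossProduct u v i = 1) (N : Submodule ℤ_[p] (Fin 3 → ℤ_[p]))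
    (hN : ∀ x, x ∈ N ↔ (p : ℤ_[p]) ^ (l + k) ∣ ∑ j, x j * u j ∧ (p : ℤ_[p]) ^ l ∣ ∑ j, x j * v j) :
    (∀ x ∈ N, ∀ y ∈ N, (p : ℤ_[p]) ^ c • br A x y ∈ N) ↔ (p : ℤ_[p]) ^ (k - c) ∣ qf A u := by
  have hbr : ∀ x y w : Fin 3 → ℤ_[p], ∑ j, br A x y j * w j
      = ∑ i, crossProduct x y i * ∑ j, (A i j : ℤ_[p]) * w j := by
    intro x y w
    simp only [br, Finset.sum_mul, Finset.mul_sum]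
    rw [Finset.sum_comm]
    exact Finset.sum_congr rfl fun i _ => Finset.sum_congr rfl fun j _ => by ring
  have hq : qf A u = ∑ i, u i * ∑ j, (A i j : ℤ_[p]) * u j := by
    simp only [qf, Finset.mul_sum]
    exact Finset.sum_congr rfl fun i _ => Finset.sum_congr rfl fun j _ => by ring
  constructor
  · intro hcl
    have hx : (p : ℤ_[p]) ^ l • crossProduct z u ∈ N := by
      rw [hN]
      constructor
      · refine ⟨0, ?_⟩
        simp only [cross_apply, Fin.sum_univ_three, Matrix.cons_val, Pi.smul_apply, smul_eq_mul]
        ring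
      · refine ⟨∑ j, crossProduct z u j * v j, ?_⟩
        simp only [cross_apply, Fin.sum_univ_three, Matrix.cons_val, Pi.smul_apply, smul_eq_mul]
        ring
    have hy : crossProduct u v ∈ N := by
      rw [hN]
      constructor <;> refine ⟨0, ?_⟩ <;>
        simp only [cross_apply, Fin.sum_univ_three, Matrix.cons_val] <;> ring
    have h1 := ((hN _).mp (hcl _ hx _ hy)).1
    have h2 : crossProduct (crossProduct z u) (crossProduct u v) = u := by
      ext i
      rw [show u i = 1 * u i by ring, ← h]
      fin_cases i <;>
        simp only [cross_apply, Fin.sum_univ_three, Matrix.cons_val, Fin.zero_eta, Fin.mk_one,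
          Fin.reduceFinMk] <;> ring
    have h3 : ∑ j, ((p : ℤ_[p]) ^ c • br A ((p : ℤ_[p]) ^ l • crossProduct z u)
        (crossProduct u v)) j * u j = (p : ℤ_[p]) ^ l * ((p : ℤ_[p]) ^ c * qf A u) := by
      rw [← one_smul ℤ_[p] (crossProduct u v), br_smul]
      simp only [Pi.smul_apply, smul_eq_mul, mul_assoc, ← Finset.mul_sum]
      rw [hbr, h2, hq]
      ring
    rw [h3, pow_add, mul_dvd_mul_iff_left (pow_ne_zero _ p_ne_zero)] at h1
    rcases le_total k c with hkc | hkc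
    · rw [Nat.sub_eq_zero_of_le hkc, pow_zero]
      exact one_dvd _
    · obtain ⟨j, rfl⟩ := Nat.exists_eq_add_of_le hkc
      rw [pow_add, mul_dvd_mul_iff_left (pow_ne_zero _ p_ne_zero)] at h1
      rwa [Nat.add_sub_cancel_left]
  · rintro ⟨q, hq'⟩ x hx y hy
    obtain ⟨⟨xu, hxu⟩, ⟨xv, hxv⟩⟩ := (hN x).mp hx
    obtain ⟨⟨yu, hyu⟩, ⟨yv, hyv⟩⟩ := (hN y).mp hy
    rw [hN]
    simp only [Pi.smul_apply, smul_eq_mul, mul_assoc, ← Finset.mul_sum]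
    rw [hbr, hbr, cross_expansion u v z x y _ h, cross_expansion u v z x y _ h, ← hq, hq', hxu, hxv,
      hyu, hyv]
    constructor
    · have hpow : (p : ℤ_[p]) ^ c * (p : ℤ_[p]) ^ (k - c)
          = (p : ℤ_[p]) ^ k * (p : ℤ_[p]) ^ (c - k) := by
        rw [← pow_add, ← pow_add]
        congr 1
        omega
      refine ⟨(p : ℤ_[p]) ^ (c - k) * (xv * (∑ j, y j * z j) - (∑ j, x j * z j) * yv) * q
        + (p : ℤ_[p]) ^ c * (((∑ j, x j * z j) * yu - xu * (∑ j, y j * z j))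
          * (∑ j, v j * ∑ i, (A j i : ℤ_[p]) * u i)
        + (p : ℤ_[p]) ^ l * (xu * yv - xv * yu)
          * (∑ j, z j * ∑ i, (A j i : ℤ_[p]) * u i)), ?_⟩
      rw [pow_add]
      linear_combination ((p : ℤ_[p]) ^ l
        * (xv * (∑ j, y j * z j) - (∑ j, x j * z j) * yv) * q) * hpow
    · refine Dvd.dvd.mul_left (dvd_add (dvd_add ?_ ?_) ?_) _
      · exact ⟨(xv * (∑ j, y j * z j) - (∑ j, x j * z j) * yv)
          * (∑ j, u j * ∑ i, (A j i : ℤ_[p]) * v i), by ring⟩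
      · exact ⟨(p : ℤ_[p]) ^ k * ((∑ j, x j * z j) * yu - xu * (∑ j, y j * z j))
          * (∑ j, v j * ∑ i, (A j i : ℤ_[p]) * v i), by ring⟩
      · exact ⟨(p : ℤ_[p]) ^ k * (p : ℤ_[p]) ^ l * (xu * yv - xv * yu)
          * (∑ j, z j * ∑ i, (A j i : ℤ_[p]) * v i), by ring⟩

theorem exists_dual (u v : Fin 3 → ℤ_[p]) (i j : Fin 3) (h : IsUnit (v j * u i - v i * u j)) :
    ∃ z : Fin 3 → ℤ_[p], ∑ i, z i * crossProduct u v i = 1 := by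
  suffices ∃ k, IsUnit (crossProduct u v k) by
    obtain ⟨k, hk⟩ := this
    obtain ⟨d, hd⟩ := hk.exists_left_inv
    exact ⟨Pi.single k d, by simpa [Pi.single_apply] using hd⟩
  by_contra! hk
  simp only [isUnit_iff_not_dvd, not_not] at hk h
  refine h ?_
  have h0 := hk 0
  have h1 := hk 1
  have h2 := hk 2
  simp only [cross_apply, Matrix.cons_val] at h0 h1 h2
  fin_cases i <;> fin_cases j <;>
    simp only [Fin.zero_eta, Fin.mk_one, Fin.reduceFinMk, sub_self, dvd_zero]
  · convert h2 using 1; ring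
  · rw [← dvd_neg]; convert h1 using 1; ring
  · rw [← dvd_neg]; convert h2 using 1; ring
  · convert h0 using 1; ring
  · convert h1 using 1; ring
  · rw [← dvd_neg]; convert h0 using 1; ring

theorem closed_ker_iff (A : Matrix (Fin 3) (Fin 3) ℤ) (c l k : ℕ) (h : l + k ≠ 0)
    (w : Fin 3 → S p (l + k) × S p l) (hw : Function.Surjective (hom p w)) :
    (∀ x ∈ LinearMap.ker (hom p w), ∀ y ∈ LinearMap.ker (hom p w),
      (p : ℤ_[p]) ^ c • br A x y ∈ LinearMap.ker (hom p w))
      ↔ (p : S p (l + k)) ^ (k - c) ∣ qf A (fun j => (w j).1) := by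
  obtain ⟨i, hi⟩ := exists_isUnit_of_surjective h hw
  obtain ⟨u, v, rfl⟩ := exists_lift w
  rw [isUnit_mk_iff h] at hi
  rw [← map_qf, pow_dvd_mk_iff (by omega)]
  have hker : ∀ x, x ∈ LinearMap.ker (hom p (fun j =>
      ((Ideal.Quotient.mk _ (u j), Ideal.Quotient.mk _ (v j)) : S p (l + k) × S p l)))
      ↔ (p : ℤ_[p]) ^ (l + k) ∣ ∑ j, x j * u j ∧ (p : ℤ_[p]) ^ l ∣ ∑ j, x j * v j := by
    intro x
    rw [LinearMap.mem_ker, Prod.ext_iff, hom_mk_fst, hom_mk_snd, Prod.fst_zero, Prod.snd_zero,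
      mk_eq_zero_iff, mk_eq_zero_iff]
  rcases Nat.eq_zero_or_pos l with rfl | hl
  · -- the second component is void, and `v` may be replaced by any vector completing `u`
    obtain ⟨j, hj⟩ := exists_ne i
    obtain ⟨z, hz⟩ := exists_dual u (Pi.single j 1) i j (by simpa [hj.symm] using hi)
    refine closed_iff A c 0 k u _ z hz _ fun x => ?_
    rw [hker]
    simp
  · obtain ⟨j, hj⟩ := (surjective_iff h hl.ne' u v i hi).mp hw
    obtain ⟨z, hz⟩ := exists_dual u v i j hj
    exact closed_iff A c l k u v z hz _ hker

/-- The lattices `N` of type `(l + k, l, 0)` such that `p^c N` is a subalgebra. -/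
abbrev ClosedLattice (p : ℕ) [Fact p.Prime] (A : Matrix (Fin 3) (Fin 3) ℤ) (c l k : ℕ) : Type :=
  {N : Submodule ℤ_[p] (Fin 3 → ℤ_[p]) //
    Nonempty (((Fin 3 → ℤ_[p]) ⧸ N) ≃ₗ[ℤ_[p]] (S p (l + k) × S p l)) ∧
    ∀ x ∈ N, ∀ y ∈ N, (p : ℤ_[p]) ^ c • br A x y ∈ N}

theorem card_closedLattice (A : Matrix (Fin 3) (Fin 3) ℤ) (c l k : ℕ) (h : l + k ≠ 0) :
    (Nat.card (ClosedLattice p A c l k) : ℚ)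
        * Nat.card {w : Fin 3 → S p (l + k) // ∃ i, IsUnit (w i)}
      = latticeCount p k l * Nat.card {w : Fin 3 → S p (l + k) // (∃ i, IsUnit (w i)) ∧
          (p : S p (l + k)) ^ (k - c) ∣ qf A w} := by
  have h1 := congrArg (Nat.cast : ℕ → ℚ) (card_kernels (p := p) (n := 3) (l := l) h
    (fun N => ∀ x ∈ N, ∀ y ∈ N, (p : ℤ_[p]) ^ c • br A x y ∈ N)
    (fun w => (p : S p (l + k)) ^ (k - c) ∣ qf A w) (closed_ker_iff A c l k h))
  have h2 := latticeCount_mul_card_aut (p := p) k l h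
  have hfin : Finite ((S p (l + k) × S p l) ≃ₗ[ℤ_[p]] (S p (l + k) × S p l)) :=
    Finite.of_injective (fun e => (e : S p (l + k) × S p l → S p (l + k) × S p l))
      DFunLike.coe_injective
  have h3 : (Nat.card ((S p (l + k) × S p l) ≃ₗ[ℤ_[p]] (S p (l + k) × S p l)) : ℚ) ≠ 0 := by
    have : Nonempty ((S p (l + k) × S p l) ≃ₗ[ℤ_[p]] (S p (l + k) × S p l)) :=
      ⟨LinearEquiv.refl _ _⟩
    exact_mod_cast Nat.card_pos.ne'
  push_cast at h1
  have hcomp : (completions p 3 l : ℚ) ≠ 0 := by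
    cases l with
    | zero => simp [completions]
    | succ l =>
      have hp : (1 : ℚ) < p := by exact_mod_cast (Fact.out : p.Prime).one_lt
      rw [completions_rat]
      have : (p : ℚ) ^ 2 - 1 ≠ 0 := by nlinarith
      positivity
  refine mul_right_cancel₀ h3 (mul_right_cancel₀ hcomp ?_)
  linear_combination (Nat.card {w : Fin 3 → S p (l + k) // ∃ i, IsUnit (w i)} : ℚ)
    * (completions p 3 l : ℚ) * h1
    - (completions p 3 l : ℚ) * (Nat.card {w : Fin 3 → S p (l + k) // (∃ i, IsUnit (w i)) ∧
          (p : S p (l + k)) ^ (k - c) ∣ qf A w} : ℚ) * h2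

theorem card_closedLattice_zero (A : Matrix (Fin 3) (Fin 3) ℤ) (c : ℕ) :
    Nat.card (ClosedLattice p A c 0 0) = 1 := by
  rw [Nat.card_eq_one_iff_unique]
  have hN : ∀ N : Submodule ℤ_[p] (Fin 3 → ℤ_[p]),
      Nonempty (((Fin 3 → ℤ_[p]) ⧸ N) ≃ₗ[ℤ_[p]] (S p (0 + 0) × S p 0)) → N = ⊤ := by
    rintro N ⟨e⟩
    have : Subsingleton (S p (0 + 0)) := subsingleton_S_zero p
    have := e.toEquiv.subsingleton
    exact Submodule.Quotient.subsingleton_iff.mp this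
  refine ⟨⟨fun N N' => Subtype.ext ((hN _ N.2.1).trans (hN _ N'.2.1).symm)⟩,
    ⟨⟨⊤, ?_, fun _ _ _ _ => trivial⟩⟩⟩
  have : Subsingleton (S p (0 + 0)) := subsingleton_S_zero p
  have : Subsingleton ((Fin 3 → ℤ_[p]) ⧸ (⊤ : Submodule ℤ_[p] (Fin 3 → ℤ_[p]))) :=
    Submodule.Quotient.subsingleton_iff.mpr rfl
  exact ⟨LinearEquiv.ofSubsingleton _ _⟩

theorem closedLattice_hasType {A : Matrix (Fin 3) (Fin 3) ℤ} {c l k : ℕ}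
    (N : ClosedLattice p A c l k) : HasType ![l + k, l, 0] N.1 :=
  (hasType_iff_quotient (n := 1)
    (by intro i j hij; fin_cases i <;> fin_cases j <;> simp_all) rfl rfl
    (fun i => by fin_cases i; rfl) N.1).mpr N.2.1

/-- The exponents of the elementary divisors of `p^c N` for `N` of type `(l + k, l, 0)`. -/
def exponents (x : ℕ × ℕ × ℕ) : Fin 3 → ℕ := ![x.1 + x.2.1 + x.2.2, x.1 + x.2.1, x.1]

theorem exponents_antitone (x : ℕ × ℕ × ℕ) : Antitone (exponents x) := by
  intro i j hij
  fin_cases i <;> fin_cases j <;> simp_all [exponents]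
  omega

theorem exponents_injective : Function.Injective exponents := by
  rintro ⟨c, l, k⟩ ⟨c', l', k'⟩ h
  have h0 := congrFun h 0
  have h1 := congrFun h 1
  have h2 := congrFun h 2
  simp only [exponents, Matrix.cons_val] at h0 h1 h2
  simp only [Prod.mk.injEq]
  omega

theorem exists_exponents {a : Fin 3 → ℕ} (ha : Antitone a) : ∃ x, exponents x = a := by
  have h1 : a 1 ≤ a 0 := ha (by decide)
  have h2 : a 2 ≤ a 1 := ha (by decide)
  refine ⟨(a 2, a 1 - a 2, a 0 - a 1), funext fun i => ?_⟩
  fin_cases i <;> simp [exponents] <;> omega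

theorem exponents_eq (c l k : ℕ) : exponents (c, l, k) = fun i => ![l + k, l, 0] i + c := by
  ext i
  fin_cases i <;> simp [exponents] <;> omega

/-- Classification of the sublattices closed under the product. -/
theorem exists_closed_equiv (A : Matrix (Fin 3) (Fin 3) ℤ) :
    ∃ e : (Σ x : ℕ × ℕ × ℕ, ClosedLattice p A x.1 x.2.1 x.2.2) ≃
      {N : Submodule ℤ_[p] (Fin 3 → ℤ_[p]) //
        Finite ((Fin 3 → ℤ_[p]) ⧸ N) ∧ ∀ x ∈ N, ∀ y ∈ N, br A x y ∈ N},
      ∀ x, HasType (exponents x.1) (e x).1 := by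
  have htype : ∀ x : (Σ x : ℕ × ℕ × ℕ, ClosedLattice p A x.1 x.2.1 x.2.2),
      HasType (exponents x.1) (scale x.1.1 x.2.1) := by
    rintro ⟨⟨c, l, k⟩, N⟩
    rw [exponents_eq]
    exact (closedLattice_hasType N).scale c
  have hclosed : ∀ (c : ℕ) (N : Submodule ℤ_[p] (Fin 3 → ℤ_[p])),
      (∀ x ∈ N, ∀ y ∈ N, (p : ℤ_[p]) ^ c • br A x y ∈ N) ↔
      (∀ x ∈ scale c N, ∀ y ∈ scale c N, br A x y ∈ scale c N) := by
    intro c N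
    constructor
    · rintro h _ ⟨x, hx, rfl⟩ _ ⟨y, hy, rfl⟩
      rw [LinearMap.lsmul_apply, LinearMap.lsmul_apply, br_smul, mul_smul, smul_mem_scale]
      exact h x hx y hy
    · intro h x hx y hy
      have := h _ ((smul_mem_scale c).mpr hx) _ ((smul_mem_scale c).mpr hy)
      rwa [br_smul, mul_smul, smul_mem_scale] at this
  refine ⟨Equiv.ofBijective (fun x => ⟨scale x.1.1 x.2.1, (htype x).finite,
    (hclosed _ _).mp x.2.2.2⟩) ⟨?_, ?_⟩, htype⟩
  · intro x y hxy
    have hxy : scale x.1.1 x.2.1 = scale y.1.1 y.2.1 := congrArg Subtype.val hxy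
    have h1 : x.1 = y.1 := exponents_injective
      ((htype x).unique (exponents_antitone _) (exponents_antitone _) (hxy ▸ htype y))
    obtain ⟨x1, x2⟩ := x
    obtain ⟨y1, y2⟩ := y
    obtain rfl : x1 = y1 := h1
    obtain rfl : x2 = y2 := Subtype.ext (scale_injective _ hxy)
    rfl
  · rintro ⟨N, hN, hcl⟩
    obtain ⟨a, ha, hNa⟩ := exists_hasType N hN
    obtain ⟨⟨c, l, k⟩, rfl⟩ := exists_exponents ha
    rw [exponents_eq] at hNa
    obtain ⟨N', hN', rfl⟩ := hNa.exists_scale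
    have hq := (hasType_iff_quotient (p := p) (n := 1) (m := l + k) (l := l)
      (by intro i j hij; fin_cases i <;> fin_cases j <;> simp_all) rfl rfl
      (fun i => by fin_cases i; rfl) N').mp hN'
    exact ⟨⟨(c, l, k), N', hq, (hclosed c N').mpr hcl⟩, rfl⟩

end

section

variable {L : Type*} [LieRing L]

/-- The matrix of structure constants of a Lie ring with a basis of three elements. -/
noncomputable def structureMatrix (b : Module.Basis (Fin 3) ℤ L) : Matrix (Fin 3) (Fin 3) ℤ :=
  Matrix.of ![b.equivFun ⁅b 1, b 2⁆, b.equivFun ⁅b 2, b 0⁆, b.equivFun ⁅b 0, b 1⁆]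

variable {p : ℕ} [Fact p.Prime]

theorem lie_sum_three {R M : Type*} [CommRing R] [LieRing M] [LieAlgebra R M] (B : Fin 3 → M)
    (x y : Fin 3 → R) :
    ⁅x 0 • B 0 + x 1 • B 1 + x 2 • B 2, y 0 • B 0 + y 1 • B 1 + y 2 • B 2⁆
      = (x 1 * y 2 - x 2 * y 1) • ⁅B 1, B 2⁆ + (x 2 * y 0 - x 0 * y 2) • ⁅B 2, B 0⁆
        + (x 0 * y 1 - x 1 * y 0) • ⁅B 0, B 1⁆ := by
  simp only [add_lie, lie_add, smul_lie, lie_smul, lie_self, smul_zero]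
  rw [← lie_skew (B 1) (B 0), ← lie_skew (B 2) (B 1), ← lie_skew (B 0) (B 2)]
  module

theorem equivFun_lie (b : Module.Basis (Fin 3) ℤ L) (x y : ℤ_[p] ⊗[ℤ] L) :
    (b.baseChange ℤ_[p]).equivFun ⁅x, y⁆
      = br (structureMatrix b) ((b.baseChange ℤ_[p]).equivFun x)
          ((b.baseChange ℤ_[p]).equivFun y) := by
  set B := b.baseChange ℤ_[p] with hB
  have hB1 : ∀ (z : L) (j : Fin 3), B.equivFun (1 ⊗ₜ z) j = (b.equivFun z j : ℤ_[p]) := by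
    intro z j
    rw [B.equivFun_apply, b.equivFun_apply, hB, Module.Basis.baseChange_repr_tmul]
    simp
  have hBB : ∀ i j, ⁅B i, B j⁆ = (1 : ℤ_[p]) ⊗ₜ[ℤ] ⁅b i, b j⁆ := by
    intro i j
    rw [hB, Module.Basis.baseChange_apply, Module.Basis.baseChange_apply,
      LieAlgebra.ExtendScalars.bracket_tmul, one_mul]
  obtain ⟨x, rfl⟩ := B.equivFun.symm.surjective x
  obtain ⟨y, rfl⟩ := B.equivFun.symm.surjective y
  rw [LinearEquiv.apply_symm_apply, LinearEquiv.apply_symm_apply, B.equivFun_symm_apply,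
    B.equivFun_symm_apply]
  rw [Fin.sum_univ_three, Fin.sum_univ_three]
  refine (congrArg B.equivFun (lie_sum_three B x y)).trans ?_
  rw [hBB, hBB, hBB]
  ext j
  simp only [map_add, map_smul, Pi.add_apply, Pi.smul_apply, smul_eq_mul, hB1, br,
    structureMatrix, Fin.sum_univ_three, cross_apply, Matrix.of_apply, Matrix.cons_val]

/-- The finite-index subalgebras of `L(ℤ_p)`, sorted by their elementary divisors. -/
theorem exists_localSubalgebra_equiv (b : Module.Basis (Fin 3) ℤ L) :
    ∃ e : (Σ x : ℕ × ℕ × ℕ, ClosedLattice p (structureMatrix b) x.1 x.2.1 x.2.2) ≃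
      LocalSubalgebra L p,
      ∀ x, Nonempty (((ℤ_[p] ⊗[ℤ] L) ⧸ (e x).1.toSubmodule) ≃ₗ[ℤ_[p]]
        ((i : Fin 3) → S p (exponents x.1 i))) := by
  obtain ⟨e, he⟩ := exists_closed_equiv (p := p) (structureMatrix b)
  let E := (b.baseChange ℤ_[p]).equivFun
  have hE : ∀ x y, E ⁅x, y⁆ = br (structureMatrix b) (E x) (E y) := equivFun_lie b
  have hq : ∀ N : Submodule ℤ_[p] (Fin 3 → ℤ_[p]),
      Nonempty (((ℤ_[p] ⊗[ℤ] L) ⧸ N.comap E.toLinearMap) ≃ₗ[ℤ_[p]] ((Fin 3 → ℤ_[p]) ⧸ N)) :=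
    fun N => ⟨Submodule.Quotient.equiv _ _ E
      (Submodule.map_comap_eq_of_surjective E.surjective N)⟩
  let g : {N : Submodule ℤ_[p] (Fin 3 → ℤ_[p]) // Finite ((Fin 3 → ℤ_[p]) ⧸ N) ∧
      ∀ x ∈ N, ∀ y ∈ N, br (structureMatrix b) x y ∈ N} → LocalSubalgebra L p := fun N =>
    ⟨{ N.1.comap E.toLinearMap with
        lie_mem' := fun {x y} hx hy => by
          change E ⁅x, y⁆ ∈ N.1
          rw [hE]
          exact N.2.2 _ hx _ hy },
      by
        have := N.2.1
        exact Finite.of_equiv _ (hq N.1).some.symm.toEquiv⟩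
  have hg : ∀ N, (g N).1.toSubmodule = N.1.comap E.toLinearMap := fun N => rfl
  have hbij : Function.Bijective g := by
    constructor
    · intro N N' h
      have h1 : N.1.comap E.toLinearMap = N'.1.comap E.toLinearMap := by rw [← hg, h, hg]
      exact Subtype.ext (Submodule.comap_injective_of_surjective E.surjective h1)
    · rintro ⟨Λ, hΛ⟩
      have h1 : (Λ.toSubmodule.map E.toLinearMap).comap E.toLinearMap = Λ.toSubmodule :=
        Submodule.comap_map_eq_of_injective E.injective _
      refine ⟨⟨Λ.toSubmodule.map E.toLinearMap, ?_, ?_⟩, ?_⟩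
      · exact Finite.of_equiv _ (Submodule.Quotient.equiv Λ.toSubmodule _ E rfl).toEquiv
      · rintro _ ⟨x, hx, rfl⟩ _ ⟨y, hy, rfl⟩
        exact ⟨⁅x, y⁆, Λ.lie_mem hx hy, hE x y⟩
      · refine Subtype.ext (LieSubalgebra.toSubmodule_injective ?_)
        rw [hg]
        exact h1
  refine ⟨e.trans (Equiv.ofBijective g hbij), fun x => ?_⟩
  obtain ⟨e1⟩ := (he x).quotientEquiv
  obtain ⟨e2⟩ := hq (e x).1
  exact ⟨e2.trans e1⟩

end

/-! ### Densities of zeros of ternary quadratic forms modulo prime powers -/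

/-- The polar form of `qf A`. -/
def polar (A : Matrix (Fin 3) (Fin 3) ℤ) {T : Type*} [CommRing T] (x y : Fin 3 → T) : T :=
  ∑ i, ∑ j, ((A i j + A j i : ℤ) : T) * x i * y j

theorem qf_add_smul (A : Matrix (Fin 3) (Fin 3) ℤ) {T : Type*} [CommRing T] (x y : Fin 3 → T)
    (s : T) : qf A (x + s • y) = qf A x + s * polar A x y + s ^ 2 * qf A y := by
  simp only [qf, polar, Fin.sum_univ_three, Pi.add_apply, Pi.smul_apply, smul_eq_mul, Int.cast_add]
  ring

theorem polar_self (A : Matrix (Fin 3) (Fin 3) ℤ) {T : Type*} [CommRing T] (x : Fin 3 → T) :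
    polar A x x = 2 * qf A x := by
  simp only [qf, polar, Fin.sum_univ_three, Int.cast_add]
  ring

/-- The quadratic form `qf A` only involves the variables in `I`, and is nondegenerate in these:
multiplication by `D ≠ 0` factors through the polar form, by means of the vectors `Y i`. -/
structure IsReduced (A : Matrix (Fin 3) (Fin 3) ℤ) (I : Finset (Fin 3)) (D : ℤ)
    (Y : Fin 3 → Fin 3 → ℤ) : Prop where
  support : ∀ i j, A i j ≠ 0 → i ∈ I ∧ j ∈ I
  dual : ∀ i ∈ I, ∀ k, ∑ j, (A k j + A j k) * Y i j = if k = i then D else 0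
  ne_zero : D ≠ 0

theorem IsReduced.polar_dual {A : Matrix (Fin 3) (Fin 3) ℤ} {I : Finset (Fin 3)} {D : ℤ}
    {Y : Fin 3 → Fin 3 → ℤ} (h : IsReduced A I D Y) {T : Type*} [CommRing T] {i : Fin 3}
    (hi : i ∈ I) (x : Fin 3 → T) : polar A x (fun j => (Y i j : T)) = D * x i := by
  have h1 : ∀ k, ∑ j, ((A k j + A j k : ℤ) : T) * x k * (Y i j : T)
      = x k * ((if k = i then D else 0 : ℤ) : T) := by
    intro k
    rw [← h.dual i hi k, Int.cast_sum, Finset.mul_sum]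
    refine Finset.sum_congr rfl fun j _ => ?_
    push_cast
    ring
  simp only [polar, h1]
  simp [mul_comm]

/-- Over `ℤ`, the radical of a quadratic form can be split off by a unimodular substitution. -/
theorem exists_isReduced (A : Matrix (Fin 3) (Fin 3) ℤ) :
    ∃ (A' : Matrix (Fin 3) (Fin 3) ℤ) (I : Finset (Fin 3)) (D : ℤ) (Y : Fin 3 → Fin 3 → ℤ)
      (U U' : Matrix (Fin 3) (Fin 3) ℤ), IsReduced A' I D Y ∧ U * U' = 1 ∧ U' * U = 1 ∧
      ∀ (T : Type) [CommRing T] (x : Fin 3 → T), qf A' x = qf A (fun i => ∑ j, (U i j : T) * x j) := by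
  classical
  let K : Submodule ℤ (Fin 3 → ℤ) := LinearMap.ker (A + A.transpose).mulVecLin
  obtain ⟨n, b, bK, f, a, hsnf⟩ := Submodule.smithNormalForm (Pi.basisFun ℤ (Fin 3)) K
  let snf : Module.Basis.SmithNormalForm K (Fin 3) n := ⟨b, bK, f, a, hsnf⟩
  have hpolar : ∀ x y : Fin 3 → ℤ, polar A x y = ∑ i, x i * (A + A.transpose).mulVec y i := by
    intro x y
    simp only [polar, Matrix.mulVec, dotProduct, Matrix.add_apply, Matrix.transpose_apply,
      Finset.mul_sum]
    refine Finset.sum_congr rfl fun i _ => Finset.sum_congr rfl fun j _ => ?_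
    push_cast
    ring
  have hsymm : ∀ x y : Fin 3 → ℤ, polar A x y = polar A y x := by
    intro x y
    simp only [polar, Fin.sum_univ_three, Int.cast_add]
    ring
  have hK : ∀ y, y ∈ K ↔ ∀ x, polar A x y = 0 := by
    intro y
    rw [LinearMap.mem_ker, Matrix.mulVecLin_apply]
    constructor
    · intro h x
      simp [hpolar, h]
    · intro h
      ext i
      have := h (Pi.single i 1)
      rw [hpolar] at this
      simpa [Pi.single_apply] using this
  let I : Finset (Fin 3) := Finset.univ.filter fun i => i ∉ Set.range f
  have hI : ∀ i, i ∉ I → b i ∈ K := by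
    intro i hi
    have hi' : i ∈ Set.range f := by simpa [I] using hi
    obtain ⟨j, rfl⟩ := hi'
    have haj : a j ≠ 0 := by
      intro h
      refine bK.ne_zero j (Subtype.ext ?_)
      rw [hsnf, h, zero_smul]
      rfl
    have h1 : a j • b (f j) ∈ K := hsnf j ▸ (bK j).2
    rw [LinearMap.mem_ker, map_smul, smul_eq_zero] at h1
    exact h1.resolve_left haj
  have hrepr : ∀ x ∈ K, ∀ i ∈ I, b.repr x i = 0 := by
    intro x hx i hi
    exact snf.repr_eq_zero_of_notMem_range ⟨x, hx⟩ (by simpa [I] using hi)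
  -- the Gram matrix on the complement of the radical
  let G : Matrix I I ℤ := Matrix.of fun i j => polar A (b i) (b j)
  have hlin : ∀ (y : Fin 3 → ℤ) (c : Fin 3 → ℤ),
      polar A y (∑ j, c j • b j) = ∑ j, polar A y (b j) * c j := by
    intro y c
    rw [hpolar]
    simp only [hpolar, ← Matrix.mulVecLin_apply, map_sum, map_smul]
    simp only [Finset.sum_apply, Pi.smul_apply, smul_eq_mul, Finset.mul_sum, Finset.sum_mul]
    rw [Finset.sum_comm]
    exact Finset.sum_congr rfl fun i _ => Finset.sum_congr rfl fun j _ => by ring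
  have hG : G.det ≠ 0 := by
    intro hdet
    obtain ⟨v, hv, hGv⟩ := Matrix.exists_mulVec_eq_zero_iff.mpr hdet
    let c : Fin 3 → ℤ := fun i => if h : i ∈ I then v ⟨i, h⟩ else 0
    have hsum : ∀ y, polar A y (∑ j, c j • b j) = ∑ j : I, polar A y (b j) * v j := by
      intro y
      rw [hlin, ← Finset.sum_subset (Finset.subset_univ I) (fun j _ hj => by simp [c, hj]),
        ← Finset.sum_coe_sort]
      exact Finset.sum_congr rfl fun j _ => by simp [c]
    have hx : ∑ j, c j • b j ∈ K := by
      rw [hK]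
      intro x
      have hb : ∀ k, polar A (b k) (∑ j, c j • b j) = 0 := by
        intro k
        by_cases hk : k ∈ I
        · rw [hsum]
          exact congrFun hGv ⟨k, hk⟩
        · rw [hsymm]
          exact (hK _).mp (hI k hk) _
      rw [hsymm, ← b.sum_repr x, hlin]
      exact Finset.sum_eq_zero fun k _ => by rw [hsymm, hb, zero_mul]
    refine hv (funext fun i => ?_)
    have := hrepr _ hx i i.2
    rw [b.repr_sum_self] at this
    simpa [c] using this
  let A' : Matrix (Fin 3) (Fin 3) ℤ := Matrix.of fun i j =>
    if i = j then qf A (b i) else if i < j then polar A (b i) (b j) else 0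
  have hA' : ∀ i j, A' i j + A' j i = polar A (b i) (b j) := by
    intro i j
    rcases lt_trichotomy i j with h | rfl | h
    · simp [A', h, h.ne, h.ne', h.not_gt]
    · simp [A', polar_self, two_mul]
    · rw [hsymm]
      simp [A', h, h.ne, h.ne', h.not_gt]
  let U : Matrix (Fin 3) (Fin 3) ℤ := (Pi.basisFun ℤ (Fin 3)).toMatrix b
  refine ⟨A', I, G.det, fun i j => if h : i ∈ I ∧ j ∈ I then G.adjugate ⟨j, h.2⟩ ⟨i, h.1⟩ else 0,
    U, b.toMatrix (Pi.basisFun ℤ (Fin 3)), ⟨?_, ?_, hG⟩,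
    Module.Basis.toMatrix_mul_toMatrix_flip _ _, Module.Basis.toMatrix_mul_toMatrix_flip _ _, ?_⟩
  · intro i j hij
    have hq : ∀ i, i ∉ I → qf A (b i) = 0 := by
      intro i hi
      have := (hK _).mp (hI i hi) (b i)
      rw [polar_self] at this
      omega
    by_contra hnot
    refine hij ?_
    simp only [A', Matrix.of_apply]
    split_ifs with h1 h2
    · subst h1
      exact hq i (by simpa using hnot)
    · by_cases hi : i ∈ I
      · exact (hK _).mp (hI j fun hj => hnot ⟨hi, hj⟩) _
      · rw [hsymm]
        exact (hK _).mp (hI i hi) _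
    · rfl
  · intro i hi k
    simp only [hA']
    rw [← Finset.sum_subset (Finset.subset_univ I) (fun j _ hj => by simp [hj]),
      ← Finset.sum_coe_sort]
    simp only [hi, Finset.coe_mem, and_self, dite_true, Subtype.coe_eta]
    by_cases hk : k ∈ I
    · have := congrFun (congrFun G.mul_adjugate ⟨k, hk⟩) ⟨i, hi⟩
      rw [Matrix.mul_apply] at this
      rw [show (∑ j : I, polar A (b k) (b j) * G.adjugate j ⟨i, hi⟩)
        = ∑ j, G ⟨k, hk⟩ j * G.adjugate j ⟨i, hi⟩ from rfl, this]
      simp [Matrix.one_apply]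
    · rw [if_neg (fun h : k = i => hk (h ▸ hi))]
      exact Finset.sum_eq_zero fun j _ => by rw [hsymm, (hK _).mp (hI k hk), zero_mul]
  · intro T _ x
    have hU : ∀ i j, U i j = b j i := fun i j => by simp [U, Module.Basis.toMatrix_apply]
    simp only [qf, polar, hU, A', Matrix.of_apply, Fin.sum_univ_three, Fin.reduceEq, if_true,
      if_false, Fin.reduceLT, Int.cast_add, Int.cast_mul, Int.cast_zero, Int.cast_id]
    ring

section

variable {p : ℕ} [Fact p.Prime]

variable (p) in
/-- The number of `x ∈ (ℤ/p^N)^3` at which the quadratic form is divisible by `p^n`. -/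
noncomputable def zeroCount (A : Matrix (Fin 3) (Fin 3) ℤ) (N n : ℕ) : ℕ :=
  Nat.card {x : Fin 3 → S p N // (p : S p N) ^ n ∣ qf A x}

theorem zeroCount_congr {A A' U U' : Matrix (Fin 3) (Fin 3) ℤ} (h1 : U * U' = 1) (h2 : U' * U = 1)
    (h : ∀ (T : Type) [CommRing T] (x : Fin 3 → T), qf A' x = qf A (fun i => ∑ j, (U i j : T) * x j))
    (N n : ℕ) : zeroCount p A' N n = zeroCount p A N n := by
  have hinv : ∀ {U U' : Matrix (Fin 3) (Fin 3) ℤ}, U * U' = 1 → ∀ x : Fin 3 → S p N,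
      (fun i => ∑ j, (U i j : S p N) * ∑ k, (U' j k : S p N) * x k) = x := by
    intro U U' hU x
    ext i
    have h3 : ∀ k, ∑ j, (U i j : S p N) * (U' j k : S p N) = if i = k then 1 else 0 := by
      intro k
      have := congrFun (congrFun hU i) k
      rw [Matrix.mul_apply, Matrix.one_apply] at this
      have := congrArg (Int.cast : ℤ → S p N) this
      push_cast at this
      exact this
    simp only [Finset.mul_sum]
    rw [Finset.sum_comm]
    simp only [← mul_assoc, ← Finset.sum_mul, h3]
    simp
  refine Nat.card_congr (Equiv.subtypeEquiv
    { toFun := fun x i => ∑ j, (U i j : S p N) * x j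
      invFun := fun x i => ∑ j, (U' i j : S p N) * x j
      left_inv := fun x => hinv h2 x
      right_inv := fun x => hinv h1 x } fun x => ?_)
  rw [h]
  rfl

theorem zeroCount_succ (A : Matrix (Fin 3) (Fin 3) ℤ) {N n : ℕ} (h : n ≤ N) :
    zeroCount p A (N + 1) n = p ^ 3 * zeroCount p A N n := by
  have hle : Ideal.span {(p : ℤ_[p]) ^ (N + 1)} ≤ Ideal.span {(p : ℤ_[p]) ^ N} := by
    rw [Ideal.span_singleton_le_span_singleton]
    exact pow_dvd_pow _ (by omega)
  let f : S p (N + 1) →+* S p N := Ideal.Quotient.factor hle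
  have hf : Function.Surjective f := Ideal.Quotient.factor_surjective hle
  let g : (Fin 3 → S p (N + 1)) →+ (Fin 3 → S p N) := f.toAddMonoidHom.compLeft (Fin 3)
  have hg : Function.Surjective g := fun y => by
    choose x hx using fun i => hf (y i)
    exact ⟨x, funext hx⟩
  have h1 := card_subtype_comp g hg (fun x => (p : S p N) ^ n ∣ qf A x)
  have h2 := card_ker_mul_card g hg
  simp only [Nat.card_pi, card_S, Finset.prod_const, Finset.card_univ, Fintype.card_fin] at h2
  have h3 : Nat.card g.ker = p ^ 3 := by
    refine Nat.eq_of_mul_eq_mul_right (pow_pos (pow_pos (Fact.out : p.Prime).pos N) 3)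
      (h2.trans ?_)
    rw [← mul_pow, pow_succ' p N]
  rw [h3] at h1
  refine Eq.trans (Nat.card_congr (Equiv.subtypeEquivRight fun x => ?_)) h1
  choose z hz using fun i => Ideal.Quotient.mk_surjective (x i)
  obtain rfl : (fun i => Ideal.Quotient.mk _ (z i)) = x := funext hz
  change _ ↔ (p : S p N) ^ n ∣ qf A (fun i => f (Ideal.Quotient.mk _ (z i)))
  simp only [f, Ideal.Quotient.factor_mk]
  rw [← map_qf, ← map_qf, pow_dvd_mk_iff (by omega), pow_dvd_mk_iff h]

variable (p) in
/-- The density of the set of `x ∈ ℤ_p^3` at which the quadratic form is divisible by `p^n`. -/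
noncomputable def density (A : Matrix (Fin 3) (Fin 3) ℤ) (n : ℕ) : ℚ :=
  zeroCount p A n n / (p : ℚ) ^ (3 * n)

theorem p_ne_zero_rat : (p : ℚ) ≠ 0 := by exact_mod_cast (Fact.out : p.Prime).ne_zero

theorem zeroCount_eq (A : Matrix (Fin 3) (Fin 3) ℤ) {N n : ℕ} (h : n ≤ N) :
    (zeroCount p A N n : ℚ) = density p A n * (p : ℚ) ^ (3 * N) := by
  induction N, h using Nat.le_induction with
  | base =>
    rw [density, div_mul_cancel₀ _ (pow_ne_zero _ p_ne_zero_rat)]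
  | succ N h ih =>
    rw [zeroCount_succ A h, Nat.cast_mul, ih]
    push_cast
    ring

theorem density_zero (A : Matrix (Fin 3) (Fin 3) ℤ) : density p A 0 = 1 := by
  have : zeroCount p A 0 0 = 1 := by
    rw [zeroCount, Nat.card_eq_one_iff_unique]
    exact ⟨inferInstance, ⟨⟨0, by simp⟩⟩⟩
  simp [density, this]

theorem card_comp_range {G H : Type*} [AddCommGroup G] [AddCommGroup H] (f : G →+ H)
    (P : H → Prop) :
    Nat.card {g // P (f g)} = Nat.card f.ker * Nat.card {h // h ∈ f.range ∧ P h} := by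
  have h1 := card_subtype_comp f.rangeRestrict f.rangeRestrict_surjective (fun h => P h)
  rw [AddMonoidHom.ker_rangeRestrict] at h1
  refine h1.trans (congrArg _ (Nat.card_congr ?_))
  exact Equiv.subtypeSubtypeEquivSubtypeInter (fun h => h ∈ f.range) P

/-- The number of zeros without a unit among the coordinates in `I`. They arise from arbitrary
vectors by substituting `p x_i` for `x_i`, `i ∈ I`, which multiplies the form by `p^2`. -/
theorem card_nonprimitive_zeros {A : Matrix (Fin 3) (Fin 3) ℤ} {I : Finset (Fin 3)}
    (hA : ∀ i j, A i j ≠ 0 → i ∈ I ∧ j ∈ I) {N n : ℕ} (hN : N ≠ 0) (h : n ≤ N) :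
    p ^ I.card * Nat.card {x : Fin 3 → S p N // (∀ i ∈ I, ¬ IsUnit (x i)) ∧ (p : S p N) ^ n ∣ qf A x}
      = zeroCount p A N (n - 2) := by
  classical
  let e : Fin 3 → S p N := fun i => if i ∈ I then p else 1
  let f : (Fin 3 → S p N) →+ (Fin 3 → S p N) :=
    { toFun := fun x i => e i * x i
      map_zero' := by ext; simp
      map_add' := fun x y => by ext; simp [mul_add] }
  have hf : ∀ x i, f x i = e i * x i := fun _ _ => rfl
  have hrange : ∀ x, x ∈ f.range ↔ ∀ i ∈ I, ¬ IsUnit (x i) := by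
    intro x
    constructor
    · rintro ⟨y, rfl⟩ i hi
      rw [not_isUnit_iff hN, hf]
      simp [e, hi]
    · intro hx
      have : ∀ i, ∃ y, e i * y = x i := by
        intro i
        by_cases hi : i ∈ I
        · obtain ⟨y, hy⟩ := (not_isUnit_iff hN).mp (hx i hi)
          exact ⟨y, by simp [e, hi, hy]⟩
        · exact ⟨x i, by simp [e, hi]⟩
      choose y hy using this
      exact ⟨y, funext hy⟩
  have hker : Nat.card f.ker = p ^ I.card := by
    have e1 : f.ker ≃ ((i : Fin 3) → {y : S p N // e i * y = 0}) :=
      (Equiv.subtypeEquivRight fun x => by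
        rw [AddMonoidHom.mem_ker, funext_iff]
        rfl).trans (Equiv.subtypePiEquivPi (p := fun i (y : S p N) => e i * y = 0))
    have h2 : ∀ i, Nat.card {y : S p N // e i * y = 0} = if i ∈ I then p else 1 := by
      intro i
      by_cases hi : i ∈ I
      · have := card_torsion_S (p := p) N 1
        rw [min_eq_right (by omega), pow_one, pow_one] at this
        rw [if_pos hi]
        refine Eq.trans ?_ this
        refine Nat.card_congr (Equiv.subtypeEquivRight fun y => ?_)
        simp only [e, if_pos hi, Algebra.smul_def, map_natCast]
      · rw [if_neg hi]
        simp [e, hi]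
    rw [Nat.card_congr e1, Nat.card_pi]
    simp only [h2, Finset.prod_ite, Finset.prod_const, one_pow, mul_one]
    simp
  have hq : ∀ x, qf A (f x) = (p : S p N) ^ 2 * qf A x := by
    intro x
    simp only [qf, Finset.mul_sum, hf]
    refine Finset.sum_congr rfl fun i _ => Finset.sum_congr rfl fun j _ => ?_
    by_cases hij : A i j = 0
    · simp [hij]
    · obtain ⟨hi, hj⟩ := hA i j hij
      simp only [e, if_pos hi, if_pos hj]
      ring
  have h1 := card_comp_range f (fun x => (p : S p N) ^ n ∣ qf A x)
  rw [hker] at h1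
  rw [zeroCount, ← Nat.card_congr (Equiv.subtypeEquivRight
    fun x => and_congr_left' (hrange x)), ← h1]
  refine Nat.card_congr (Equiv.subtypeEquivRight fun x => ?_)
  rw [hq]
  generalize qf A x = y
  obtain ⟨y, rfl⟩ := Ideal.Quotient.mk_surjective y
  have : (p : S p N) ^ 2 * Ideal.Quotient.mk _ y = Ideal.Quotient.mk _ ((p : ℤ_[p]) ^ 2 * y) := by
    simp
  rw [this, pow_dvd_mk_iff h, pow_dvd_mk_iff (by omega)]
  rcases Nat.lt_or_ge n 2 with h2 | h2
  · rw [Nat.sub_eq_zero_of_le h2.le, pow_zero]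
    exact iff_of_true ((pow_dvd_pow _ h2.le).mul_right _) (one_dvd _)
  · obtain ⟨k, rfl⟩ := Nat.exists_eq_add_of_le h2
    rw [Nat.add_sub_cancel_left, pow_add, mul_dvd_mul_iff_left (pow_ne_zero _ p_ne_zero)]

/-- The number of zeros modulo `p^n` with a unit among the coordinates in `I`. -/
theorem card_primitive_zeros {A : Matrix (Fin 3) (Fin 3) ℤ} {I : Finset (Fin 3)}
    (hA : ∀ i j, A i j ≠ 0 → i ∈ I ∧ j ∈ I) {N n : ℕ} (hN : N ≠ 0) (h : n ≤ N) :
    (Nat.card {x : Fin 3 → S p N // (∃ i ∈ I, IsUnit (x i)) ∧ (p : S p N) ^ n ∣ qf A x} : ℚ)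
      = (density p A n - density p A (n - 2) / (p : ℚ) ^ I.card) * (p : ℚ) ^ (3 * N) := by
  classical
  have h1 := congrArg (Nat.cast : ℕ → ℚ) (card_nonprimitive_zeros (p := p) hA hN h)
  have h2 : zeroCount p A N n
      = Nat.card {x : Fin 3 → S p N // (∃ i ∈ I, IsUnit (x i)) ∧ (p : S p N) ^ n ∣ qf A x}
      + Nat.card {x : Fin 3 → S p N // (∀ i ∈ I, ¬ IsUnit (x i)) ∧ (p : S p N) ^ n ∣ qf A x} := by
    rw [zeroCount, ← Nat.card_congr (Equiv.sumCompl
      (fun x : {x : Fin 3 → S p N // (p : S p N) ^ n ∣ qf A x} => ∃ i ∈ I, IsUnit (x.1 i))),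
      Nat.card_sum]
    congr 1
    · refine Nat.card_congr ((Equiv.subtypeSubtypeEquivSubtypeInter
        (fun x : Fin 3 → S p N => (p : S p N) ^ n ∣ qf A x) (fun x => ∃ i ∈ I, IsUnit (x i))).trans
        (Equiv.subtypeEquivRight fun x => and_comm))
    · refine Nat.card_congr ((Equiv.subtypeSubtypeEquivSubtypeInter
        (fun x : Fin 3 → S p N => (p : S p N) ^ n ∣ qf A x)
        (fun x => ¬ ∃ i ∈ I, IsUnit (x i))).trans
        (Equiv.subtypeEquivRight fun x => by rw [and_comm]; simp))
  have h3 := congrArg (Nat.cast : ℕ → ℚ) h2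
  push_cast at h1 h3
  rw [zeroCount_eq A h] at h3
  rw [zeroCount_eq A (by omega : n - 2 ≤ N)] at h1
  have hp : (p : ℚ) ^ I.card ≠ 0 := pow_ne_zero _ p_ne_zero_rat
  field_simp
  linear_combination -(p : ℚ) ^ I.card * h3 - h1

theorem int_isUnit {D : ℤ} (h : ¬ (p : ℤ) ∣ D) : IsUnit (D : ℤ_[p]) := by
  rw [isUnit_iff_not_dvd]
  intro hd
  have := PadicInt.pow_p_dvd_int_iff (p := p) 1 D
  rw [pow_one, pow_one] at this
  exact h (this.mp hd)

/-- Hensel's lemma in counting form: beyond the precision `2 v_p(D)`, each zero modulo `p^n` has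
exactly one `p`-th of its neighbours lifting to a zero modulo `p^(n+1)`. The neighbours of `x` are
its shifts by the multiples of `p^(n-v) Y_i`, where `x_i` is a unit: by duality the form
changes, modulo `p^(n+1)`, by the multiples of `p^n D' x_i`. -/
theorem hensel {A : Matrix (Fin 3) (Fin 3) ℤ} {I : Finset (Fin 3)} {D : ℤ}
    {Y : Fin 3 → Fin 3 → ℤ} (hA : IsReduced A I D Y) {v : ℕ} {D' : ℤ} (hD : D = p ^ v * D')
    (hD' : ¬ (p : ℤ) ∣ D') {N n : ℕ} (hv : 2 * v + 1 ≤ n) (h : n + 1 ≤ N) :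
    p * Nat.card {x : Fin 3 → S p N // (∃ i ∈ I, IsUnit (x i)) ∧ (p : S p N) ^ (n + 1) ∣ qf A x}
      = Nat.card {x : Fin 3 → S p N // (∃ i ∈ I, IsUnit (x i)) ∧ (p : S p N) ^ n ∣ qf A x} := by
  classical
  -- the direction of the shift only depends on the set of unit coordinates
  let units : (Fin 3 → S p N) → Finset (Fin 3) := fun x => I.filter fun i => IsUnit (x i)
  let ch : Finset (Fin 3) → Fin 3 := fun s => if hs : s.Nonempty then hs.choose else 0
  have hch : ∀ x : Fin 3 → S p N, (∃ i ∈ I, IsUnit (x i)) →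
      ch (units x) ∈ I ∧ IsUnit (x (ch (units x))) := by
    rintro x ⟨i, hi, hxi⟩
    have hs : (units x).Nonempty := ⟨i, by simp [units, hi, hxi]⟩
    have : ch (units x) ∈ units x := by
      simp only [ch, dif_pos hs]
      exact hs.choose_spec
    simpa [units] using this
  let w : (Fin 3 → S p N) → (Fin 3 → S p N) := fun x j =>
    (p : S p N) ^ (n - v) * (Y (ch (units x)) j : S p N)
  have hunits : ∀ (x : Fin 3 → S p N) (s : S p N) (x' : Fin 3 → S p N),
      units (x + s • w x') = units x := by
    intro x s x'
    ext i
    simp only [units, Finset.mem_filter, and_congr_right_iff]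
    intro _
    rw [← not_iff_not, not_isUnit_iff (by omega), not_isUnit_iff (by omega)]
    refine (dvd_add_left ?_)
    obtain ⟨k, hk⟩ : ∃ k, n - v = k + 1 := ⟨n - v - 1, by omega⟩
    exact ⟨s * ((p : S p N) ^ k * (Y (ch (units x')) i : S p N)), by
      simp only [w, hk, Pi.smul_apply, smul_eq_mul]; ring⟩
  have hw : ∀ x x', units x = units x' → w x = w x' := by
    intro x x' hxx
    simp only [w, hxx]
  -- expansion of the quadratic form along the shift
  have hexp : ∀ (x : Fin 3 → S p N) (s : S p N), (∃ i ∈ I, IsUnit (x i)) →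
      ∃ r, qf A (x + s • w x) = qf A x + (p : S p N) ^ n * (s * (D' * x (ch (units x))))
        + (p : S p N) ^ (n + 1) * r := by
    intro x s hx
    have h1 : w x = (p : S p N) ^ (n - v) • (fun j => (Y (ch (units x)) j : S p N)) := rfl
    obtain ⟨k, hk⟩ : ∃ k, (n - v) * 2 = n + 1 + k := ⟨(n - v) * 2 - (n + 1), by omega⟩
    refine ⟨s ^ 2 * (p : S p N) ^ k * qf A (fun j => (Y (ch (units x)) j : S p N)), ?_⟩
    rw [h1, smul_smul, qf_add_smul, hA.polar_dual (hch x hx).1, hD, mul_pow, ← pow_mul, hk]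
    have h2 : (p : S p N) ^ n = (p : S p N) ^ (n - v) * (p : S p N) ^ v := by
      rw [← pow_add]; congr 1; omega
    rw [pow_add _ (n + 1) k, h2]
    push_cast
    ring
  have hdiv : ∀ a : S p N, (p : S p N) ^ (n + 1) ∣ (p : S p N) ^ n * a ↔ (p : S p N) ∣ a := by
    intro a
    obtain ⟨a, rfl⟩ := Ideal.Quotient.mk_surjective a
    have h1 : (p : S p N) ^ n * Ideal.Quotient.mk _ a = Ideal.Quotient.mk _ ((p : ℤ_[p]) ^ n * a) := by
      simp
    have h2 := pow_dvd_mk_iff (p := p) (m := N) (n := 1) (by omega) (x := a)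
    rw [pow_one, pow_one] at h2
    rw [h1, pow_dvd_mk_iff h, h2, pow_succ, mul_dvd_mul_iff_left (pow_ne_zero _ p_ne_zero)]
  have hDunit : IsUnit (D' : S p N) := by
    have := (int_isUnit hD').map (Ideal.Quotient.mk (Ideal.span {(p : ℤ_[p]) ^ N}))
    simpa using this
  let F : {x : Fin 3 → S p N // (∃ i ∈ I, IsUnit (x i)) ∧ (p : S p N) ^ (n + 1) ∣ qf A x} × Fin p →
      {x : Fin 3 → S p N // (∃ i ∈ I, IsUnit (x i)) ∧ (p : S p N) ^ n ∣ qf A x} := fun y =>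
    ⟨y.1.1 + ((y.2 : ℕ) : S p N) • w y.1.1, by
      constructor
      · have h1 := hch _ y.1.2.1
        rw [← hunits y.1.1 ((y.2 : ℕ) : S p N) y.1.1] at h1
        have h2 : ch (units (y.1.1 + ((y.2 : ℕ) : S p N) • w y.1.1)) ∈
            units (y.1.1 + ((y.2 : ℕ) : S p N) • w y.1.1) := by
          have h3 := hch _ y.1.2.1
          rw [hunits]
          simp [units, h3]
        exact ⟨_, Finset.mem_filter.mp h2⟩
      · obtain ⟨r, hr⟩ := hexp y.1.1 ((y.2 : ℕ) : S p N) y.1.2.1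
        rw [hr]
        refine dvd_add (dvd_add ((pow_dvd_pow _ (Nat.le_succ n)).trans y.1.2.2)
          (Dvd.intro _ rfl)) ((pow_dvd_pow _ (Nat.le_succ n)).mul_right _)⟩
  have hbij : Function.Bijective F := by
    constructor
    · rintro ⟨⟨x, hx, hqx⟩, t⟩ ⟨⟨x', hx', hqx'⟩, t'⟩ hF
      have hF : x + ((t : ℕ) : S p N) • w x = x' + ((t' : ℕ) : S p N) • w x' :=
        congrArg Subtype.val hF
      have hu : units x = units x' := by
        rw [← hunits x ((t : ℕ) : S p N) x, hF, hunits]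
      rw [← hw x x' hu] at hF
      have hx'eq : x' = x + (((t : ℕ) : S p N) - ((t' : ℕ) : S p N)) • w x := by
        rw [sub_smul, ← add_sub_assoc, hF, add_sub_cancel_right]
      obtain ⟨r, hr⟩ := hexp x (((t : ℕ) : S p N) - ((t' : ℕ) : S p N)) hx
      rw [← hx'eq] at hr
      have h1 : (p : S p N) ^ (n + 1) ∣ (p : S p N) ^ n *
          ((((t : ℕ) : S p N) - ((t' : ℕ) : S p N)) * (D' * x (ch (units x)))) := by
        have : (p : S p N) ^ n *
          ((((t : ℕ) : S p N) - ((t' : ℕ) : S p N)) * (D' * x (ch (units x))))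
          = qf A x' - qf A x - (p : S p N) ^ (n + 1) * r := by rw [hr]; ring
        rw [this]
        exact dvd_sub (dvd_sub hqx' hqx) (Dvd.intro _ rfl)
      rw [hdiv, (hDunit.mul (hch x hx).2).dvd_mul_right] at h1
      have h2 : ((t : ℕ) : S p N) - ((t' : ℕ) : S p N)
          = Ideal.Quotient.mk _ (((t : ℤ) - (t' : ℤ) : ℤ) : ℤ_[p]) := by simp
      have h3 := pow_dvd_mk_iff (p := p) (m := N) (n := 1) (by omega)
        (x := (((t : ℤ) - (t' : ℤ) : ℤ) : ℤ_[p]))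
      have h4 := PadicInt.pow_p_dvd_int_iff (p := p) 1 ((t : ℤ) - (t' : ℤ))
      rw [pow_one, pow_one] at h3 h4
      rw [h2, h3, h4] at h1
      have htt : t = t' := by
        have ht := t.2
        have ht' := t'.2
        ext
        have h5 := Int.eq_zero_of_abs_lt_dvd h1 (by rw [abs_lt]; omega)
        omega
      subst htt
      rw [sub_self, zero_smul, add_zero] at hx'eq
      subst hx'eq
      rfl
    · rintro ⟨y, hy, a, ha⟩
      obtain ⟨c, hc⟩ := (hDunit.mul (hch y hy).2).exists_left_inv
      obtain ⟨z, hz⟩ := Ideal.Quotient.mk_surjective (a * c)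
      obtain ⟨t, ht, htz⟩ := PadicInt.exists_mem_range z
      have htz' : (p : S p N) ∣ a * c - (t : S p N) := by
        rw [PadicInt.maximalIdeal_eq_span_p, Ideal.mem_span_singleton] at htz
        obtain ⟨r, hr⟩ := htz
        exact ⟨Ideal.Quotient.mk _ r, by
          rw [← hz]
          have := congrArg (Ideal.Quotient.mk (Ideal.span {(p : ℤ_[p]) ^ N})) hr
          simpa using this⟩
      let x : Fin 3 → S p N := y + (-(t : S p N)) • w y
      have hux : units x = units y := hunits y _ y
      have hx : ∃ i ∈ I, IsUnit (x i) := by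
        have h1 := hch y hy
        have h2 : ch (units y) ∈ units x := by
          rw [hux]
          simp [units, h1]
        exact ⟨_, Finset.mem_filter.mp h2⟩
      have hqx : (p : S p N) ^ (n + 1) ∣ qf A x := by
        obtain ⟨r, hr⟩ := hexp y (-(t : S p N)) hy
        rw [hr, ha]
        refine dvd_add ?_ (Dvd.intro _ rfl)
        rw [← mul_add, hdiv]
        have : a + -(t : S p N) * (D' * y (ch (units y)))
            = (a * c - t) * (D' * y (ch (units y))) := by
          linear_combination (-a) * hc
        rw [this]
        exact htz'.mul_right _
      refine ⟨(⟨x, hx, hqx⟩, ⟨t, ht⟩), Subtype.ext ?_⟩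
      change x + (t : S p N) • w x = y
      rw [hw x y hux]
      simp [x]
  rw [← Nat.card_congr (Equiv.ofBijective F hbij), Nat.card_prod, Nat.card_fin, mul_comm]

end

/-! ### Points of conics over finite fields -/

section

variable {F : Type*} [Field F]

theorem polar_add_smul (A : Matrix (Fin 3) (Fin 3) ℤ) {T : Type*} [CommRing T] (x y v : Fin 3 → T)
    (s : T) : polar A (x + s • y) v = polar A x v + s * polar A y v := by
  simp only [polar, Fin.sum_univ_three, Pi.add_apply, Pi.smul_apply, smul_eq_mul]
  ring

/-- The lines through an isotropic vector `v` not orthogonal to `v` contain exactly one zero of the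
quadratic form. -/
theorem card_zeros_not_orthogonal [Finite F] (A : Matrix (Fin 3) (Fin 3) ℤ) (v : Fin 3 → F)
    (hv : qf A v = 0)
    (hv' : ∃ y, polar A y v ≠ 0) :
    Nat.card {x : Fin 3 → F // qf A x = 0 ∧ polar A x v ≠ 0} + Nat.card F = Nat.card F ^ 2 ∧
    Nat.card {x : Fin 3 → F // polar A x v = 0} = Nat.card F ^ 2 := by
  classical
  have hq : 0 < Nat.card F := Nat.card_pos
  let ℓ : (Fin 3 → F) →+ F :=
    { toFun := fun x => polar A x v
      map_zero' := by simp [polar]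
      map_add' := fun x y => by
        have := polar_add_smul A x y v 1
        rwa [one_smul, one_mul] at this }
  have hℓ : Function.Surjective ℓ := by
    obtain ⟨y, hy⟩ := hv'
    intro c
    refine ⟨(c / polar A y v) • y, ?_⟩
    have := polar_add_smul A 0 y v (c / polar A y v)
    rw [zero_add] at this
    change polar A _ v = c
    rw [this, div_mul_cancel₀ _ hy]
    simp [polar]
  have hker : Nat.card {x : Fin 3 → F // polar A x v = 0} = Nat.card F ^ 2 := by
    have := card_ker_mul_card ℓ hℓ
    rw [Nat.card_pi, Finset.prod_const, Finset.card_univ, Fintype.card_fin, pow_succ] at this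
    exact Nat.eq_of_mul_eq_mul_right hq this
  refine ⟨?_, hker⟩
  have hvv : polar A v v = 0 := by rw [polar_self, hv, mul_zero]
  have e : {x : Fin 3 → F // qf A x = 0 ∧ polar A x v ≠ 0} × F ≃
      {x : Fin 3 → F // polar A x v ≠ 0} := by
    refine Equiv.ofBijective (fun y => ⟨y.1.1 + y.2 • v, ?_⟩) ⟨?_, ?_⟩
    · rw [polar_add_smul, hvv, mul_zero, add_zero]
      exact y.1.2.2
    · rintro ⟨⟨x, hx, hxv⟩, t⟩ ⟨⟨x', hx', hxv'⟩, t'⟩ h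
      have h : x + t • v = x' + t' • v := congrArg Subtype.val h
      have hx'eq : x' = x + (t - t') • v := by
        rw [sub_smul, ← add_sub_assoc, h, add_sub_cancel_right]
      rw [hx'eq, qf_add_smul, hx, hv, mul_zero, add_zero, zero_add, mul_eq_zero, sub_eq_zero] at hx'
      obtain rfl := hx'.resolve_right hxv
      rw [sub_self, zero_smul, add_zero] at hx'eq
      subst hx'eq
      rfl
    · rintro ⟨y, hy⟩
      refine ⟨(⟨y + (-(qf A y / polar A y v)) • v, ?_, ?_⟩, qf A y / polar A y v),
        Subtype.ext ?_⟩
      · rw [qf_add_smul, hv, mul_zero, add_zero, neg_mul, div_mul_cancel₀ _ hy, add_neg_cancel]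
      · rwa [polar_add_smul, hvv, mul_zero, add_zero]
      · simp
  have h1 := Nat.card_congr e
  have h2 := Nat.card_congr (Equiv.sumCompl (fun x : Fin 3 → F => polar A x v = 0))
  rw [Nat.card_sum, hker, Nat.card_pi, Finset.prod_const, Finset.card_univ, Fintype.card_fin] at h2
  rw [Nat.card_prod] at h1
  rw [← h1] at h2
  refine Nat.eq_of_mul_eq_mul_right hq ?_
  rw [add_mul]
  linarith

variable {A : Matrix (Fin 3) (Fin 3) ℤ} {I : Finset (Fin 3)} {D : ℤ} {Y : Fin 3 → Fin 3 → ℤ}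

theorem IsReduced.exists_polar_ne_zero (hA : IsReduced A I D Y) (hD : (D : F) ≠ 0) {v : Fin 3 → F}
    {i : Fin 3} (hi : i ∈ I) (hvi : v i ≠ 0) : ∃ y, polar A y v ≠ 0 := by
  refine ⟨fun j => (Y i j : F), ?_⟩
  have hsymm : polar A (fun j => (Y i j : F)) v = polar A v (fun j => (Y i j : F)) := by
    simp only [polar, Fin.sum_univ_three, Int.cast_add]
    ring
  rw [hsymm, hA.polar_dual hi]
  exact mul_ne_zero hD hvi

/-- A ternary quadratic form over a finite field has a nontrivial zero, by the theorem of Chevalley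
and Warning. -/
theorem exists_isotropic [Fintype F] (A : Matrix (Fin 3) (Fin 3) ℤ) :
    ∃ v : Fin 3 → F, qf A v = 0 ∧ v ≠ 0 := by
  classical
  obtain ⟨q, hq⟩ := CharP.exists F
  have hqp : Fact q.Prime := ⟨CharP.char_is_prime F q⟩
  let f : MvPolynomial (Fin 3) F :=
    ∑ i, ∑ j, MvPolynomial.C (A i j : F) * MvPolynomial.X i * MvPolynomial.X j
  have hf : ∀ x, MvPolynomial.eval x f = qf A x := fun x => by simp [f, qf]
  have hdeg : f.totalDegree < Fintype.card (Fin 3) := by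
    rw [Fintype.card_fin]
    refine Nat.lt_succ_of_le ?_
    refine MvPolynomial.totalDegree_finsetSum_le fun i _ =>
      MvPolynomial.totalDegree_finsetSum_le fun j _ => ?_
    refine (MvPolynomial.totalDegree_mul _ _).trans ?_
    refine (Nat.add_le_add (MvPolynomial.totalDegree_mul _ _) le_rfl).trans ?_
    rw [MvPolynomial.totalDegree_C, MvPolynomial.totalDegree_X, MvPolynomial.totalDegree_X]
  have h1 := char_dvd_card_solutions q hdeg
  by_contra! hcon
  have h2 : Fintype.card {x : Fin 3 → F // MvPolynomial.eval x f = 0} = 1 := by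
    rw [Fintype.card_eq_one_iff]
    refine ⟨⟨0, by rw [hf]; simp [qf]⟩, fun x => Subtype.ext (hcon x.1 ?_)⟩
    rw [← hf]
    exact x.2
  rw [h2] at h1
  exact hqp.out.one_lt.ne' (Nat.dvd_one.mp h1)

/-- In rank two, the vectors orthogonal to an isotropic vector are isotropic. -/
theorem qf_eq_zero_of_rank_two (hA : IsReduced A I D Y) (hI : I.card = 2) {v x : Fin 3 → F}
    (hv : qf A v = 0) (hv' : ∃ y, polar A y v ≠ 0) {i : Fin 3} (hi : i ∈ I) (hvi : v i ≠ 0)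
    (hx : polar A x v = 0) : qf A x = 0 := by
  classical
  obtain ⟨j, hj⟩ : ∃ j, I.erase i = {j} := Finset.card_eq_one.mp (by
    rw [Finset.card_erase_of_mem hi, hI])
  have hji : j ≠ i := fun h => by
    have : j ∈ I.erase i := by rw [hj]; simp
    exact (Finset.mem_erase.mp this).1 h
  have hIij : ∀ k, k ∈ I → k = i ∨ k = j := by
    intro k hk
    by_cases hki : k = i
    · exact Or.inl hki
    · have : k ∈ I.erase i := Finset.mem_erase.mpr ⟨hki, hk⟩
      rw [hj, Finset.mem_singleton] at this
      exact Or.inr this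
  have hz : ∀ k k', (k ∉ I ∨ k' ∉ I) → A k k' = 0 := by
    intro k k' h
    by_contra hne
    have := hA.support k k' hne
    tauto
  obtain ⟨m, hm⟩ : ∃ m, (∀ f : Fin 3 → F, ∑ k, f k = f i + f j + f m) ∧ m ∉ I := by
    have h3 : ∀ i j : Fin 3, ∃ m, m ≠ i ∧ m ≠ j := by decide
    obtain ⟨m, hmi, hmj⟩ := h3 i j
    refine ⟨m, fun f => ?_, fun hmI => by rcases hIij m hmI with h | h <;> contradiction⟩
    have hu : ∀ i j m : Fin 3, j ≠ i → m ≠ i → m ≠ j → Finset.univ = {i, j, m} := by decide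
    rw [hu i j m hji hmi hmj, Finset.sum_insert (by simp [hji.symm, hmi.symm]), Finset.sum_insert
      (by simpa using hmj.symm), Finset.sum_singleton, add_assoc]
  have hqf : ∀ y : Fin 3 → F, qf A y = A i i * y i * y i + (A i j + A j i) * y i * y j
      + A j j * y j * y j := by
    intro y
    simp only [qf, hm.1, hz i m (Or.inr hm.2), hz j m (Or.inr hm.2), hz m i (Or.inl hm.2),
      hz m j (Or.inl hm.2), hz m m (Or.inl hm.2), Int.cast_zero]
    ring
  have hpol : ∀ y : Fin 3 → F, polar A y v = (2 * A i i * v i + (A i j + A j i) * v j) * y i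
      + ((A i j + A j i) * v i + 2 * A j j * v j) * y j := by
    intro y
    simp only [polar, hm.1, hz i m (Or.inr hm.2), hz j m (Or.inr hm.2), hz m i (Or.inl hm.2),
      hz m j (Or.inl hm.2), hz m m (Or.inl hm.2), Int.cast_zero, Int.cast_add, add_zero]
    ring
  rw [hpol] at hx
  rw [hqf] at hv ⊢
  obtain ⟨y, hy⟩ := hv'
  rw [hpol] at hy
  have h0 : v i * x j - v j * x i = 0 := by
    by_contra hne
    have h1 : (2 * A i i * v i + (A i j + A j i) * v j : F) * (v i * x j - v j * x i) = 0 := by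
      linear_combination (2 * x j) * hv - v j * hx
    have h2 : ((A i j + A j i) * v i + 2 * A j j * v j : F) * (v i * x j - v j * x i) = 0 := by
      linear_combination v i * hx - (2 * x i) * hv
    rw [(mul_eq_zero.mp h1).resolve_right hne, (mul_eq_zero.mp h2).resolve_right hne] at hy
    simp at hy
  have h3 : v i * v i ≠ 0 := mul_ne_zero hvi hvi
  refine (mul_eq_zero.mp (?_ : v i * v i * _ = 0)).resolve_left h3
  linear_combination (x i * x i) * hv
    + ((A i j + A j i) * v i * x i + A j j * (v i * x j + v j * x i)) * h0

/-- In rank three, the isotropic vectors orthogonal to an isotropic vector are its multiples. -/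
theorem proportional_of_rank_three (hA : IsReduced A I D Y) (hI : I.card = 3) (hD : (D : F) ≠ 0)
    {v x : Fin 3 → F} (hv : qf A v = 0) (hx : qf A x = 0) (hxv : polar A x v = 0) (i j : Fin 3) :
    x i * v j = x j * v i := by
  classical
  have hIu : I = Finset.univ := (Finset.card_eq_iff_eq_univ I).mp (by simpa using hI)
  let B : Matrix (Fin 3) (Fin 3) F := Matrix.of fun k j => ((A k j + A j k : ℤ) : F)
  have hB : B.det ≠ 0 := by
    have h1 : B * (Matrix.of fun j i => (Y i j : F)) = (D : F) • (1 : Matrix (Fin 3) (Fin 3) F) := by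
      ext k i
      have := hA.dual i (hIu ▸ Finset.mem_univ i) k
      have := congrArg (Int.cast : ℤ → F) this
      rw [Matrix.mul_apply, Matrix.smul_apply, Matrix.one_apply]
      simp only [B, Matrix.of_apply]
      push_cast at this ⊢
      rw [this]
      simp
    have h2 := congrArg Matrix.det h1
    rw [Matrix.det_mul, Matrix.det_smul, Matrix.det_one, mul_one, Fintype.card_fin] at h2
    exact left_ne_zero_of_mul (h2 ▸ pow_ne_zero 3 hD)
  have key : ∀ w : Fin 3 → F, (Matrix.of ![x, v, w]).det = 0 := by
    intro w
    have h1 : ∀ a b, (Matrix.of ![x, v, w] * B * (Matrix.of ![x, v, w]).transpose) a b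
        = polar A (![x, v, w] a) (![x, v, w] b) := by
      intro a b
      simp only [Matrix.mul_apply, Matrix.transpose_apply, Matrix.of_apply, B, polar,
        Fin.sum_univ_three]
      ring
    have hxx : polar A x x = 0 := by rw [polar_self, hx, mul_zero]
    have hvv : polar A v v = 0 := by rw [polar_self, hv, mul_zero]
    have hvx : polar A v x = 0 := by
      rw [← hxv]
      simp only [polar, Fin.sum_univ_three, Int.cast_add]
      ring
    have h2 : (Matrix.of ![x, v, w] * B * (Matrix.of ![x, v, w]).transpose).det = 0 := by
      rw [Matrix.det_fin_three]
      simp only [h1, Matrix.cons_val, hxx, hvv, hvx, hxv]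
      ring
    rw [Matrix.det_mul, Matrix.det_mul, Matrix.det_transpose] at h2
    by_contra hne
    exact mul_ne_zero (mul_ne_zero hne hB) hne h2
  have hk : ∀ k, crossProduct x v k = 0 := by
    intro k
    have := key (Pi.single k 1)
    rw [Matrix.det_fin_three] at this
    fin_cases k <;> simp [cross_apply] at this ⊢ <;> linear_combination this
  have h0 := hk 0
  have h1 := hk 1
  have h2 := hk 2
  simp only [cross_apply, Matrix.cons_val] at h0 h1 h2
  fin_cases i <;> fin_cases j <;> simp only [Fin.zero_eta, Fin.mk_one, Fin.reduceFinMk]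
  · linear_combination h2
  · linear_combination -h1
  · linear_combination -h2
  · linear_combination h0
  · linear_combination h1
  · linear_combination -h0

/-- The number of zeros over a finite field of a quadratic form in three variables, outside the
radical. -/
theorem card_zeros_field [Fintype F] (hA : IsReduced A I D Y) (hD : (D : F) ≠ 0) :
    (Nat.card {x : Fin 3 → F // (∃ i ∈ I, x i ≠ 0) ∧ qf A x = 0} = 0 ∧ I.card ≠ 3) ∨
    (Nat.card {x : Fin 3 → F // (∃ i ∈ I, x i ≠ 0) ∧ qf A x = 0} + 2 * Nat.card F
      = 2 * Nat.card F ^ 2 ∧ I.card = 2) ∨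
    (Nat.card {x : Fin 3 → F // (∃ i ∈ I, x i ≠ 0) ∧ qf A x = 0} + 1 = Nat.card F ^ 2
      ∧ I.card = 3) := by
  classical
  by_cases hex : ∃ v : Fin 3 → F, (∃ i ∈ I, v i ≠ 0) ∧ qf A v = 0
  swap
  · left
    have hempty : IsEmpty {x : Fin 3 → F // (∃ i ∈ I, x i ≠ 0) ∧ qf A x = 0} :=
      ⟨fun x => hex ⟨x.1, x.2⟩⟩
    refine ⟨Nat.card_of_isEmpty, fun hI => ?_⟩
    have hIu : I = Finset.univ := (Finset.card_eq_iff_eq_univ I).mp (by simpa using hI)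
    obtain ⟨v, hv, hv0⟩ := exists_isotropic (F := F) A
    obtain ⟨i, hi⟩ := Function.ne_iff.mp hv0
    exact hex ⟨v, ⟨i, hIu ▸ Finset.mem_univ i, hi⟩, hv⟩
  right
  obtain ⟨v, ⟨i, hi, hvi⟩, hv⟩ := hex
  have hv' := hA.exists_polar_ne_zero hD hi hvi
  obtain ⟨h3, h4⟩ := card_zeros_not_orthogonal A v hv hv'
  have hrad : ∀ x : Fin 3 → F, (∀ i ∈ I, x i = 0) → qf A x = 0 ∧ polar A x v = 0 := by
    intro x hx
    constructor
    · refine Finset.sum_eq_zero fun k _ => Finset.sum_eq_zero fun k' _ => ?_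
      by_cases hkk : A k k' = 0
      · simp [hkk]
      · simp [hx k (hA.support k k' hkk).1]
    · refine Finset.sum_eq_zero fun k _ => Finset.sum_eq_zero fun k' _ => ?_
      by_cases hkk : A k k' = 0
      · by_cases hkk' : A k' k = 0
        · simp [hkk, hkk']
        · simp [hx k (hA.support k' k hkk').2]
      · simp [hx k (hA.support k k' hkk).1]
  have hradcard : Nat.card {x : Fin 3 → F // ∀ i ∈ I, x i = 0} = Nat.card F ^ (3 - I.card) := by
    have e : {x : Fin 3 → F // ∀ i ∈ I, x i = 0} ≃ ((k : Fin 3) → {y : F // k ∈ I → y = 0}) :=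
      Equiv.subtypePiEquivPi (p := fun k (y : F) => k ∈ I → y = 0)
    have h5 : ∀ k, Nat.card {y : F // k ∈ I → y = 0} = if k ∈ I then 1 else Nat.card F := by
      intro k
      by_cases hk : k ∈ I
      · simp [hk]
      · simp [hk]
    rw [Nat.card_congr e, Nat.card_pi]
    simp only [h5, Finset.prod_ite, Finset.prod_const, one_pow, one_mul]
    congr 1
    rw [Finset.filter_not, Finset.card_sdiff]
    simp
  -- split the zeros according to orthogonality to `v` and according to membership in the radical
  have h5 : Nat.card {x : Fin 3 → F // qf A x = 0}
      = Nat.card {x : Fin 3 → F // qf A x = 0 ∧ polar A x v = 0}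
        + Nat.card {x : Fin 3 → F // qf A x = 0 ∧ polar A x v ≠ 0} := by
    rw [← Nat.card_congr (Equiv.sumCompl
      (fun x : {x : Fin 3 → F // qf A x = 0} => polar A x.1 v = 0)), Nat.card_sum]
    exact congrArg₂ _
      (Nat.card_congr (Equiv.subtypeSubtypeEquivSubtypeInter
        (fun x : Fin 3 → F => qf A x = 0) (fun x => polar A x v = 0)))
      (Nat.card_congr (Equiv.subtypeSubtypeEquivSubtypeInter
        (fun x : Fin 3 → F => qf A x = 0) (fun x => polar A x v ≠ 0)))
  have h6 : Nat.card {x : Fin 3 → F // qf A x = 0}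
      = Nat.card {x : Fin 3 → F // (∃ i ∈ I, x i ≠ 0) ∧ qf A x = 0}
        + Nat.card {x : Fin 3 → F // ∀ i ∈ I, x i = 0} := by
    rw [← Nat.card_congr (Equiv.sumCompl
      (fun x : {x : Fin 3 → F // qf A x = 0} => ∃ i ∈ I, x.1 i ≠ 0)), Nat.card_sum]
    refine congrArg₂ _
      (Nat.card_congr ((Equiv.subtypeSubtypeEquivSubtypeInter
        (fun x : Fin 3 → F => qf A x = 0) (fun x => ∃ i ∈ I, x i ≠ 0)).trans
        (Equiv.subtypeEquivRight fun x => and_comm)))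
      (Nat.card_congr ((Equiv.subtypeSubtypeEquivSubtypeInter
        (fun x : Fin 3 → F => qf A x = 0) (fun x => ¬ ∃ i ∈ I, x i ≠ 0)).trans
        (Equiv.subtypeEquivRight fun x => ?_)))
    push Not
    exact ⟨fun h => h.2, fun h => ⟨(hrad x h).1, h⟩⟩
  have hIle : I.card ≤ 3 := by simpa using Finset.card_le_univ I
  have hI1 : I.card ≠ 0 := fun h => by simp [Finset.card_eq_zero.mp h] at hi
  have hI2 : I.card ≠ 1 := by
    intro h
    obtain ⟨k, hk⟩ := Finset.card_eq_one.mp h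
    obtain rfl : i = k := by simpa [hk] using hi
    have hz : ∀ a b, ¬ (a = i ∧ b = i) → A a b = 0 := by
      intro a b hab
      by_contra hne
      have := hA.support a b hne
      simp only [hk, Finset.mem_singleton] at this
      exact hab this
    have hq : qf A v = A i i * v i * v i := by
      rw [qf, Finset.sum_eq_single i, Finset.sum_eq_single i]
      · intro b _ hb
        simp [hz i b (fun h => hb h.2)]
      · simp
      · intro a _ ha
        exact Finset.sum_eq_zero fun b _ => by simp [hz a b (fun h => ha h.1)]
      · simp
    have hp := hA.polar_dual hi v
    have hAii : (A i i : F) = 0 := by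
      rw [hq] at hv
      simpa [hvi] using hv
    have hzero : ∀ a b, ((A a b + A b a : ℤ) : F) = 0 := by
      intro a b
      by_cases hab : a = i ∧ b = i
      · obtain ⟨rfl, rfl⟩ := hab
        push_cast
        rw [hAii, add_zero]
      · rw [hz a b hab, hz b a (fun h => hab ⟨h.2, h.1⟩)]
        simp
    simp only [polar, hzero, zero_mul, Finset.sum_const_zero] at hp
    exact mul_ne_zero hD hvi hp.symm
  have hI : I.card = 2 ∨ I.card = 3 := by omega
  rcases hI with hI | hI
  · left
    refine ⟨?_, hI⟩
    have h7 : Nat.card {x : Fin 3 → F // qf A x = 0 ∧ polar A x v = 0} = Nat.card F ^ 2 := by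
      rw [← h4]
      refine Nat.card_congr (Equiv.subtypeEquivRight fun x => ?_)
      exact ⟨fun h => h.2, fun h => ⟨qf_eq_zero_of_rank_two hA hI hv hv' hi hvi h, h⟩⟩
    rw [hradcard, hI, show 3 - 2 = 1 from rfl, pow_one] at h6
    omega
  · right
    refine ⟨?_, hI⟩
    have h7 : Nat.card {x : Fin 3 → F // qf A x = 0 ∧ polar A x v = 0} = Nat.card F := by
      symm
      refine Nat.card_congr (Equiv.ofBijective (fun t => ⟨t • v, ?_, ?_⟩) ⟨?_, ?_⟩)
      · have := qf_add_smul A (0 : Fin 3 → F) v t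
        rw [zero_add, hv] at this
        rw [this]
        simp [qf, polar]
      · have := polar_add_smul A (0 : Fin 3 → F) v v t
        rw [zero_add, polar_self, hv] at this
        rw [this]
        simp [polar]
      · intro t t' h
        have := congrFun (congrArg Subtype.val h) i
        exact mul_right_cancel₀ hvi this
      · rintro ⟨x, hx, hxv⟩
        refine ⟨x i / v i, Subtype.ext (funext fun j => ?_)⟩
        have := proportional_of_rank_three hA hI hD hv hx hxv i j
        change x i / v i * v j = x j
        rw [div_mul_eq_mul_div, this, mul_div_assoc, div_self hvi,
          mul_one]
    rw [hradcard, hI, show 3 - 3 = 0 from rfl, pow_zero] at h6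
    omega

end

section

variable {p : ℕ} [Fact p.Prime]

/-- The number `m` of zeros with a nonzero coordinate in `I` modulo a prime of good reduction. For
`|I| = 2` it depends on whether the form splits modulo `p`. -/
theorem card_zeros_mod_p {A : Matrix (Fin 3) (Fin 3) ℤ} {I : Finset (Fin 3)} {D : ℤ}
    {Y : Fin 3 → Fin 3 → ℤ} (hA : IsReduced A I D Y) (hD : ¬ (p : ℤ) ∣ D) :
    let m : ℚ := p ^ 3 * (density p A 1 - 1 / (p : ℚ) ^ I.card)
    (m = 0 ∧ I.card ≠ 3) ∨ (m = 2 * (p ^ 2 - p) ∧ I.card = 2) ∨ (m = p ^ 2 - 1 ∧ I.card = 3) := by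
  intro m
  have hmax : (Ideal.span {(p : ℤ_[p]) ^ 1}).IsMaximal := by
    rw [pow_one, ← PadicInt.maximalIdeal_eq_span_p]
    infer_instance
  have h1 := card_primitive_zeros (p := p) hA.support one_ne_zero le_rfl
  have hp0 : (p : S p 1) = 0 := by
    have : (Ideal.Quotient.mk _ (p : ℤ_[p]) : S p 1) = 0 := mk_eq_zero_iff.mpr (by simp)
    simpa using this
  have hint : ∀ k : ℤ, ¬ (p : ℤ) ∣ k → IsUnit (k : S p 1) := by
    intro k hk
    have := (int_isUnit hk).map (Ideal.Quotient.mk (Ideal.span {(p : ℤ_[p]) ^ 1}))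
    simpa using this
  let _ : Field (S p 1) := Ideal.Quotient.field _
  let _ : Fintype (S p 1) := Fintype.ofFinite _
  have hD1 : (D : S p 1) ≠ 0 := (hint D hD).ne_zero
  have h2 := card_zeros_field (F := S p 1) hA hD1
  have h3 : Nat.card {x : Fin 3 → S p 1 // (∃ i ∈ I, IsUnit (x i)) ∧ (p : S p 1) ^ 1 ∣ qf A x}
      = Nat.card {x : Fin 3 → S p 1 // (∃ i ∈ I, x i ≠ 0) ∧ qf A x = 0} := by
    refine Nat.card_congr (Equiv.subtypeEquivRight fun x => ?_)
    refine and_congr (exists_congr fun i => and_congr_right fun _ => isUnit_iff_ne_zero) ?_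
    rw [pow_one (p : S p 1), hp0, zero_dvd_iff]
  rw [h3, show 1 - 2 = 0 from rfl, density_zero] at h1
  have hm : m = Nat.card {x : Fin 3 → S p 1 // (∃ i ∈ I, x i ≠ 0) ∧ qf A x = 0} := by
    rw [h1]
    ring
  have hc : Nat.card (S p 1) = p := by rw [card_S, pow_one]
  rw [hc] at h2
  rw [hm]
  rcases h2 with ⟨h, hI⟩ | ⟨h, hI⟩ | ⟨h, hI⟩
  · exact Or.inl ⟨by rw [h]; simp, hI⟩
  · refine Or.inr (Or.inl ⟨?_, hI⟩)
    have := congrArg (Nat.cast : ℕ → ℚ) h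
    push_cast at this
    linear_combination this
  · refine Or.inr (Or.inr ⟨?_, hI⟩)
    have := congrArg (Nat.cast : ℕ → ℚ) h
    push_cast at this
    linear_combination this

end

/-! ### The generating function of the densities -/

section

variable {p : ℕ} [Fact p.Prime]

variable (p) in
/-- The probability that the quadratic form is divisible by `p^n` at a primitive vector. For `n ≤ 1`
the index `n - 2` is truncated to `0`, as it should be: at a vector in `p ℤ_p^3` the form is always
divisible by `p^2`. -/
noncomputable def primitiveDensity (A : Matrix (Fin 3) (Fin 3) ℤ) (n : ℕ) : ℚ :=
  (density p A n - density p A (n - 2) / (p : ℚ) ^ 3) / (1 - 1 / (p : ℚ) ^ 3)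

theorem one_lt_p_rat : (1 : ℚ) < p := by exact_mod_cast (Fact.out : p.Prime).one_lt

theorem one_sub_pos : 0 < 1 - 1 / (p : ℚ) ^ 3 := by
  rw [sub_pos, div_lt_one (pow_pos (by linarith [one_lt_p_rat (p := p)]) 3)]
  exact one_lt_pow₀ one_lt_p_rat (by norm_num)

theorem card_primitive_dvd (A : Matrix (Fin 3) (Fin 3) ℤ) {N n : ℕ} (hN : N ≠ 0) (h : n ≤ N) :
    (Nat.card {w : Fin 3 → S p N // (∃ i, IsUnit (w i)) ∧ (p : S p N) ^ n ∣ qf A w} : ℚ)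
      = primitiveDensity p A n * Nat.card {w : Fin 3 → S p N // ∃ i, IsUnit (w i)} := by
  have h1 := card_primitive_zeros (p := p) (A := A) (I := Finset.univ) (by simp) hN h
  have h2 := card_primitive_zeros (p := p) (A := A) (I := Finset.univ) (by simp) hN (Nat.zero_le N)
  simp only [Finset.mem_univ, true_and, Finset.card_univ, Fintype.card_fin, pow_zero,
    isUnit_one.dvd, and_true, Nat.zero_sub, density_zero] at h1 h2
  rw [h1, h2, primitiveDensity, ← mul_assoc, div_mul_cancel₀ _ one_sub_pos.ne']

theorem primitiveDensity_nonneg (A : Matrix (Fin 3) (Fin 3) ℤ) (n : ℕ) :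
    0 ≤ primitiveDensity p A n ∧ primitiveDensity p A n ≤ 1 := by
  have h1 := card_primitive_dvd (p := p) A (Nat.succ_ne_zero n) (Nat.le_succ n)
  have h2 : 0 < (Nat.card {w : Fin 3 → S p (n + 1) // ∃ i, IsUnit (w i)} : ℚ) := by
    have : Nonempty {w : Fin 3 → S p (n + 1) // ∃ i, IsUnit (w i)} :=
      ⟨⟨fun _ => 1, 0, isUnit_one⟩⟩
    exact_mod_cast Nat.card_pos
  have h3 : (Nat.card {w : Fin 3 → S p (n + 1) //
      (∃ i, IsUnit (w i)) ∧ (p : S p (n + 1)) ^ n ∣ qf A w} : ℚ)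
      ≤ Nat.card {w : Fin 3 → S p (n + 1) // ∃ i, IsUnit (w i)} :=
    Nat.cast_le.mpr <| Nat.card_le_card_of_injective
      (fun w : {w : Fin 3 → S p (n + 1) // (∃ i, IsUnit (w i)) ∧ (p : S p (n + 1)) ^ n ∣ qf A w} =>
        (⟨w.1, w.2.1⟩ : {w : Fin 3 → S p (n + 1) // ∃ i, IsUnit (w i)}))
      (fun w w' h => Subtype.ext (Subtype.mk.inj h))
  rw [h1] at h3
  constructor
  · exact nonneg_of_mul_nonneg_left (h1 ▸ Nat.cast_nonneg _) h2
  · exact (mul_le_iff_le_one_left h2).mp h3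

theorem density_nonneg_le_one (A : Matrix (Fin 3) (Fin 3) ℤ) (n : ℕ) :
    0 ≤ density p A n ∧ density p A n ≤ 1 := by
  have hp : 0 < (p : ℚ) ^ (3 * n) := pow_pos (by linarith [one_lt_p_rat (p := p)]) _
  refine ⟨div_nonneg (Nat.cast_nonneg _) hp.le, (div_le_one hp).mpr ?_⟩
  have h : zeroCount p A n n ≤ Nat.card (Fin 3 → S p n) :=
    Nat.card_le_card_of_injective _ Subtype.val_injective
  rw [Nat.card_pi, Finset.prod_const, Finset.card_univ, Fintype.card_fin, card_S, ← pow_mul,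
    mul_comm] at h
  exact_mod_cast h

instance (A : Matrix (Fin 3) (Fin 3) ℤ) (c l k : ℕ) : Finite (ClosedLattice p A c l k) := by
  let f : ClosedLattice p A c l k → (Fin 3 → S p (l + k) × S p l) := fun N i =>
    N.2.1.some (Submodule.mkQ N.1 (Pi.single i 1))
  refine Finite.of_injective f fun N N' h => Subtype.ext ?_
  have h1 : N.2.1.some.toLinearMap.comp (Submodule.mkQ N.1)
      = N'.2.1.some.toLinearMap.comp (Submodule.mkQ N'.1) := by
    refine (Pi.basisFun ℤ_[p] (Fin 3)).ext fun i => ?_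
    simpa [f] using congrFun h i
  have h2 := congrArg LinearMap.ker h1
  rwa [LinearEquiv.ker_comp, LinearEquiv.ker_comp, Submodule.ker_mkQ, Submodule.ker_mkQ] at h2

/-- The number of lattices `N` of type `(l + k, l, 0)` for which `p^c N` is a subalgebra. -/
theorem card_closedLattice_eq (A : Matrix (Fin 3) (Fin 3) ℤ) (c l k : ℕ) :
    (Nat.card (ClosedLattice p A c l k) : ℚ)
      = latticeCount p k l * primitiveDensity p A (k - c) := by
  by_cases h : l + k = 0
  · obtain ⟨rfl, rfl⟩ : l = 0 ∧ k = 0 := by omega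
    rw [card_closedLattice_zero, latticeCount, primitiveDensity, Nat.zero_sub, density_zero,
      div_self one_sub_pos.ne']
    simp
  · have h1 := card_closedLattice (p := p) A c l k h
    rw [card_primitive_dvd A h (by omega), ← mul_assoc] at h1
    refine mul_right_cancel₀ ?_ h1
    have : Nonempty {w : Fin 3 → S p (l + k) // ∃ i, IsUnit (w i)} :=
      ⟨⟨fun _ => 1, 0, isUnit_one⟩⟩
    exact_mod_cast Nat.card_pos.ne'

theorem summable_of_le_one {a : ℕ → ℂ} (ha : ∀ n, ‖a n‖ ≤ 1) {u : ℂ} (hu : ‖u‖ < 1) :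
    Summable fun n => a n * u ^ n := by
  refine Summable.of_norm_bounded (summable_geometric_of_lt_one (norm_nonneg u) hu) fun n => ?_
  rw [norm_mul, norm_pow]
  exact mul_le_of_le_one_left (by positivity) (ha n)

theorem norm_ratCast_le_one {q : ℚ} (h : 0 ≤ q ∧ q ≤ 1) : ‖(q : ℂ)‖ ≤ 1 := by
  rw [Complex.norm_ratCast, abs_of_nonneg (by exact_mod_cast h.1)]
  exact_mod_cast h.2

variable (p) in
/-- The density of the zeros modulo `p^n` with a unit among `r` coordinates, for a form that
only involves these, see `card_primitive_zeros`. -/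
noncomputable def partialDensity (A : Matrix (Fin 3) (Fin 3) ℤ) (r n : ℕ) : ℚ :=
  density p A n - density p A (n - 2) / (p : ℚ) ^ r

variable (p) in
/-- The coefficients of `(1 - U/p) ∑ partialDensity (n + 1) U^n`, which measure how far the densities
are from being a geometric progression of ratio `1/p`. -/
noncomputable def defect (A : Matrix (Fin 3) (Fin 3) ℤ) (r : ℕ) : ℕ → ℚ
  | 0 => partialDensity p A r 1
  | n + 1 => partialDensity p A r (n + 2) - partialDensity p A r (n + 1) / p

/-- If the densities `partialDensity` form a geometric progression of ratio `1/p` from `n₀` on, the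
generating function of the densities on primitive vectors is rational. -/
theorem tsum_primitiveDensity (A : Matrix (Fin 3) (Fin 3) ℤ) {r n₀ : ℕ} (hr : r ≤ 3)
    (hgeom : ∀ n, n₀ ≤ n → defect p A r n = 0) {u : ℂ} (hu : ‖u‖ < 1) :
    ((p : ℂ) ^ 3 - 1) * ((p : ℂ) ^ 3 - (p : ℂ) ^ (3 - r) * u ^ 2) * (p - u)
        * ∑' n, (primitiveDensity p A (n + 1) : ℂ) * u ^ n
      = p * (p ^ 3 * ∑ n ∈ Finset.range n₀, (defect p A r n : ℂ) * u ^ n) * (p ^ 3 - u ^ 2)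
        + p ^ 3 * (p ^ (3 - r) - 1) * (1 + u) * (p - u) := by
  have hp : (p : ℂ) ≠ 0 := by exact_mod_cast (Fact.out : p.Prime).ne_zero
  have hx : (1 - 1 / (p : ℂ) ^ 3) ≠ 0 := by
    have : ((1 - 1 / (p : ℚ) ^ 3 : ℚ) : ℂ) ≠ 0 := by exact_mod_cast one_sub_pos.ne'
    simpa using this
  have hμ : ∀ n, ‖(density p A n : ℂ)‖ ≤ 1 := fun n =>
    norm_ratCast_le_one (density_nonneg_le_one A n)
  have hs0 : Summable fun n => (density p A n : ℂ) * u ^ n := summable_of_le_one hμ hu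
  have hs1 : Summable fun n => (density p A (n + 1) : ℂ) * u ^ n :=
    summable_of_le_one (fun n => hμ _) hu
  have hs2 : Summable fun n => (density p A (n + 1 - 2) : ℂ) * u ^ n :=
    summable_of_le_one (fun n => hμ _) hu
  set G := ∑' n, (density p A n : ℂ) * u ^ n with hG
  set G1 := ∑' n, (density p A (n + 1) : ℂ) * u ^ n with hG1
  have e1 : G = 1 + u * G1 := by
    rw [hG, hs0.tsum_eq_zero_add, density_zero, hG1, ← tsum_mul_left]
    congr 1
    · simp
    · exact tsum_congr fun n => by ring
  have e2 : ∑' n, (density p A (n + 1 - 2) : ℂ) * u ^ n = 1 + u * G := by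
    rw [hs2.tsum_eq_zero_add, show 0 + 1 - 2 = 0 from rfl, density_zero, hG, ← tsum_mul_left]
    congr 1
    · simp
    · exact tsum_congr fun n => by rw [show n + 1 + 1 - 2 = n by omega]; ring
  have e3 : (1 - 1 / (p : ℂ) ^ 3) * ∑' n, (primitiveDensity p A (n + 1) : ℂ) * u ^ n
      = G1 - (1 + u * G) / p ^ 3 := by
    rw [← e2, hG1, ← tsum_mul_left, ← tsum_div_const, ← hs1.tsum_sub (hs2.div_const _)]
    refine tsum_congr fun n => ?_
    rw [primitiveDensity]
    push_cast
    rw [← mul_assoc, mul_div_cancel₀ _ hx]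
    ring
  have hsM : Summable fun n => (partialDensity p A r (n + 1) : ℂ) * u ^ n := by
    refine (hs1.sub (hs2.div_const ((p : ℂ) ^ r))).congr fun n => ?_
    rw [partialDensity]
    push_cast
    ring
  have e4 : ∑' n, (partialDensity p A r (n + 1) : ℂ) * u ^ n = G1 - (1 + u * G) / p ^ r := by
    rw [← e2, hG1, ← tsum_div_const, ← hs1.tsum_sub (hs2.div_const _)]
    refine tsum_congr fun n => ?_
    rw [partialDensity]
    push_cast
    ring
  have e5 : ∑' n, (defect p A r n : ℂ) * u ^ n
      = (1 - u / p) * ∑' n, (partialDensity p A r (n + 1) : ℂ) * u ^ n := by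
    have hsd : Summable fun n => (defect p A r n : ℂ) * u ^ n :=
      summable_of_ne_finset_zero (s := Finset.range n₀) fun n hn => by
        rw [hgeom n (by simpa using hn)]
        simp
    have hsM1 := (summable_nat_add_iff 1).mpr hsM
    rw [sub_mul, one_mul, hsd.tsum_eq_zero_add, hsM.tsum_eq_zero_add, add_sub_assoc]
    congr 1
    rw [← hsM.tsum_eq_zero_add, ← tsum_mul_left, ← hsM1.tsum_sub (hsM.mul_left _)]
    refine tsum_congr fun n => ?_
    rw [defect]
    push_cast
    ring
  have e6 : ∑' n, (defect p A r n : ℂ) * u ^ n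
      = ∑ n ∈ Finset.range n₀, (defect p A r n : ℂ) * u ^ n :=
    tsum_eq_sum fun n hn => by
      rw [hgeom n (by simpa using hn)]
      simp
  rw [← e6, e5, e4]
  have hpr : (p : ℂ) ^ r * (p : ℂ) ^ (3 - r) = (p : ℂ) ^ 3 := by
    rw [← pow_add]; congr 1; omega
  have hy : (1 + u * G) / (p : ℂ) ^ r = (p : ℂ) ^ (3 - r) * (1 + u * G) / p ^ 3 := by
    rw [← hpr]
    field_simp
  rw [hy]
  generalize ∑' n, (primitiveDensity p A (n + 1) : ℂ) * u ^ n = W at *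
  generalize (p : ℂ) ^ (3 - r) = q at *
  have r1 : ((p : ℂ) ^ 3 - 1) * W = (p : ℂ) ^ 3 * G1 - (1 + u * G) := by
    field_simp at e3
    linear_combination e3
  have r2 : ((p : ℂ) ^ 3 * (1 - u / p) * (G1 - q * (1 + u * G) / p ^ 3)) * p
      = (p - u) * (p ^ 3 * G1 - q * (1 + u * G)) := by
    field_simp
  rw [e1] at r1 r2 ⊢
  linear_combination (p ^ 3 - q * u ^ 2) * (p - u) * r1 - (p ^ 3 - u ^ 2) * r2

/-! ### Summation over the lattice types -/

theorem latticeCount_nonneg (k l : ℕ) : 0 ≤ latticeCount p k l := by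
  have := one_lt_p_rat (p := p)
  rcases k with _ | k <;> rcases l with _ | l <;> simp only [latticeCount] <;> positivity

theorem latticeCount_le (k l : ℕ) :
    latticeCount p k l ≤ (p ^ 2 + p + 1) * (p + 1) * (((p : ℚ) ^ 2) ^ l * ((p : ℚ) ^ 2) ^ k) := by
  have hp := one_lt_p_rat (p := p)
  have h0 : (1 : ℚ) ≤ p + 1 := by linarith
  have h1 : (1 : ℚ) ≤ p ^ 2 + p + 1 := by nlinarith
  rcases k with _ | k <;> rcases l with _ | l <;> simp only [latticeCount, pow_zero, mul_one,
    one_mul, ← pow_mul]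
  · exact one_le_mul_of_one_le_of_one_le h1 h0
  · rw [mul_assoc]
    refine mul_le_mul_of_nonneg_left ?_ (by linarith)
    exact (pow_le_pow_right₀ hp.le (by omega)).trans (le_mul_of_one_le_left (by positivity) h0)
  · rw [mul_assoc]
    refine mul_le_mul_of_nonneg_left ?_ (by linarith)
    exact (pow_le_pow_right₀ hp.le (by omega)).trans (le_mul_of_one_le_left (by positivity) h0)
  · rw [← pow_add]
    exact mul_le_mul_of_nonneg_left (pow_le_pow_right₀ hp.le (by omega)) (by positivity)

end

theorem tsum_latticeCount_zero {p : ℕ} {z : ℂ} (hz : ‖(p : ℂ) ^ 2 * z‖ < 1) :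
    (1 - (p : ℂ) ^ 2 * z) * ∑' l, (latticeCount p 0 l : ℂ) * z ^ l = 1 + (p + 1) * z := by
  have hg := tsum_geometric_of_norm_lt_one hz
  have hgs := summable_geometric_of_norm_lt_one hz
  have hne : 1 - (p : ℂ) ^ 2 * z ≠ 0 := fun h => by
    rw [← sub_eq_zero.mp h, norm_one] at hz
    exact lt_irrefl _ hz
  have hsucc : ∀ l, (latticeCount p 0 (l + 1) : ℂ) * z ^ (l + 1)
      = ((p : ℂ) ^ 2 + p + 1) * z * ((p : ℂ) ^ 2 * z) ^ l := by
    intro l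
    simp only [latticeCount]
    push_cast
    rw [mul_pow, ← pow_mul]
    ring
  have hs : Summable fun l => (latticeCount p 0 l : ℂ) * z ^ l := by
    rw [← summable_nat_add_iff 1]
    simp only [hsucc]
    exact hgs.mul_left _
  rw [hs.tsum_eq_zero_add]
  simp only [hsucc]
  rw [tsum_mul_left, hg, latticeCount]
  field_simp
  push_cast
  ring

theorem tsum_latticeCount_succ {p : ℕ} (k : ℕ) {z : ℂ} (hz : ‖(p : ℂ) ^ 2 * z‖ < 1) :
    (1 - (p : ℂ) ^ 2 * z) * ∑' l, (latticeCount p (k + 1) l : ℂ) * z ^ l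
      = ((p : ℂ) ^ 2 + p + 1) * (p ^ 2) ^ k * (1 + p * z) := by
  have hg := tsum_geometric_of_norm_lt_one hz
  have hgs := summable_geometric_of_norm_lt_one hz
  have hne : 1 - (p : ℂ) ^ 2 * z ≠ 0 := fun h => by
    rw [← sub_eq_zero.mp h, norm_one] at hz
    exact lt_irrefl _ hz
  have hsucc : ∀ l, (latticeCount p (k + 1) (l + 1) : ℂ) * z ^ (l + 1)
      = ((p : ℂ) ^ 2 + p + 1) * (p ^ 2) ^ k * ((p + 1) * p * z) * ((p : ℂ) ^ 2 * z) ^ l := by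
    intro l
    simp only [latticeCount]
    push_cast
    rw [mul_pow, ← pow_mul, ← pow_mul]
    ring
  have hs : Summable fun l => (latticeCount p (k + 1) l : ℂ) * z ^ l := by
    rw [← summable_nat_add_iff 1]
    simp only [hsucc]
    exact hgs.mul_left _
  rw [hs.tsum_eq_zero_add]
  simp only [hsucc]
  rw [tsum_mul_left, hg, latticeCount, pow_mul]
  field_simp
  push_cast
  ring

section

variable {p : ℕ} [Fact p.Prime]

/-- The generating function of the numbers of subalgebras of all elementary divisor types, with
denominators cleared. For fixed `k` the sums over `l` and over `c` separate. -/
theorem tsum_types (a : ℕ → ℚ) (ha : ∀ n, 0 ≤ a n ∧ a n ≤ 1) (ha0 : a 0 = 1) {y z t : ℂ}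
    (hy : ‖(p : ℂ) ^ 2 * y‖ < 1) (hz : ‖(p : ℂ) ^ 2 * z‖ < 1) (ht : ‖t‖ < 1) :
    Summable (fun x : ℕ × ℕ × ℕ =>
      ((latticeCount p x.1 x.2.1 * a (x.1 - x.2.2) : ℚ) : ℂ) * (y ^ x.1 * (z ^ x.2.1 * t ^ x.2.2))) ∧
    (1 - (p : ℂ) ^ 2 * z) * (1 - t) * (1 - (p : ℂ) ^ 2 * y * t) * ∑' x : ℕ × ℕ × ℕ,
      ((latticeCount p x.1 x.2.1 * a (x.1 - x.2.2) : ℚ) : ℂ) * (y ^ x.1 * (z ^ x.2.1 * t ^ x.2.2))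
      = (1 + (p + 1) * z) * (1 - (p : ℂ) ^ 2 * y * t)
        + ((p : ℂ) ^ 2 + p + 1) * (1 + p * z) * y
          * (t + (1 - t) * ∑' n, (a (n + 1) : ℂ) * ((p : ℂ) ^ 2 * y) ^ n) := by
  have ha' : ∀ n, ‖(a n : ℂ)‖ ≤ 1 := fun n => norm_ratCast_le_one (ha n)
  have hsum : Summable (fun x : ℕ × ℕ × ℕ =>
      ((latticeCount p x.1 x.2.1 * a (x.1 - x.2.2) : ℚ) : ℂ)
        * (y ^ x.1 * (z ^ x.2.1 * t ^ x.2.2))) := by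
    have h1 : Summable fun x : ℕ × ℕ × ℕ => ‖(p : ℂ) ^ 2 * y‖ ^ x.1
        * (‖(p : ℂ) ^ 2 * z‖ ^ x.2.1 * ‖t‖ ^ x.2.2) := by
      refine Summable.mul_of_nonneg (summable_geometric_of_lt_one (norm_nonneg _) hy)
        (Summable.mul_of_nonneg (summable_geometric_of_lt_one (norm_nonneg _) hz)
          (summable_geometric_of_lt_one (norm_nonneg _) ht) ?_ ?_) ?_ ?_
      · exact fun n => pow_nonneg (norm_nonneg _) n
      · exact fun n => pow_nonneg (norm_nonneg _) n
      · exact fun n => pow_nonneg (norm_nonneg _) n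
      · exact fun n => mul_nonneg (pow_nonneg (norm_nonneg _) _) (pow_nonneg (norm_nonneg _) _)
    refine Summable.of_norm_bounded
      (h1.mul_left ((((p : ℚ) ^ 2 + p + 1) * (p + 1) : ℚ) : ℝ)) fun x => ?_
    have hb : ‖((latticeCount p x.1 x.2.1 * a (x.1 - x.2.2) : ℚ) : ℂ)‖
        ≤ ((((p : ℚ) ^ 2 + p + 1) * (p + 1) * (((p : ℚ) ^ 2) ^ x.2.1 * ((p : ℚ) ^ 2) ^ x.1) : ℚ) : ℝ)
        := by
      rw [Complex.norm_ratCast, abs_of_nonneg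
        (by exact_mod_cast mul_nonneg (latticeCount_nonneg _ _) (ha _).1)]
      exact_mod_cast (mul_le_of_le_one_right (latticeCount_nonneg _ _) (ha _).2).trans
        (latticeCount_le _ _)
    rw [norm_mul, norm_mul, norm_mul, norm_pow, norm_pow, norm_pow]
    refine (mul_le_mul_of_nonneg_right hb (by positivity)).trans (le_of_eq ?_)
    rw [norm_mul, norm_mul, norm_pow, Complex.norm_natCast, mul_pow, mul_pow]
    push_cast
    ring
  refine ⟨hsum, ?_⟩
  have hne : ∀ {w : ℂ}, ‖w‖ < 1 → 1 - w ≠ 0 := fun {w} hw h => by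
    rw [← sub_eq_zero.mp h, norm_one] at hw
    exact lt_irrefl _ hw
  -- `h k` collects the contributions of all multiples of a lattice
  let h : ℕ → ℂ := fun k => ∑' c, (a (k - c) : ℂ) * t ^ c
  have hhs : ∀ k, Summable fun c => (a (k - c) : ℂ) * t ^ c := fun k =>
    summable_of_le_one (fun c => ha' _) ht
  have hh0 : (1 - t) * h 0 = 1 := by
    have : h 0 = ∑' c, t ^ c := tsum_congr fun c => by simp [ha0]
    rw [this, tsum_geometric_of_norm_lt_one ht, mul_inv_cancel₀ (hne ht)]
  have hhsucc : ∀ k, h (k + 1) = a (k + 1) + t * h k := by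
    intro k
    simp only [h]
    rw [(hhs (k + 1)).tsum_eq_zero_add, ← tsum_mul_left]
    congr 1
    · simp
    · exact tsum_congr fun c => by rw [Nat.add_sub_add_right]; ring
  have hval : ∑' x : ℕ × ℕ × ℕ, ((latticeCount p x.1 x.2.1 * a (x.1 - x.2.2) : ℚ) : ℂ)
        * (y ^ x.1 * (z ^ x.2.1 * t ^ x.2.2))
      = ∑' k, (y ^ k * h k) * ∑' l, (latticeCount p k l : ℂ) * z ^ l := by
    rw [hsum.tsum_prod]
    refine tsum_congr fun k => ?_
    rw [(hsum.prod_factor k).tsum_prod, ← tsum_mul_left]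
    refine tsum_congr fun l => ?_
    have e : ∀ c, ((latticeCount p k l * a (k - c) : ℚ) : ℂ) * (y ^ k * (z ^ l * t ^ c))
        = ((latticeCount p k l : ℂ) * (y ^ k * z ^ l)) * ((a (k - c) : ℂ) * t ^ c) := by
      intro c
      push_cast
      ring
    simp only [e]
    rw [tsum_mul_left]
    simp only [h]
    ring
  have hks : Summable fun k => (y ^ k * h k) * ∑' l, (latticeCount p k l : ℂ) * z ^ l := by
    refine hsum.prod.congr fun k => ?_
    rw [(hsum.prod_factor k).tsum_prod, ← tsum_mul_left]
    refine tsum_congr fun l => ?_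
    have e : ∀ c, ((latticeCount p k l * a (k - c) : ℚ) : ℂ) * (y ^ k * (z ^ l * t ^ c))
        = ((latticeCount p k l : ℂ) * (y ^ k * z ^ l)) * ((a (k - c) : ℂ) * t ^ c) := by
      intro c
      push_cast
      ring
    simp only [e]
    rw [tsum_mul_left]
    simp only [h]
    ring
  have hhb : ∀ k, ‖(1 - t) * h k‖ ≤ ‖1 - t‖ * ∑' c, ‖t‖ ^ c := by
    intro k
    rw [norm_mul]
    refine mul_le_mul_of_nonneg_left ?_ (norm_nonneg _)
    refine tsum_of_norm_bounded (summable_geometric_of_lt_one (norm_nonneg _) ht).hasSum fun c => ?_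
    rw [norm_mul, norm_pow]
    exact mul_le_of_le_one_left (by positivity) (ha' _)
  have hHs : ∀ i, Summable fun k => ((p : ℂ) ^ 2 * y) ^ k * h (k + i) := by
    intro i
    have h1 : Summable fun k => ‖(p : ℂ) ^ 2 * y‖ ^ k * (‖1 - t‖ * ∑' c, ‖t‖ ^ c) :=
      (summable_geometric_of_lt_one (norm_nonneg _) hy).mul_right _
    have h2 : Summable fun k => ((p : ℂ) ^ 2 * y) ^ k * ((1 - t) * h (k + i)) := by
      refine Summable.of_norm_bounded h1 fun k => ?_
      rw [norm_mul, norm_pow]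
      exact mul_le_mul_of_nonneg_left (hhb _) (by positivity)
    refine (h2.mul_left (1 - t)⁻¹).congr fun k => ?_
    have := hne ht
    field_simp
  set H := ∑' k, ((p : ℂ) ^ 2 * y) ^ k * h (k + 1) with hH
  have hHrec : H = (∑' n, (a (n + 1) : ℂ) * ((p : ℂ) ^ 2 * y) ^ n)
      + t * (h 0 + (p : ℂ) ^ 2 * y * H) := by
    have h1 : ∑' k, ((p : ℂ) ^ 2 * y) ^ k * h (k + 0) = h 0 + (p : ℂ) ^ 2 * y * H := by
      have h2 : ∀ k, ((p : ℂ) ^ 2 * y) ^ (k + 1) * h (k + 1 + 0)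
          = (p : ℂ) ^ 2 * y * (((p : ℂ) ^ 2 * y) ^ k * h (k + 1)) := fun k => by
        rw [add_zero, pow_succ']
        ring
      rw [(hHs 0).tsum_eq_zero_add, pow_zero, one_mul, add_zero]
      simp only [h2]
      rw [tsum_mul_left]
    rw [← h1, ← tsum_mul_left, ← (summable_of_le_one (fun n => ha' (n + 1)) hy).tsum_add
      ((hHs 0).mul_left t), hH]
    exact tsum_congr fun k => by rw [hhsucc, add_zero]; ring
  have hsucc : (1 - (p : ℂ) ^ 2 * z) * ∑' k, (y ^ (k + 1) * h (k + 1))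
      * ∑' l, (latticeCount p (k + 1) l : ℂ) * z ^ l
      = ((p : ℂ) ^ 2 + p + 1) * (1 + p * z) * y * H := by
    rw [← tsum_mul_left, hH, ← tsum_mul_left]
    refine tsum_congr fun k => ?_
    rw [mul_left_comm, tsum_latticeCount_succ k hz, mul_pow]
    ring
  rw [hval, hks.tsum_eq_zero_add]
  have h0 := tsum_latticeCount_zero (p := p) hz
  rw [pow_zero, one_mul]
  linear_combination (1 - t) * (1 - (p : ℂ) ^ 2 * y * t) * h 0 * h0
    + (1 - t) * (1 - (p : ℂ) ^ 2 * y * t) * hsucc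
    + (1 + (p + 1) * z) * (1 - (p : ℂ) ^ 2 * y * t) * hh0
    + ((p : ℂ) ^ 2 + p + 1) * (1 + p * z) * y * (1 - t) * hHrec
    + ((p : ℂ) ^ 2 + p + 1) * (1 + p * z) * y * t * hh0

end

/-! ### The zeta functions as sums over lattice types -/

section

variable {L : Type*} [LieRing L] {ι : Type}

/-- The cotype term with the variables `s_1, s_2, s_3` replaced by `s_{j 1}, s_{j 2}, s_{j 3}`.
This is the term of the cotype zeta function if `j` is the identity of `Fin 3`, and that of the
subalgebra zeta function if `ι` is the one-point type. -/
noncomputable def mergedTerm (L : Type*) [LieRing L] (j : Fin 3 → ι) (p : ℕ) [Fact p.Prime]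
    (Λ : LocalSubalgebra L p) (s : ι → ℂ) : ℂ :=
  ∏ i, (cotype 3 Λ.1.toSubmodule i : ℂ) ^ (-s (j i))

theorem zetaTerm_eq_mergedTerm [Module.Free ℤ L] [Module.Finite ℤ L]
    (b : Module.Basis (Fin 3) ℤ L) (p : ℕ) [Fact p.Prime] :
    zetaTerm L p = mergedTerm L (fun _ => ()) p := by
  obtain ⟨e, he⟩ := exists_localSubalgebra_equiv (p := p) b
  ext Λ s
  obtain ⟨x, rfl⟩ := e.surjective Λ
  obtain ⟨f⟩ := he x
  rw [zetaTerm, mergedTerm, Nat.card_congr f.toEquiv, Nat.card_pi, Nat.cast_prod]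
  simp only [cotype_eq (exponents_antitone x.1) f, card_S, Fin.prod_univ_three]
  rw [← Nat.cast_mul, Complex.natCast_mul_natCast_cpow, Nat.cast_mul,
    Complex.natCast_mul_natCast_cpow]

variable {p : ℕ} [Fact p.Prime]

theorem natCast_pow_cpow (q n : ℕ) (w : ℂ) : ((q ^ n : ℕ) : ℂ) ^ w = ((q : ℂ) ^ w) ^ n := by
  induction n with
  | zero => simp
  | succ n ih => rw [pow_succ, Nat.cast_mul, Complex.natCast_mul_natCast_cpow, ih, pow_succ]

theorem norm_sq_mul_cpow_lt_one {w : ℂ} (hw : 2 < w.re) : ‖(p : ℂ) ^ 2 * (p : ℂ) ^ (-w)‖ < 1 := by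
  have hp : 1 < (p : ℝ) := by exact_mod_cast (Fact.out : p.Prime).one_lt
  rw [norm_mul, norm_pow, Complex.norm_natCast,
    Complex.norm_natCast_cpow_of_pos (Fact.out : p.Prime).pos, ← Real.rpow_natCast,
    ← Real.rpow_add (by linarith)]
  refine Real.rpow_lt_one_of_one_lt_of_neg hp ?_
  simp only [Complex.neg_re, Nat.cast_ofNat]
  linarith

theorem norm_cpow_le_one {w : ℂ} (hw : 2 < w.re) : ‖(p : ℂ) ^ (-w)‖ ≤ 1 := by
  have hp : 1 < (p : ℝ) := by exact_mod_cast (Fact.out : p.Prime).one_lt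
  rw [Complex.norm_natCast_cpow_of_pos (Fact.out : p.Prime).pos]
  refine Real.rpow_le_one_of_one_le_of_nonpos hp.le ?_
  simp only [Complex.neg_re]
  linarith

/-- The local zeta function in terms of the generating function of the densities. -/
theorem tsum_mergedTerm (b : Module.Basis (Fin 3) ℤ L) (j : Fin 3 → ι) {s : ι → ℂ}
    (hs : ∀ i, 2 < (s i).re) {y z t : ℂ} (hy : y = (p : ℂ) ^ (-s (j 0)))
    (hz : z = y * (p : ℂ) ^ (-s (j 1))) (ht : t = z * (p : ℂ) ^ (-s (j 2))) :
    Summable (fun Λ => mergedTerm L j p Λ s) ∧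
    (1 - (p : ℂ) ^ 2 * z) * (1 - t) * (1 - (p : ℂ) ^ 2 * y * t) * ∑' Λ, mergedTerm L j p Λ s
      = (1 + (p + 1) * z) * (1 - (p : ℂ) ^ 2 * y * t)
        + ((p : ℂ) ^ 2 + p + 1) * (1 + p * z) * y
          * (t + (1 - t) * ∑' n, (primitiveDensity p (structureMatrix b) (n + 1) : ℂ)
              * ((p : ℂ) ^ 2 * y) ^ n) := by
  set A := structureMatrix b with hA
  obtain ⟨e, he⟩ := exists_localSubalgebra_equiv (p := p) b
  have hterm : ∀ x, mergedTerm L j p (e x) s = y ^ x.1.2.2 * (z ^ x.1.2.1 * t ^ x.1.1) := by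
    intro x
    obtain ⟨f⟩ := he x
    rw [mergedTerm]
    simp only [cotype_eq (exponents_antitone x.1) f, Fin.prod_univ_three, natCast_pow_cpow,
      exponents, ← hy]
    simp only [Matrix.cons_val]
    rw [ht, hz]
    ring
  have hy1 : ‖(p : ℂ) ^ 2 * y‖ < 1 := hy ▸ norm_sq_mul_cpow_lt_one (hs _)
  have hz1 : ‖(p : ℂ) ^ 2 * z‖ < 1 := by
    rw [hz, ← mul_assoc, norm_mul]
    exact mul_lt_one_of_nonneg_of_lt_one_left (norm_nonneg _) hy1 (norm_cpow_le_one (hs _))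
  have ht1 : ‖t‖ < 1 := by
    have h : ‖z‖ ≤ ‖(p : ℂ) ^ 2 * z‖ := by
      rw [norm_mul, norm_pow, Complex.norm_natCast]
      refine le_mul_of_one_le_left (norm_nonneg _) (one_le_pow₀ ?_)
      exact_mod_cast (Fact.out : p.Prime).one_le
    rw [ht, norm_mul]
    exact mul_lt_one_of_nonneg_of_lt_one_left (norm_nonneg _) (h.trans_lt hz1)
      (norm_cpow_le_one (hs _))
  have ha0 : primitiveDensity p A 0 = 1 := by
    rw [primitiveDensity, Nat.zero_sub, density_zero, div_self one_sub_pos.ne']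
  obtain ⟨h1, h2⟩ := tsum_types (p := p) _ (primitiveDensity_nonneg (p := p) A) ha0 hy1 hz1 ht1
  -- the order `(c, l, k)` of the lattice types is reversed in the triple series
  let r : ℕ × ℕ × ℕ ≃ ℕ × ℕ × ℕ :=
    ⟨fun x => (x.2.2, x.2.1, x.1), fun x => (x.2.2, x.2.1, x.1), fun _ => rfl, fun _ => rfl⟩
  have hcard : ∀ x : ℕ × ℕ × ℕ, (Nat.card (ClosedLattice p A x.1 x.2.1 x.2.2) : ℂ)
      = ((latticeCount p (r x).1 (r x).2.1 * primitiveDensity p A ((r x).1 - (r x).2.2) : ℚ) : ℂ) := by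
    intro x
    rw [← card_closedLattice_eq, Rat.cast_natCast]
    rfl
  rw [← r.summable_iff] at h1
  rw [← r.tsum_eq] at h2
  have h3 : ∀ x, ∑' _ : ClosedLattice p A x.1 x.2.1 x.2.2, y ^ x.2.2 * (z ^ x.2.1 * t ^ x.1)
      = ((latticeCount p (r x).1 (r x).2.1 * primitiveDensity p A ((r x).1 - (r x).2.2) : ℚ) : ℂ)
        * (y ^ (r x).1 * (z ^ (r x).2.1 * t ^ (r x).2.2)) := by
    intro x
    rw [tsum_const, nsmul_eq_mul, hcard]
    rfl
  have hsum : Summable fun x : (Σ x : ℕ × ℕ × ℕ, ClosedLattice p A x.1 x.2.1 x.2.2) =>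
      y ^ x.1.2.2 * (z ^ x.1.2.1 * t ^ x.1.1) := by
    refine Summable.of_norm ((summable_sigma_of_nonneg fun _ => norm_nonneg _).mpr
      ⟨fun x => Summable.of_finite, ?_⟩)
    refine h1.norm.congr fun x => ?_
    rw [Function.comp_apply, ← h3, tsum_const, nsmul_eq_mul, norm_mul, Complex.norm_natCast,
      ← nsmul_eq_mul]
    exact (tsum_const _).symm
  have hsum' : Summable ((fun Λ => mergedTerm L j p Λ s) ∘ e) := hsum.congr fun x => (hterm x).symm
  refine ⟨e.summable_iff.mp hsum', ?_⟩
  rw [← h2, ← e.tsum_eq]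
  simp only [hterm]
  rw [hsum.tsum_sigma]
  simp only [h3]

end

/-! ### The rational functions -/

section

open MvPolynomial

variable {ι : Type} (j : Fin 3 → ι) (r : ℕ)

/-- The variable `X`, which is specialized to the prime. -/
noncomputable def vX : MvPolynomial (Option ι) ℚ := X none

/-- The variable belonging to the `i`-th elementary divisor. -/
noncomputable def vY (i : Fin 3) : MvPolynomial (Option ι) ℚ := X (some (j i))

/-- The denominator of the generating function of the densities on primitive vectors, for a
quadratic form in `r` essential variables. -/
noncomputable def densityDen : MvPolynomial (Option ι) ℚ :=
  (vX ^ 3 - 1) * (vX ^ 3 - vX ^ (3 - r) * (vX ^ 2 * vY j 0) ^ 2) * (vX - vX ^ 2 * vY j 0)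

/-- The numerator of the generating function of the densities on primitive vectors, where `e`
collects the defects of the densities from being a geometric progression. -/
noncomputable def densityNum (e : MvPolynomial (Option ι) ℚ) : MvPolynomial (Option ι) ℚ :=
  vX * e * (vX ^ 3 - (vX ^ 2 * vY j 0) ^ 2)
    + vX ^ 3 * (vX ^ (3 - r) - 1) * (1 + vX ^ 2 * vY j 0) * (vX - vX ^ 2 * vY j 0)

/-- The denominator of the local zeta functions. -/
noncomputable def zetaDen : MvPolynomial (Option ι) ℚ :=
  (1 - vX ^ 2 * (vY j 0 * vY j 1)) * (1 - vY j 0 * vY j 1 * vY j 2)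
    * (1 - vX ^ 2 * vY j 0 * (vY j 0 * vY j 1 * vY j 2)) * densityDen j r

/-- The numerator of the local zeta functions. -/
noncomputable def zetaNum (e : MvPolynomial (Option ι) ℚ) : MvPolynomial (Option ι) ℚ :=
  (1 + (vX + 1) * (vY j 0 * vY j 1)) * (1 - vX ^ 2 * vY j 0 * (vY j 0 * vY j 1 * vY j 2))
      * densityDen j r
    + (vX ^ 2 + vX + 1) * (1 + vX * (vY j 0 * vY j 1)) * vY j 0
      * (vY j 0 * vY j 1 * vY j 2 * densityDen j r
        + (1 - vY j 0 * vY j 1 * vY j 2) * densityNum j r e)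

/-- The local factor at a prime whose densities have the defect `e`. -/
noncomputable def localFactor (e : MvPolynomial (Option ι) ℚ) : RatXY ι :=
  algebraMap (MvPolynomial (Option ι) ℚ) (RatXY ι) (zetaNum j r e)
    / algebraMap (MvPolynomial (Option ι) ℚ) (RatXY ι) (zetaDen j r)

@[simp] theorem evalAt_vX (q : ℕ) (s : ι → ℂ) : evalAt q s vX = q := by simp [evalAt, vX]

@[simp] theorem evalAt_vY (q : ℕ) (s : ι → ℂ) (i : Fin 3) :
    evalAt q s (vY j i) = (q : ℂ) ^ (-s (j i)) := by simp [evalAt, vY]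

theorem specializeX_zetaDen_ne_zero {q : ℕ} (hq : 1 < q) : specializeX q (zetaDen j r) ≠ 0 := by
  intro h
  -- the constant coefficient is `(q^3 - 1) q^3 q`
  have h1 := congrArg (aeval (fun _ => (0 : ℚ)) : MvPolynomial ι ℚ → ℚ) h
  have hq' : (1 : ℚ) < q := by exact_mod_cast hq
  have h3 : (1 : ℚ) < (q : ℚ) ^ 3 := one_lt_pow₀ hq' (by norm_num)
  simp [specializeX, zetaDen, densityDen, vX, vY] at h1
  rcases h1 with h1 | h1
  · linarith
  · rw [h1] at hq'
    norm_num at hq'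

theorem zetaDen_ne_zero : zetaDen j r ≠ 0 := fun h =>
  specializeX_zetaDen_ne_zero j r (q := 2) (by norm_num) (by rw [h, specializeX, map_zero])

variable {L : Type*} [LieRing L] {p : ℕ} [Fact p.Prime]

/-- The local zeta function is given by `localFactor`, if the densities of the structure form agree
with those of a form whose densities eventually form a geometric progression. -/
theorem seriesEqRat_mergedTerm (b : Module.Basis (Fin 3) ℤ L) {A : Matrix (Fin 3) (Fin 3) ℤ}
    (hA : ∀ n, density p (structureMatrix b) n = density p A n) {r n₀ : ℕ} (hr : r ≤ 3)
    (hgeom : ∀ n, n₀ ≤ n → defect p A r n = 0) {e : MvPolynomial (Option ι) ℚ}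
    (he : ∀ s : ι → ℂ, evalAt p s e = p ^ 3 * ∑ n ∈ Finset.range n₀,
      (defect p A r n : ℂ) * ((p : ℂ) ^ 2 * (p : ℂ) ^ (-s (j 0))) ^ n) :
    SeriesEqRat p (mergedTerm L j p) (localFactor j r e) := by
  refine ⟨_, _, rfl, specializeX_zetaDen_ne_zero j r (Fact.out : p.Prime).one_lt, 2, fun s hs => ?_⟩
  obtain ⟨h1, h2⟩ := tsum_mergedTerm (p := p) b j hs rfl rfl rfl
  refine ⟨h1, ?_⟩
  have hu : ‖(p : ℂ) ^ 2 * (p : ℂ) ^ (-s (j 0))‖ < 1 := norm_sq_mul_cpow_lt_one (hs _)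
  have h3 := tsum_primitiveDensity (p := p) A hr hgeom hu
  rw [← he s] at h3
  have hA' : ∀ n, primitiveDensity p (structureMatrix b) n = primitiveDensity p A n := fun n => by
    rw [primitiveDensity, primitiveDensity, hA, hA]
  simp only [hA'] at h2
  have hX := evalAt_vX p s
  have hY := evalAt_vY j p s
  simp only [evalAt] at hX hY h3 ⊢
  simp only [zetaDen, zetaNum, densityDen, densityNum, map_mul, map_add, map_sub, map_pow, map_one,
    hX, hY] at h2 h3 ⊢
  generalize (∑' n, (primitiveDensity p A (n + 1) : ℂ)
    * ((p : ℂ) ^ 2 * (p : ℂ) ^ (-s (j 0))) ^ n) = W at h2 h3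
  generalize (∑' Λ, mergedTerm L j p Λ s) = Z at h2 ⊢
  generalize (p : ℂ) ^ (-s (j 0)) = y at h2 h3 ⊢
  generalize (p : ℂ) ^ (-s (j 1)) = y1 at h2 h3 ⊢
  generalize (p : ℂ) ^ (-s (j 2)) = y2 at h2 h3 ⊢
  generalize aeval (fun o : Option ι => o.elim (p : ℂ) fun i => (p : ℂ) ^ (-s i)) e = E at h3 ⊢
  generalize (p : ℂ) ^ (3 - r) = q at h3 ⊢
  linear_combination ((p : ℂ) ^ 3 - 1) * (p ^ 3 - q * (p ^ 2 * y) ^ 2) * (p - p ^ 2 * y) * h2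
    + ((p : ℂ) ^ 2 + p + 1) * (1 + p * (y * y1)) * y * (1 - y * y1 * y2) * h3

end

/-! ### Uniqueness of the rational function -/

section

open MvPolynomial

variable {ι : Type}

theorem evalAt_eq_aeval_specializeX (q : ℕ) (s : ι → ℂ) (P : MvPolynomial (Option ι) ℚ) :
    evalAt q s P = aeval (fun i => (q : ℂ) ^ (-s i)) (specializeX q P) := by
  have h : (aeval fun o : Option ι => o.elim (q : ℂ) (fun i => (q : ℂ) ^ (-s i)))
      = ((aeval (R := ℚ) fun i => (q : ℂ) ^ (-s i)).comp (aeval fun o : Option ι =>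
        o.elim (C (q : ℚ)) (fun i => (X i : MvPolynomial ι ℚ)))) := by
    ext o
    cases o <;> simp
  exact DFunLike.congr_fun h P

/-- A polynomial that vanishes at `(q^{-s_i})_i` for all `s` in a right half-space is zero. -/
theorem specializeX_eq_zero {q : ℕ} (hq : 1 < q) {σ : ℝ} {P : MvPolynomial (Option ι) ℚ}
    (h : ∀ s : ι → ℂ, (∀ i, σ < (s i).re) → evalAt q s P = 0) : specializeX q P = 0 := by
  have hinj : Function.Injective (map (algebraMap ℚ ℂ) : MvPolynomial ι ℚ → MvPolynomial ι ℂ) :=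
    map_injective _ (algebraMap ℚ ℂ).injective
  refine hinj ?_
  rw [map_zero]
  have hq' : (1 : ℝ) < q := by exact_mod_cast hq
  let g : ℝ → ℂ := fun x => (q : ℂ) ^ (-(x : ℂ))
  have hg : Function.Injective g := by
    intro x x' hx
    have h1 := congrArg norm hx
    simp only [g] at h1
    rw [Complex.norm_natCast_cpow_of_pos (by omega), Complex.norm_natCast_cpow_of_pos (by omega)]
      at h1
    simpa using Real.strictMono_rpow_of_base_gt_one hq' |>.injective h1
  -- already the real points `s` give a box with infinite sides
  refine funext_set (fun _ : ι => g '' Set.Ioi σ)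
    (fun _ => (Set.Ioi_infinite σ).image hg.injOn) fun x hx => ?_
  choose s hs using fun i => hx i (Set.mem_univ i)
  have h1 := h (fun i => (s i : ℂ)) fun i => by simpa using (hs i).1
  rw [evalAt_eq_aeval_specializeX] at h1
  have h2 : (fun i => (q : ℂ) ^ (-(s i : ℂ))) = x := funext fun i => (hs i).2
  rw [h2] at h1
  rw [map_zero, eval_map]
  exact h1

/-- A polynomial that vanishes at infinitely many values of `X` is zero. -/
theorem eq_zero_of_specializeX {T : Set ℕ} (hT : T.Infinite) {P : MvPolynomial (Option ι) ℚ}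
    (h : ∀ q ∈ T, specializeX q P = 0) : P = 0 := by
  refine funext_set (fun o : Option ι => o.elim ((Nat.cast : ℕ → ℚ) '' T) fun _ => Set.univ)
    (fun o => ?_) fun x hx => ?_
  · cases o with
    | none => exact hT.image Nat.cast_injective.injOn
    | some i => exact Set.infinite_univ
  · obtain ⟨q, hq, hqx⟩ : x none ∈ (Nat.cast : ℕ → ℚ) '' T := hx none (Set.mem_univ _)
    have h1 := congrArg (aeval (fun i => x (some i)) : MvPolynomial ι ℚ → ℚ) (h q hq)
    have h2 : (aeval x : MvPolynomial (Option ι) ℚ →ₐ[ℚ] ℚ)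
        = ((aeval (R := ℚ) fun i => x (some i)).comp (aeval fun o : Option ι =>
          o.elim (C (q : ℚ)) (fun i => (X i : MvPolynomial ι ℚ)))) := by
      ext o
      cases o <;> simp [hqx]
    rw [map_zero, ← coe_aeval_eq_eval]
    refine (DFunLike.congr_fun h2 P).trans (h1.trans (map_zero _))

/-- Two rational functions that describe the same series agree at `X = q`. -/
theorem specializeX_cross_eq_zero {α : Type*} {q : ℕ} (hq : 1 < q) {term : α → (ι → ℂ) → ℂ}
    {a b c d : MvPolynomial (Option ι) ℚ} (hb : b ≠ 0) (hd : d ≠ 0)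
    (h1 : SeriesEqRat q term (algebraMap _ (RatXY ι) a / algebraMap _ (RatXY ι) b))
    (h2 : SeriesEqRat q term (algebraMap _ (RatXY ι) c / algebraMap _ (RatXY ι) d)) :
    specializeX q (a * d - c * b) = 0 := by
  obtain ⟨P, Q, hPQ, hQ, σ, hs⟩ := h1
  obtain ⟨P', Q', hPQ', hQ', σ', hs'⟩ := h2
  have hinj : Function.Injective (algebraMap (MvPolynomial (Option ι) ℚ) (RatXY ι)) :=
    IsFractionRing.injective _ _
  have hne : ∀ {R : MvPolynomial (Option ι) ℚ}, R ≠ 0 → algebraMap _ (RatXY ι) R ≠ 0 :=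
    fun hR h => hR (hinj (h.trans (map_zero _).symm))
  have hne' : ∀ {R : MvPolynomial (Option ι) ℚ}, specializeX q R ≠ 0 → R ≠ 0 :=
    fun hR h => hR (by rw [h, specializeX, map_zero])
  rw [div_eq_div_iff (hne hb) (hne (hne' hQ)), ← map_mul, ← map_mul] at hPQ
  rw [div_eq_div_iff (hne hd) (hne (hne' hQ')), ← map_mul, ← map_mul] at hPQ'
  have e1 : specializeX q a * specializeX q Q = specializeX q P * specializeX q b := by
    simpa only [specializeX, map_mul] using congrArg (specializeX q) (hinj hPQ)
  have e2 : specializeX q c * specializeX q Q' = specializeX q P' * specializeX q d := by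
    simpa only [specializeX, map_mul] using congrArg (specializeX q) (hinj hPQ')
  have e3 : specializeX q (P * Q' - P' * Q) = 0 := by
    refine specializeX_eq_zero hq (σ := max σ σ') fun s hσ => ?_
    have t1 := (hs s fun i => (le_max_left _ _).trans_lt (hσ i)).2
    have t2 := (hs' s fun i => (le_max_right _ _).trans_lt (hσ i)).2
    have t3 : evalAt q s (P * Q' - P' * Q)
        = evalAt q s P * evalAt q s Q' - evalAt q s P' * evalAt q s Q := by
      simp only [evalAt, map_sub, map_mul]
    rw [t3, ← t1, ← t2]
    ring
  have e3' : specializeX q P * specializeX q Q' - specializeX q P' * specializeX q Q = 0 := by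
    simpa only [specializeX, map_mul, map_sub] using e3
  have e4 : specializeX q Q * specializeX q Q' * specializeX q (a * d - c * b) = 0 := by
    have : specializeX q (a * d - c * b)
        = specializeX q a * specializeX q d - specializeX q c * specializeX q b := by
      simp only [specializeX, map_sub, map_mul]
    rw [this]
    linear_combination specializeX q Q' * specializeX q d * e1
      - specializeX q Q * specializeX q b * e2 + specializeX q b * specializeX q d * e3'
  exact (mul_eq_zero.mp e4).resolve_left (mul_ne_zero hQ hQ')

end

/-! ### Local factors at good and bad primes -/

section

variable {p : ℕ} [Fact p.Prime]

/-- By Hensel's lemma the defects vanish beyond the precision `2 v_p(D)`. -/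
theorem IsReduced.defect_eq_zero {A : Matrix (Fin 3) (Fin 3) ℤ} {I : Finset (Fin 3)} {D : ℤ}
    {Y : Fin 3 → Fin 3 → ℤ} (hA : IsReduced A I D Y) {v : ℕ} {D' : ℤ} (hD : D = p ^ v * D')
    (hD' : ¬ (p : ℤ) ∣ D') {n : ℕ} (hn : 2 * v + 1 ≤ n) : defect p A I.card n = 0 := by
  obtain ⟨m, rfl⟩ : ∃ m, n = m + 1 := ⟨n - 1, by omega⟩
  have h1 := congrArg (Nat.cast : ℕ → ℚ) (hensel hA hD hD' hn (le_refl (m + 1 + 1)))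
  rw [Nat.cast_mul, card_primitive_zeros hA.support (by omega) le_rfl,
    card_primitive_zeros hA.support (by omega) (Nat.le_succ _), ← mul_assoc] at h1
  have h2 := mul_right_cancel₀ (pow_ne_zero _ (p_ne_zero_rat (p := p))) h1
  rw [defect, partialDensity, partialDensity, ← h2, mul_div_cancel_left₀ _ p_ne_zero_rat, sub_self]

theorem defect_zero (A : Matrix (Fin 3) (Fin 3) ℤ) (r : ℕ) :
    defect p A r 0 = density p A 1 - 1 / (p : ℚ) ^ r := by
  rw [defect, partialDensity, show 1 - 2 = 0 from rfl, density_zero]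

end

section

variable {L : Type*} [LieRing L]

/-- The rational functions describing the local zeta functions. Up to finitely many primes the
local factor only depends on the number `r` of essential variables of the structure form and, in
the case `r = 2`, on whether the form splits modulo the prime. Both this number and the set of
primes at which the form splits are the same for all choices of variables `j`. -/
theorem exists_localFactor (b : Module.Basis (Fin 3) ℤ L) :
    ∃ (r : ℕ) (bad : Finset ℕ) (split : Set ℕ), ∀ (ι : Type) (j : Fin 3 → ι) (p : ℕ)
      [Fact p.Prime], (∃ e, SeriesEqRat p (mergedTerm L j p) (localFactor j r e)) ∧
      (p ∉ bad →
        (r = 3 → SeriesEqRat p (mergedTerm L j p) (localFactor j r (vX ^ 2 - 1))) ∧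
        (r ≠ 3 → p ∉ split → SeriesEqRat p (mergedTerm L j p) (localFactor j r 0)) ∧
        (r ≠ 3 → p ∈ split → r = 2 ∧
          SeriesEqRat p (mergedTerm L j p) (localFactor j r (2 * (vX ^ 2 - vX))))) := by
  obtain ⟨A, I, D, Y, U, U', hA, hU, hU', hf⟩ := exists_isReduced (structureMatrix b)
  refine ⟨I.card, D.natAbs.primeFactors,
    {p | ∃ h : p.Prime, @defect p ⟨h⟩ A I.card 0 ≠ 0}, fun ι j p _ => ?_⟩
  have hr : I.card ≤ 3 := by simpa using I.card_le_univ
  have hdens : ∀ n, density p (structureMatrix b) n = density p A n := fun n => by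
    rw [density, density, zeroCount_congr hU hU' hf]
  refine ⟨?_, fun hp => ?_⟩
  · have hfin : FiniteMultiplicity (p : ℤ) D := Int.finiteMultiplicity_iff.mpr
      ⟨by simpa using (Fact.out : p.Prime).ne_one, hA.ne_zero⟩
    obtain ⟨D', hD, hD'⟩ := hfin.exists_eq_pow_mul_and_not_dvd
    refine ⟨∑ n ∈ Finset.range (2 * multiplicity (p : ℤ) D + 1),
      MvPolynomial.C ((p : ℚ) ^ 3 * defect p A I.card n) * (vX ^ 2 * vY j 0) ^ n,
      seriesEqRat_mergedTerm j b hdens hr (fun n hn => hA.defect_eq_zero hD hD' hn) fun s => ?_⟩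
    have hX := evalAt_vX p s
    have hY := evalAt_vY j p s
    simp only [evalAt] at hX hY ⊢
    rw [map_sum, Finset.mul_sum]
    refine Finset.sum_congr rfl fun n _ => ?_
    simp only [map_mul, map_pow, hX, hY, MvPolynomial.aeval_C, eq_ratCast]
    push_cast
    ring
  · have hpD : ¬ (p : ℤ) ∣ D := fun h => hp <| by
      rw [Nat.mem_primeFactors]
      exact ⟨Fact.out, Int.natCast_dvd.mp h, by simpa using hA.ne_zero⟩
    have hgood : ∀ e : MvPolynomial (Option ι) ℚ,
        (∀ s, evalAt p s e = ((p ^ 3 * (density p A 1 - 1 / (p : ℚ) ^ I.card) : ℚ) : ℂ)) →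
        SeriesEqRat p (mergedTerm L j p) (localFactor j I.card e) := by
      intro e he
      refine seriesEqRat_mergedTerm j b hdens (n₀ := 1) hr (fun n hn =>
        hA.defect_eq_zero (v := 0) (D' := D) (by simp) hpD (by simpa using hn)) fun s => ?_
      rw [he, Finset.sum_range_one, defect_zero, pow_zero, mul_one]
      push_cast
      ring
    have hmem : (p ∈ {p | ∃ h : p.Prime, @defect p ⟨h⟩ A I.card 0 ≠ 0}) ↔
        p ^ 3 * (density p A 1 - 1 / (p : ℚ) ^ I.card) ≠ 0 := by
      have h1 : (p ∈ {p | ∃ h : p.Prime, @defect p ⟨h⟩ A I.card 0 ≠ 0}) ↔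
          defect p A I.card 0 ≠ 0 := ⟨fun ⟨_, h⟩ => h, fun h => ⟨Fact.out, h⟩⟩
      rw [h1, defect_zero, mul_ne_zero_iff, and_iff_right (pow_ne_zero _ p_ne_zero_rat)]
    rw [hmem]
    have hX := evalAt_vX (ι := ι) p
    simp only [evalAt] at hX hgood
    rcases card_zeros_mod_p hA hpD with ⟨hm, h3⟩ | ⟨hm, h2⟩ | ⟨hm, h3⟩
    · refine ⟨fun h => absurd h h3, fun _ _ => hgood _ fun s => ?_, fun _ h => absurd hm h⟩
      rw [hm]
      simp
    · have hne : (2 * ((p : ℚ) ^ 2 - p)) ≠ 0 := by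
        have := one_lt_p_rat (p := p)
        nlinarith
      refine ⟨fun h => by omega, fun _ h => absurd (hm ▸ hne) h,
        fun _ _ => ⟨h2, hgood _ fun s => ?_⟩⟩
      rw [hm]
      simp only [map_mul, map_sub, map_pow, map_ofNat, hX]
      push_cast
      ring
    · refine ⟨fun _ => hgood _ fun s => ?_, fun h => absurd h3 h, fun h => absurd h3 h⟩
      rw [hm]
      simp only [map_sub, map_pow, map_one, hX]
      push_cast
      ring

theorem finitelyUniform_mergedTerm (b : Module.Basis (Fin 3) ℤ L) {ι : Type} (j : Fin 3 → ι) :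
    FinitelyUniform (fun p [Fact p.Prime] => mergedTerm L j p) := by
  classical
  obtain ⟨r, bad, split, h⟩ := exists_localFactor b
  have h1 : ∀ p : ℕ, ∃ W, ∀ _ : Fact p.Prime, SeriesEqRat p (mergedTerm L j p) W := by
    intro p
    by_cases hp : Fact p.Prime
    · obtain ⟨e, he⟩ := (h ι j p).1
      exact ⟨_, fun _ => he⟩
    · exact ⟨0, fun h => absurd h hp⟩
  choose W hW using h1
  let F : Finset (RatXY ι) := {localFactor j r (vX ^ 2 - 1), localFactor j r 0,
    localFactor j r (2 * (vX ^ 2 - vX))} ∪ bad.image W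
  refine ⟨F.card, fun i => (F.equivFin.symm i).1, fun p hp => ?_⟩
  suffices hs : ∃ w ∈ F, SeriesEqRat p (mergedTerm L j p) w by
    obtain ⟨w, hw, hs⟩ := hs
    exact ⟨F.equivFin ⟨w, hw⟩, by simpa using hs⟩
  by_cases hb : p ∈ bad
  · exact ⟨W p, Finset.mem_union_right _ (Finset.mem_image_of_mem _ hb), hW p hp⟩
  · obtain ⟨h3, h0, h2⟩ := (h ι j p).2 hb
    by_cases hr : r = 3
    · exact ⟨_, by simp [F], h3 hr⟩
    · by_cases hsp : p ∈ split
      · exact ⟨_, by simp [F], (h2 hr hsp).2⟩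
      · exact ⟨_, by simp [F], h0 hr hsp⟩

/-- The numerators in the split and in the nonsplit case differ. -/
theorem zetaNum_split_ne {ι : Type} (j : Fin 3 → ι) :
    zetaNum j 2 (2 * (vX ^ 2 - vX)) ≠ zetaNum j 2 0 := by
  intro h
  -- the values at the point with all coordinates `2` differ
  have h1 := congrArg (MvPolynomial.eval fun _ => (2 : ℚ)) h
  norm_num [zetaNum, densityNum, densityDen, vX, vY] at h1

/-- Uniformity amounts to a condition on the structure form that does not involve the choice `j` of
the variables. -/
theorem exists_uniform_iff (b : Module.Basis (Fin 3) ℤ L) :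
    ∃ q : Prop, ∀ (ι : Type) (j : Fin 3 → ι),
      Uniform (fun p [Fact p.Prime] => mergedTerm L j p) ↔ q := by
  classical
  obtain ⟨r, bad, split, h⟩ := exists_localFactor b
  refine ⟨r = 3 ∨ {p | p.Prime ∧ p ∈ split}.Finite ∨ {p | p.Prime ∧ p ∉ split}.Finite,
    fun ι j => ⟨?_, ?_⟩⟩
  · rintro ⟨W, E, hW⟩
    by_contra! hq
    obtain ⟨hr, hs, hns⟩ := hq
    obtain ⟨a, d, hd, rfl⟩ := IsFractionRing.div_surjective (A := MvPolynomial (Option ι) ℚ) W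
    have hd0 : d ≠ 0 := nonZeroDivisors.ne_zero hd
    -- on an infinite set of primes with the same local factor, that factor determines `W`
    have key : ∀ (T : Set ℕ) (e : MvPolynomial (Option ι) ℚ), T.Infinite →
        (∀ p (_ : Fact p.Prime), p ∈ T → p ∉ bad →
          SeriesEqRat p (mergedTerm L j p) (localFactor j r e)) → (∀ p ∈ T, p.Prime) →
        a * zetaDen j r = zetaNum j r e * d := by
      intro T e hT hTe hTp
      refine sub_eq_zero.mp (eq_zero_of_specializeX
        (hT.sdiff ((bad ∪ E).finite_toSet)) fun p hp => ?_)
      obtain ⟨hp1, hp2⟩ := hp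
      rw [Finset.mem_coe, Finset.mem_union, not_or] at hp2
      have hpF : Fact p.Prime := ⟨hTp p hp1⟩
      exact specializeX_cross_eq_zero hpF.out.one_lt hd0 (zetaDen_ne_zero j r) (hW p hp2.2)
        (hTe p hpF hp1 hp2.1)
    have k1 := key _ _ hs (fun p _ hp hb => (((h ι j p).2 hb).2.2 hr hp.2).2) fun p hp => hp.1
    have k2 := key _ _ hns (fun p _ hp hb => ((h ι j p).2 hb).2.1 hr hp.2) fun p hp => hp.1
    obtain ⟨p, hp, hb⟩ := (hs.sdiff bad.finite_toSet).nonempty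
    have hpF : Fact p.Prime := ⟨hp.1⟩
    obtain rfl := (((h ι j p).2 hb).2.2 hr hp.2).1
    exact zetaNum_split_ne j (mul_right_cancel₀ hd0 (k1.symm.trans k2))
  · intro hq
    by_cases hr : r = 3
    · exact ⟨_, bad, fun p _ hp => ((h ι j p).2 hp).1 hr⟩
    rcases hq.resolve_left hr with hq | hq
    · refine ⟨localFactor j r 0, bad ∪ hq.toFinset, fun p hpF hp => ?_⟩
      rw [Finset.mem_union, not_or, Set.Finite.mem_toFinset] at hp
      exact ((h ι j p).2 hp.1).2.1 hr fun hs => hp.2 ⟨hpF.out, hs⟩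
    · refine ⟨localFactor j r (2 * (vX ^ 2 - vX)), bad ∪ hq.toFinset, fun p hpF hp => ?_⟩
      rw [Finset.mem_union, not_or, Set.Finite.mem_toFinset] at hp
      exact (((h ι j p).2 hp.1).2.2 hr (by_contra fun hs => hp.2 ⟨hpF.out, hs⟩)).2

end

end CotypeZeta

theorem theorem1p8 (L : Type*) [LieRing L] [Module.Free ℤ L] [Module.Finite ℤ L]
    (hL : Module.finrank ℤ L = 3) :
    ZetaFinitelyUniform L ∧
    (ZetaUniform L ↔ CotypeZetaUniform L 3) ∧
    (ZetaFinitelyUniform L ↔ CotypeZetaFinitelyUniform L 3) := by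
  have b : Module.Basis (Fin 3) ℤ L := Module.finBasisOfFinrankEq ℤ L hL
  have hzeta : (fun (p : ℕ) [Fact p.Prime] => zetaTerm L p)
      = fun (p : ℕ) [Fact p.Prime] => CotypeZeta.mergedTerm L (fun _ => ()) p := by
    funext p hp
    exact CotypeZeta.zetaTerm_eq_mergedTerm b p
  have hfin : ZetaFinitelyUniform L := by
    rw [ZetaFinitelyUniform, hzeta]
    exact CotypeZeta.finitelyUniform_mergedTerm b _
  have hfin' : CotypeZetaFinitelyUniform L 3 := CotypeZeta.finitelyUniform_mergedTerm b id
  obtain ⟨q, hq⟩ := CotypeZeta.exists_uniform_iff b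
  have hu : ZetaUniform L ↔ q := by
    rw [ZetaUniform, hzeta]
    exact hq _ _
  have hu' : CotypeZetaUniform L 3 ↔ q := hq _ id
  exact ⟨hfin, hu.trans hu'.symm, iff_of_true hfin hfin'⟩
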